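/- Conventions. Let $n\ge 0$, $d\ge 1$, $p\ge 0$. Samples $(X_i,y_i,Z_i)_{i=1}^n$ consist of covariates $X_i\in\mathbb R^d$, responses $y_i\in\mathbb R$ and instruments $Z_i\in\mathbb R^p$. Let $X\in\mathbb R^{n\times d}$ and $Z\in\mathbb R^{n\times p}$ be the matrices with rows $X_i$ and $Z_i$, and let $\tilde X\in\mathbb R^{n\times(d-1)}$ be $X$ with its first column removed. For $w\in[0,1]^n$ put $$\mathrm{IV}(X,y,Z,w)=\{\beta\in\mathbb R^d:\ Z^{T}(w\star(X\beta-y))=0\},$$ where $\star$ is the elementwise product, and define the IV stability $$\mathrm{Stab}_{\mathrm{IV}}(X,y,Z)=\inf\{\,n-\|w\|_1:\ w\in[0,1]^n,\ \beta\in\mathrm{IV}(X,y,Z,w),\ \beta_1=0\,\}.$$ For $\varepsilon,\delta>0$ the samples satisfy $(\varepsilon,\delta)$-strong anti-concentration if for every $\alpha\in\mathbb R^p$ and every $\beta\in\mathbb R^{d-1}$ $$\bigl|\{i: |\langle Z_i,\alpha\rangle|<\tfrac{\delta}{\sqrt n}\|Z\alpha\|_2\}\bigr|\le\varepsilon n \quad\text{and}\quad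 \bigl|\{i: |\langle\tilde X_i,\beta\rangle-y_i|<\tfrac{\delta}{\sqrt n}\|\tilde X\beta-y\|_2\}\bigr|\le\varepsilon n .$$ Algorithms are programs for a deterministic real random access machine: memory cells hold natural numbers (for counting and indirect addressing) or real numbers, each of the real operations $+,-,\times,\div,\sqrt{\ }$, each comparison, and each addition, subtraction, copy or constant load on addresses costs one step, and there is no rounding from reals to integers. Theorem. There are a single program and constants $C,k\in\mathbb N$ such that for all $n\ge 0$, $d\ge1$, $p\ge0$, all $\varepsilon,\delta>0$ and all real samples $(X_i,y_i,Z_i)_{i=1}^n$, the program, given $n,d,p,\varepsilon,\delta$ and the samples, halts within $$C\,(n+p+1)^{k}\cdot\max\Bigl\{1,\Bigl(\frac{\sqrt d}{\varepsilon\delta^2}\Bigr)^{d}\Bigr\}$$ steps with a real output $\hat S$, and if the samples satisfy $(\varepsilon,\delta)$-strong anti-concentration then $$\mathrm{Stab}_{\mathrm{IV}}(X,y,Z)\ \le\ \hat S\ \le\ \mathrm{Stab}_{\mathrm{IV}}(X,y,Z)+3\varepsilon n+1 .$$ -/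

import Mathlib

open scoped Matrix

/-! ## Instrumental variables regression -/

/-- The weighted IV estimator set `{β : Zᵀ (w ⋆ (X β - y)) = 0}`, with `⋆` the elementwise
product (the multiplication of functions `Fin n → ℝ`). -/
def ivSet {n d p : ℕ} (X : Matrix (Fin n) (Fin d) ℝ) (y : Fin n → ℝ)
    (Z : Matrix (Fin n) (Fin p) ℝ) (w : Fin n → ℝ) : Set (Fin d → ℝ) :=
  {β | Zᵀ *ᵥ (w * (X *ᵥ β - y)) = 0}

/-- Finite-sample stability of the first coefficient (index `0`): the infimum of `n - ‖w‖₁`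
over all `w ∈ [0,1]ⁿ` and all `β` with vanishing first coordinate in the weighted IV estimator
set. The set below is non-empty (take `w = 0`) and bounded below by `0`. -/
noncomputable def ivStability {n d p : ℕ} [NeZero d] (X : Matrix (Fin n) (Fin d) ℝ)
    (y : Fin n → ℝ) (Z : Matrix (Fin n) (Fin p) ℝ) : ℝ :=
  sInf {r : ℝ | ∃ (w : Fin n → ℝ) (β : Fin d → ℝ),
    (∀ i, w i ∈ Set.Icc (0 : ℝ) 1) ∧ β 0 = 0 ∧ β ∈ ivSet X y Z w ∧ r = n - ∑ i, |w i|}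

/-- The matrix `X` with its first column removed. -/
def dropFirst {n d : ℕ} [NeZero d] (X : Matrix (Fin n) (Fin d) ℝ) :
    Matrix (Fin n) {j : Fin d // j ≠ 0} ℝ :=
  X.submatrix id Subtype.val

/-- At most `ε n` of the entries of `v ∈ ℝⁿ` are smaller in magnitude than `(δ / √n) ‖v‖₂`. -/
def FewSmallEntries {n : ℕ} (ε δ : ℝ) (v : Fin n → ℝ) : Prop :=
  ({i : Fin n | |v i| < δ / √(n : ℝ) * ‖WithLp.toLp 2 v‖}.ncard : ℝ) ≤ ε * n

/-- `(ε, δ)`-strong anti-concentration of IV data, for the instruments and for the residuals. -/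
def IVStrongAntiConcentration {n d p : ℕ} [NeZero d] (ε δ : ℝ) (X : Matrix (Fin n) (Fin d) ℝ)
    (y : Fin n → ℝ) (Z : Matrix (Fin n) (Fin p) ℝ) : Prop :=
  (∀ α : Fin p → ℝ, FewSmallEntries ε δ (Z *ᵥ α)) ∧
  (∀ β : {j : Fin d // j ≠ 0} → ℝ, FewSmallEntries ε δ (dropFirst X *ᵥ β - y))

/-! ## The real random access machine

Programs are finite texts, independent of the input. The memory consists of numbered arrays of
natural numbers (used for counting and addressing) and numbered arrays of real numbers. Every
elementary instruction and every test costs one step. Reals support `+ - * / √` and comparisons,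
words support constants, `+`, truncated `-` and comparisons. There is no conversion from reals
to words (no rounding), no multiplication of words, and there are no built-in real constants
other than the natural numbers. -/

namespace RealRAM

/-- Memory: cell `i` of word array `a` is `word a i`, cell `i` of real array `a` is `real a i`. -/
structure State where
  word : ℕ → ℕ → ℕ
  real : ℕ → ℕ → ℝ

/-- Addressing modes: `cell a i` is cell `i` of array `a`; `ind a b j` is the cell of array `a`
whose index is the current content of cell `j` of word array `b` (indirect addressing). -/
inductive Loc where
  | cell (a i : ℕ)
  | ind (a b j : ℕ)

/-- The array that a location lies in. -/
def Loc.array : Loc → ℕ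
  | .cell a _ => a
  | .ind a _ _ => a

/-- The index, inside its array, that a location has in a given state. -/
def Loc.index (s : State) : Loc → ℕ
  | .cell _ i => i
  | .ind _ b j => s.word b j

/-- The word stored at a location. -/
def State.getWord (s : State) (l : Loc) : ℕ := s.word l.array (l.index s)

/-- The real number stored at a location. -/
def State.getReal (s : State) (l : Loc) : ℝ := s.real l.array (l.index s)

/-- Store a word at a location (of the word memory). -/
def State.setWord (s : State) (l : Loc) (v : ℕ) : State :=
  { s with word := fun a i => if a = l.array ∧ i = l.index s then v else s.word a i }

/-- Store a real number at a location (of the real memory). -/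
noncomputable def State.setReal (s : State) (l : Loc) (v : ℝ) : State :=
  { s with real := fun a i => if a = l.array ∧ i = l.index s then v else s.real a i }

/-- Elementary instructions; the first argument is the location that is written. -/
inductive Instr where
  | skip
  | wconst (l : Loc) (c : ℕ)
  | wmove (l a : Loc)
  | wadd (l a b : Loc)
  | wsub (l a b : Loc)
  | rcast (l a : Loc)
  | rmove (l a : Loc)
  | radd (l a b : Loc)
  | rsub (l a b : Loc)
  | rmul (l a b : Loc)
  | rdiv (l a b : Loc)
  | rsqrt (l a : Loc)

/-- Effect of an instruction. Division by `0` and the root of a negative number give `0`. -/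
noncomputable def Instr.apply (s : State) : Instr → State
  | .skip => s
  | .wconst l c => s.setWord l c
  | .wmove l a => s.setWord l (s.getWord a)
  | .wadd l a b => s.setWord l (s.getWord a + s.getWord b)
  | .wsub l a b => s.setWord l (s.getWord a - s.getWord b)
  | .rcast l a => s.setReal l (s.getWord a : ℝ)
  | .rmove l a => s.setReal l (s.getReal a)
  | .radd l a b => s.setReal l (s.getReal a + s.getReal b)
  | .rsub l a b => s.setReal l (s.getReal a - s.getReal b)
  | .rmul l a b => s.setReal l (s.getReal a * s.getReal b)
  | .rdiv l a b => s.setReal l (s.getReal a / s.getReal b)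
  | .rsqrt l a => s.setReal l √(s.getReal a)

/-- Tests: comparisons of two words or of two real numbers. -/
inductive Test where
  | wle (a b : Loc)
  | wlt (a b : Loc)
  | rle (a b : Loc)
  | rlt (a b : Loc)

/-- Truth of a test in a state. -/
def Test.Holds (s : State) : Test → Prop
  | .wle a b => s.getWord a ≤ s.getWord b
  | .wlt a b => s.getWord a < s.getWord b
  | .rle a b => s.getReal a ≤ s.getReal b
  | .rlt a b => s.getReal a < s.getReal b

/-- Programs: instructions, sequencing, branching, and while loops. -/
inductive Program where
  | instr (i : Instr)
  | seq (P Q : Program)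
  | ite (c : Test) (P Q : Program)
  | loop (c : Test) (P : Program)

/-- `Exec P s t s'`: started in state `s`, the program `P` halts after exactly `t` steps in
state `s'`. -/
inductive Exec : Program → State → ℕ → State → Prop where
  | instr (i : Instr) (s : State) : Exec (.instr i) s 1 (i.apply s)
  | seq {P Q : Program} {s s' s'' : State} {t t' : ℕ} :
      Exec P s t s' → Exec Q s' t' s'' → Exec (.seq P Q) s (t + t') s''
  | ite_true {c : Test} {P Q : Program} {s s' : State} {t : ℕ} :
      c.Holds s → Exec P s t s' → Exec (.ite c P Q) s (t + 1) s'
  | ite_false {c : Test} {P Q : Program} {s s' : State} {t : ℕ} :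
      ¬ c.Holds s → Exec Q s t s' → Exec (.ite c P Q) s (t + 1) s'
  | loop_done {c : Test} {P : Program} {s : State} :
      ¬ c.Holds s → Exec (.loop c P) s 1 s
  | loop_step {c : Test} {P : Program} {s s' s'' : State} {t t' : ℕ} :
      c.Holds s → Exec P s t s' → Exec (.loop c P) s' t' s'' →
        Exec (.loop c P) s (t + t' + 1) s''

/-- Row-major listing of a matrix, continued by `0`. -/
def rowMajor {n m : ℕ} (A : Matrix (Fin n) (Fin m) ℝ) (k : ℕ) : ℝ :=
  if h : k < n * m then A (Fin.divNat ⟨k, h⟩) (Fin.modNat ⟨k, h⟩) else 0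

/-- Initial memory: word array `0` holds `n, d, p`; real array `0` holds `ε, δ`; real arrays
`1`, `2`, `3` hold `X` (row-major), `y` and `Z` (row-major); all other cells are `0`. -/
def input {n d p : ℕ} (ε δ : ℝ) (X : Matrix (Fin n) (Fin d) ℝ) (y : Fin n → ℝ)
    (Z : Matrix (Fin n) (Fin p) ℝ) : State where
  word
    | 0, 0 => n
    | 0, 1 => d
    | 0, 2 => p
    | _, _ => 0
  real
    | 0, 0 => ε
    | 0, 1 => δ
    | 1, k => rowMajor X k
    | 2, k => if h : k < n then y ⟨k, h⟩ else 0
    | 3, k => rowMajor Z k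
    | _, _ => 0

/-- The output of a computation is the content of cell `0` of real array `0`. -/
def State.output (s : State) : ℝ := s.real 0 0

end RealRAM

/-! For a fixed `β` with residual `u = X β - y`, `β 0 = 0`, the largest total weight of a solution
`w ∈ [0,1]ⁿ` of `Zᵀ (w ⋆ u) = 0` is the value of a linear program. Its dual is to minimize the hinge
loss `∑ max(0, 1 - uᵢ (Zα)ᵢ)` over `α` (`sum_le_hingeLoss`, `exists_weights_of_le_hingeLoss`). The
equations are homogeneous in `u`, so only the direction of `u` matters: the stability is `n` minus
the supremum of this minimum over the directions in the span of the last `d - 1` columns of `X` and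
of `y` in which `y` occurs with nonzero coefficient.

Three approximations make this computable. Let `R = n / δ²` and `γ = ε δ²`. By anti-concentration of
`u` and of `Zα`, the dual vector `Zα` can be shrunk to norm at most `R` while the loss grows by at
most `2εn` (`exists_smul_hingeLoss_le`). For dual vectors in this ball the loss is `R`-Lipschitz in
`u` (`hingeLoss_le_add`), so a net of directions of resolution `γ` costs at most `γ R = εn`
(`exists_netPoint_near`). At each point of the net, a primal-dual (Chambolle–Pock) iteration with
step sizes `R` and `1/R` reaches the minimum over the ball up to `1` within `⌈nR⌉` rounds
(`primalDual_gap`, `IsPrimalDual.value_le`). If `b` is the best value found, the stability lies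
between `n - b - εn` and `n - b + 2εn + 1` (`le_ivStability_of_isBest`,
`ivStability_le_of_isValue`), and the upper bound is the output.

The net lives in Gram–Schmidt coordinates of the residual space. All coordinates but the last are
integers, and the last is what their absolute values leave of the width `L = 2d/γ`. An odometer
enumerates at most `15^d / γ^(d-1)` positions (`odometer_spec`, `odometerLength_le`). The number of
rounds per point supplies the missing factor `1/γ`, and `15^d` and the powers of `d` are absorbed
into `√d ^ d`.

Three cases are settled directly. If `ε ≥ 1/2`, the answer `n` is accurate enough. If `ε < 1/2` and
`γ ≥ 1`, anti-concentration forces all residuals to vanish, and the answer is `0`. If `y` depends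
linearly on the columns, full weight is feasible and the answer is again `0`.

The program is written in a language of counted loops, whose compilation to the machine is proved
correct with polynomial cost. Reals cannot be rounded to words, so the two data-dependent loops,
over the net and over the iteration, are controlled by real comparisons. -/

namespace RealRAM

open Finset Function

/-! ### A small language of counted loops over real arrays, compiled to the machine -/

/-- Indices into arrays: `lin v m u c` is `v * m + u + c`, with `v`, `m`, `u` word variables. -/
inductive Ix where
  | const (c : ℕ)
  | var (v : ℕ)
  | lin (v m u c : ℕ)

/-- Value of an index. -/
def Ix.eval (w : ℕ → ℕ) : Ix → ℕ
  | .const c => c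
  | .var v => w v
  | .lin v m u c => w v * w m + w u + c

/-- Real expressions. `ifLt a b x y` is `x` if `a < b` and `y` otherwise; `sum v m e` is the sum
of `e` over all values `v < m`. -/
inductive RExpr where
  | lit (c : ℕ)
  | cast (v : ℕ)
  | get (a : ℕ) (ix : Ix)
  | add (e f : RExpr)
  | sub (e f : RExpr)
  | mul (e f : RExpr)
  | div (e f : RExpr)
  | sqrt (e : RExpr)
  | ifLt (e f x y : RExpr)
  | sum (v m : ℕ) (e : RExpr)

open Classical in
/-- Value of a real expression, given the word variables and the real arrays. -/
noncomputable def RExpr.eval (r : ℕ → ℕ → ℝ) : RExpr → (ℕ → ℕ) → ℝ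
  | .lit c, _ => c
  | .cast v, w => w v
  | .get a ix, w => r a (ix.eval w)
  | .add e f, w => e.eval r w + f.eval r w
  | .sub e f, w => e.eval r w - f.eval r w
  | .mul e f, w => e.eval r w * f.eval r w
  | .div e f, w => e.eval r w / f.eval r w
  | .sqrt e, w => √(e.eval r w)
  | .ifLt e f x y, w => if e.eval r w < f.eval r w then x.eval r w else y.eval r w
  | .sum v m e, w => ∑ i ∈ range (w m), e.eval r (update w v i)

/-- Commands: assignment to a cell of a real array, sequencing, and the loop `v = 0, …, m - 1`. -/
inductive Cmd where
  | set (a : ℕ) (ix : Ix) (e : RExpr)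
  | seq (c d : Cmd)
  | rep (v m : ℕ) (c : Cmd)

/-- The real arrays after the first `i` rounds of a counted loop. -/
def iter (f : ℕ → (ℕ → ℕ → ℝ) → ℕ → ℕ → ℝ) (r : ℕ → ℕ → ℝ) : ℕ → ℕ → ℕ → ℝ
  | 0 => r
  | i + 1 => f i (iter f r i)

/-- Write one cell. -/
noncomputable def put (r : ℕ → ℕ → ℝ) (a i : ℕ) (x : ℝ) : ℕ → ℕ → ℝ :=
  update r a (update (r a) i x)

/-- The real arrays after execution of a command. -/
noncomputable def Cmd.eval : Cmd → (ℕ → ℕ) → (ℕ → ℕ → ℝ) → ℕ → ℕ → ℝ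
  | .set a ix e, w, r => put r a (ix.eval w) (e.eval r w)
  | .seq c d, w, r => d.eval w (c.eval w r)
  | .rep v m c, w, r => iter (fun i r' => c.eval (update w v i) r') r (w m)

/-- Sequencing of several programs. -/
def Program.block : List Program → Program
  | [] => .instr .skip
  | [P] => P
  | P :: Ps => .seq P (Program.block Ps)

/-- Evaluate an index into temporary word `3 k`. -/
def Ix.compile (k : ℕ) : Ix → Program
  | .const c => .instr (.wconst (.cell 1 (3 * k)) c)
  | .var v => .instr (.wmove (.cell 1 (3 * k)) (.cell 0 v))
  | .lin v m u c => .block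
      [.instr (.wconst (.cell 1 (3 * k)) c),
       .instr (.wadd (.cell 1 (3 * k)) (.cell 1 (3 * k)) (.cell 0 u)),
       .instr (.wconst (.cell 1 (3 * k + 2)) 1),
       .instr (.wmove (.cell 1 (3 * k + 1)) (.cell 0 v)),
       .loop (.wle (.cell 1 (3 * k + 2)) (.cell 1 (3 * k + 1)))
        (.seq (.instr (.wadd (.cell 1 (3 * k)) (.cell 1 (3 * k)) (.cell 0 m)))
          (.instr (.wsub (.cell 1 (3 * k + 1)) (.cell 1 (3 * k + 1)) (.cell 1 (3 * k + 2)))))]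

/-- The loop `v = 0, …, m - 1` around a program; the variable `v` is restored at the end. -/
def countLoop (k v m : ℕ) (P : Program) : Program := .block
  [.instr (.wmove (.cell 1 (3 * k)) (.cell 0 v)),
   .instr (.wmove (.cell 1 (3 * k + 1)) (.cell 0 m)),
   .instr (.wconst (.cell 0 v) 0),
   .loop (.wlt (.cell 0 v) (.cell 1 (3 * k + 1)))
     (.block [P, .instr (.wconst (.cell 1 (3 * k + 2)) 1),
       .instr (.wadd (.cell 0 v) (.cell 0 v) (.cell 1 (3 * k + 2)))]),
   .instr (.wmove (.cell 0 v) (.cell 1 (3 * k)))]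

/-- Evaluate an expression into temporary real `k`. -/
def RExpr.compile : RExpr → ℕ → Program
  | .lit c, k => .seq (.instr (.wconst (.cell 1 (3 * k)) c))
      (.instr (.rcast (.cell 0 k) (.cell 1 (3 * k))))
  | .cast v, k => .instr (.rcast (.cell 0 k) (.cell 0 v))
  | .get a ix, k => .seq (ix.compile k) (.instr (.rmove (.cell 0 k) (.ind (a + 1) 1 (3 * k))))
  | .add e f, k => .block [e.compile k, f.compile (k + 1),
      .instr (.radd (.cell 0 k) (.cell 0 k) (.cell 0 (k + 1)))]
  | .sub e f, k => .block [e.compile k, f.compile (k + 1),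
      .instr (.rsub (.cell 0 k) (.cell 0 k) (.cell 0 (k + 1)))]
  | .mul e f, k => .block [e.compile k, f.compile (k + 1),
      .instr (.rmul (.cell 0 k) (.cell 0 k) (.cell 0 (k + 1)))]
  | .div e f, k => .block [e.compile k, f.compile (k + 1),
      .instr (.rdiv (.cell 0 k) (.cell 0 k) (.cell 0 (k + 1)))]
  | .sqrt e, k => .seq (e.compile k) (.instr (.rsqrt (.cell 0 k) (.cell 0 k)))
  | .ifLt e f x y, k => .block [e.compile k, f.compile (k + 1),
      .ite (.rlt (.cell 0 k) (.cell 0 (k + 1))) (x.compile k) (y.compile k)]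
  | .sum v m e, k => .block
      [.instr (.wconst (.cell 1 (3 * k)) 0), .instr (.rcast (.cell 0 k) (.cell 1 (3 * k))),
       countLoop k v m (.seq (e.compile (k + 1))
         (.instr (.radd (.cell 0 k) (.cell 0 k) (.cell 0 (k + 1)))))]

/-- The program of a command, using temporaries from level `k` on. -/
def Cmd.compile : Cmd → ℕ → Program
  | .set a ix e, k => .block [e.compile k, ix.compile (k + 1),
      .instr (.rmove (.ind (a + 1) 1 (3 * (k + 1))) (.cell 0 k))]
  | .seq c d, k => .seq (c.compile k) (d.compile k)
  | .rep v m c, k => countLoop k v m (c.compile (k + 1))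

/-- Cost of an index when all word variables are at most `B`. -/
def Ix.cost (B : ℕ) : Ix → ℕ
  | .const _ => 1
  | .var _ => 1
  | .lin _ _ _ _ => 3 * B + 5

/-- Cost of an expression when all word variables are at most `B`. -/
def RExpr.cost (B : ℕ) : RExpr → ℕ
  | .lit _ => 2
  | .cast _ => 1
  | .get _ ix => ix.cost B + 1
  | .add e f => e.cost B + f.cost B + 1
  | .sub e f => e.cost B + f.cost B + 1
  | .mul e f => e.cost B + f.cost B + 1
  | .div e f => e.cost B + f.cost B + 1
  | .sqrt e => e.cost B + 1
  | .ifLt e f x y => e.cost B + f.cost B + x.cost B + y.cost B + 1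
  | .sum _ _ e => B * (e.cost B + 4) + 7

/-- Cost of a command when all word variables are at most `B`. -/
def Cmd.cost (B : ℕ) : Cmd → ℕ
  | .set _ ix e => e.cost B + ix.cost B + 1
  | .seq c d => c.cost B + d.cost B
  | .rep _ _ c => B * (c.cost B + 3) + 5

/-! ### Halting within a time bound, and correctness of the compilation. -/

/-- `P` halts from `s` within `t` steps in a state satisfying `Q`. -/
def Halts (P : Program) (s : State) (t : ℕ) (Q : State → Prop) : Prop :=
  ∃ t' s', Exec P s t' s' ∧ t' ≤ t ∧ Q s'

theorem Halts.mono {P : Program} {s : State} {t t' : ℕ} {Q Q' : State → Prop}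
    (h : Halts P s t Q) (ht : t ≤ t') (hQ : ∀ s', Q s' → Q' s') : Halts P s t' Q' := by
  obtain ⟨t₁, s', h₁, h₂, h₃⟩ := h
  exact ⟨t₁, s', h₁, h₂.trans ht, hQ _ h₃⟩

theorem Halts.seq {P P' : Program} {s : State} {t t' : ℕ} {Q : State → Prop}
    (h : Halts P s t fun s' => Halts P' s' t' Q) : Halts (.seq P P') s (t + t') Q := by
  obtain ⟨t₁, s₁, h₁, h₂, t₂, s₂, h₃, h₄, h₅⟩ := h
  exact ⟨_, _, .seq h₁ h₃, by omega, h₅⟩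

theorem Halts.block_cons {P P' : Program} {Ps : List Program} {s : State} {t t' : ℕ}
    {Q : State → Prop} (h : Halts P s t fun s' => Halts (.block (P' :: Ps)) s' t' Q) :
    Halts (.block (P :: P' :: Ps)) s (t + t') Q := h.seq

theorem Halts.block_single {P : Program} {s : State} {t : ℕ}
    {Q : State → Prop} (h : Halts P s t Q) : Halts (.block [P]) s t Q := h

theorem Halts.instr {i : Instr} {s : State} {Q : State → Prop} (h : Q (i.apply s)) :
    Halts (.instr i) s 1 Q := ⟨_, _, .instr i s, le_rfl, h⟩

theorem Halts.ite {c : Test} {P P' : Program} {s : State} {t t' : ℕ} {Q : State → Prop}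
    (h : c.Holds s → Halts P s t Q) (h' : ¬ c.Holds s → Halts P' s t' Q) :
    Halts (.ite c P P') s (t + t' + 1) Q := by
  by_cases hc : c.Holds s
  · obtain ⟨t₁, s₁, h₁, h₂, h₃⟩ := h hc
    exact ⟨_, _, .ite_true hc h₁, by omega, h₃⟩
  · obtain ⟨t₁, s₁, h₁, h₂, h₃⟩ := h' hc
    exact ⟨_, _, .ite_false hc h₁, by omega, h₃⟩

/-- A loop that runs through the invariants `I 0, …, I N`. -/
theorem Halts.loop {c : Test} {P : Program} {t : ℕ} (I : ℕ → State → Prop) :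
    ∀ (N : ℕ) (s : State), I 0 s → (∀ i < N, ∀ s, I i s → c.Holds s) →
      (∀ s, I N s → ¬ c.Holds s) → (∀ i < N, ∀ s, I i s → Halts P s t (I (i + 1))) →
      Halts (.loop c P) s (N * (t + 1) + 1) (I N) := by
  intro N
  induction N generalizing I with
  | zero =>
    intro s h0 _ hN _
    exact ⟨_, _, .loop_done (hN s h0), by omega, h0⟩
  | succ N ih =>
    intro s h0 hlt hN hstep
    obtain ⟨t₁, s₁, h₁, h₂, h₃⟩ := hstep 0 (by omega) s h0
    obtain ⟨t₂, s₂, h₄, h₅, h₆⟩ := ih (fun i => I (i + 1)) s₁ h₃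
      (fun i hi => hlt (i + 1) (by omega)) hN (fun i hi => hstep (i + 1) (by omega))
    refine ⟨_, _, .loop_step (hlt 0 (by omega) s h0) h₁ h₄, ?_, h₆⟩
    calc t₁ + t₂ + 1 ≤ t + (N * (t + 1) + 1) + 1 := by omega
      _ = (N + 1) * (t + 1) + 1 := by ring

/-- The state holds the word variables `w` and the real arrays `r`. -/
def Rel (s : State) (w : ℕ → ℕ) (r : ℕ → ℕ → ℝ) : Prop :=
  s.word 0 = w ∧ ∀ a, s.real (a + 1) = r a

/-- Temporaries below level `k` agree. -/
def Keep (k : ℕ) (s s' : State) : Prop :=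
  (∀ j < k, s'.real 0 j = s.real 0 j) ∧ ∀ j < 3 * k, s'.word 1 j = s.word 1 j

theorem Keep.trans {k k' : ℕ} {s s' s'' : State} (h : Keep k s s') (h' : Keep k' s' s'')
    (hk : k ≤ k') : Keep k s s'' :=
  ⟨fun j hj => (h'.1 j (by omega)).trans (h.1 j hj),
    fun j hj => (h'.2 j (by omega)).trans (h.2 j hj)⟩

/-- Words cannot be multiplied, so the product in `lin` is accumulated by repeated addition; this is
why the cost is linear in `B`. -/
theorem Ix.halts (ix : Ix) (k : ℕ) {s : State} {w : ℕ → ℕ} {B : ℕ}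
    (hs : s.word 0 = w) (hB : ∀ v, w v ≤ B) :
    Halts (ix.compile k) s (ix.cost B) fun s' => s'.real = s.real ∧ s'.word 0 = w ∧
      (∀ j < 3 * k, s'.word 1 j = s.word 1 j) ∧ s'.word 1 (3 * k) = ix.eval w := by
  subst hs
  cases ix with
  | const c =>
    refine Halts.instr ⟨rfl, ?_, ?_, ?_⟩
    · ext; simp [Instr.apply, State.setWord, Loc.array]
    · intro j hj; simp [Instr.apply, State.setWord, Loc.array, Loc.index]; omega
    · simp [Instr.apply, State.setWord, Loc.array, Loc.index, Ix.eval]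
  | var v =>
    refine Halts.instr ⟨rfl, ?_, ?_, ?_⟩
    · ext; simp [Instr.apply, State.setWord, Loc.array]
    · intro j hj; simp [Instr.apply, State.setWord, Loc.array, Loc.index]; omega
    · simp [Instr.apply, State.setWord, State.getWord, Loc.array, Loc.index, Ix.eval]
  | lin v m u c =>
    refine Halts.mono (t := 1 + (1 + (1 + (1 + (s.word 0 v * (2 + 1) + 1)))))
      (Halts.block_cons <| Halts.instr <| Halts.block_cons <| Halts.instr <| Halts.block_cons <|
      Halts.instr <| Halts.block_cons <| Halts.instr <| Halts.block_single <|
      Halts.loop (fun i s' => s'.real = s.real ∧ s'.word 0 = s.word 0 ∧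
        (∀ j < 3 * k, s'.word 1 j = s.word 1 j) ∧ s'.word 1 (3 * k + 2) = 1 ∧
        s'.word 1 (3 * k + 1) = s.word 0 v - i ∧
        s'.word 1 (3 * k) = i * s.word 0 m + s.word 0 u + c) (s.word 0 v) _ ?_ ?_ ?_ ?_) ?_ ?_
    · refine ⟨rfl, ?_, ?_, ?_, ?_, ?_⟩
      · ext; simp [Instr.apply, State.setWord, Loc.array]
      · intro j hj
        have h1 : j ≠ 3 * k := by omega
        have h2 : j ≠ 3 * k + 1 := by omega
        have h3 : j ≠ 3 * k + 2 := by omega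
        simp [Instr.apply, State.setWord, Loc.array, Loc.index, h1, h2, h3]
      · simp [Instr.apply, State.setWord, State.getWord, Loc.array, Loc.index]
      · simp [Instr.apply, State.setWord, State.getWord, Loc.array, Loc.index]
      · simp [Instr.apply, State.setWord, State.getWord, Loc.array, Loc.index, add_comm]
    · rintro i hi s' ⟨-, -, -, h1, h2, -⟩
      simp only [Test.Holds, State.getWord, Loc.array, Loc.index, h1, h2]; omega
    · rintro s' ⟨-, -, -, h1, h2, -⟩
      simp only [Test.Holds, State.getWord, Loc.array, Loc.index, h1, h2]; omega
    · rintro i hi s' ⟨h1, h2, h3, h4, h5, h6⟩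
      refine Halts.mono (t := 1 + 1) (Halts.seq <| Halts.instr <| Halts.instr ?_) le_rfl
        (fun _ h => h)
      refine ⟨h1, ?_, ?_, ?_, ?_, ?_⟩
      · rw [← h2]; ext; simp [Instr.apply, State.setWord, Loc.array]
      · intro j hj
        have h1 : j ≠ 3 * k := by omega
        have h2 : j ≠ 3 * k + 1 := by omega
        simp [Instr.apply, State.setWord, Loc.array, Loc.index, h1, h2, h3 j hj]
      · simp [Instr.apply, State.setWord, State.getWord, Loc.array, Loc.index, h4]
      · simp [Instr.apply, State.setWord, State.getWord, Loc.array, Loc.index, h4, h5]; omega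
      · simp [Instr.apply, State.setWord, State.getWord, Loc.array, Loc.index, h6, h2]; ring
    · have := hB v
      simp only [Ix.cost]; omega
    · rintro s' ⟨h1, h2, h3, h4, h5, h6⟩
      exact ⟨h1, h2, h3, h6⟩

/-- The bound and the old value of the loop variable sit in the temporary words of level `k`. A body
that preserves everything below level `k + 1` cannot disturb them, so the number of rounds is fixed
on entry. -/
theorem countLoop_halts {k v m tb : ℕ} {P : Program} {w : ℕ → ℕ} {s : State}
    (I : ℕ → (ℕ → ℕ → ℝ) → Prop) (hs : s.word 0 = w) (h0 : I 0 s.real)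
    (hP : ∀ i < w m, ∀ s, s.word 0 = update w v i → I i s.real → Halts P s tb fun s' =>
      s'.word 0 = update w v i ∧ (∀ j < 3 * (k + 1), s'.word 1 j = s.word 1 j) ∧
        I (i + 1) s'.real) :
    Halts (countLoop k v m P) s (w m * (tb + 3) + 5) fun s' => s'.word 0 = w ∧
      (∀ j < 3 * k, s'.word 1 j = s.word 1 j) ∧ I (w m) s'.real := by
  subst hs
  refine Halts.mono (t := 1 + (1 + (1 + (s.word 0 m * ((tb + (1 + 1)) + 1) + 1 + 1))))
    (Halts.block_cons <| Halts.instr <| Halts.block_cons <| Halts.instr <| Halts.block_cons <|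
    Halts.instr <| Halts.block_cons <|
    Halts.mono (Halts.loop (fun i s' => s'.word 0 = update (s.word 0) v i ∧
        (∀ j < 3 * k, s'.word 1 j = s.word 1 j) ∧ s'.word 1 (3 * k) = s.word 0 v ∧
        s'.word 1 (3 * k + 1) = s.word 0 m ∧ I i s'.real) (s.word 0 m) _ ?_ ?_ ?_ ?_) le_rfl ?_)
      ?_ (fun _ h => h)
  · refine ⟨?_, ?_, ?_, ?_, h0⟩
    · ext x; simp [Instr.apply, State.setWord, Loc.array, Loc.index, update_apply]
    · intro j hj
      have h1 : j ≠ 3 * k := by omega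
      have h2 : j ≠ 3 * k + 1 := by omega
      simp [Instr.apply, State.setWord, Loc.array, Loc.index, h1, h2]
    · simp [Instr.apply, State.setWord, State.getWord, Loc.array, Loc.index]
    · simp [Instr.apply, State.setWord, State.getWord, Loc.array, Loc.index]
  · rintro i hi s' ⟨h1, -, -, h2, -⟩
    simpa [Test.Holds, State.getWord, Loc.array, Loc.index, h1, h2] using hi
  · rintro s' ⟨h1, -, -, h2, -⟩
    simp [Test.Holds, State.getWord, Loc.array, Loc.index, h1, h2]
  · rintro i hi s' ⟨h1, h2, h3, h4, h5⟩
    refine Halts.block_cons <| (hP i hi s' h1 h5).mono le_rfl fun s₁ h => Halts.block_cons <|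
      Halts.instr <| Halts.block_single <| Halts.instr ?_
    obtain ⟨g1, g2, g3⟩ := h
    refine ⟨?_, ?_, ?_, ?_, g3⟩
    · ext x
      by_cases hx : x = v
      · simp [Instr.apply, State.setWord, State.getWord, Loc.array, Loc.index, hx, g1]
      · simp [Instr.apply, State.setWord, State.getWord, Loc.array, Loc.index, hx, g1]
    · intro j hj
      have e1 : j ≠ 3 * k + 2 := by omega
      simp [Instr.apply, State.setWord, Loc.array, Loc.index, e1, g2 j (by omega), h2 j hj]
    · simp [Instr.apply, State.setWord, State.getWord, Loc.array, Loc.index,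
        g2 (3 * k) (by omega), h3]
    · simp [Instr.apply, State.setWord, State.getWord, Loc.array, Loc.index,
        g2 (3 * k + 1) (by omega), h4]
  · rintro s' ⟨h1, h2, h3, -, h5⟩
    refine Halts.block_single <| Halts.instr ⟨?_, ?_, h5⟩
    · ext x
      by_cases hx : x = v
      · simp [Instr.apply, State.setWord, State.getWord, Loc.array, Loc.index, hx, h3]
      · simp [Instr.apply, State.setWord, State.getWord, Loc.array, Loc.index, hx, h1]
    · intro j hj
      simp [Instr.apply, State.setWord, Loc.array, h2 j hj]
  · have : s.word 0 m * (tb + (1 + 1) + 1) = s.word 0 m * (tb + 3) := by ring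
    omega

theorem binop_halts {k te tf : ℕ} {Pe Pf : Program} {i : Instr} {op : ℝ → ℝ → ℝ} {s : State}
    {w : ℕ → ℕ} {r : ℕ → ℕ → ℝ} {x y : ℝ}
    (hi : ∀ s, i.apply s = s.setReal (.cell 0 k) (op (s.real 0 k) (s.real 0 (k + 1))))
    (he : Halts Pe s te fun s' => Rel s' w r ∧ Keep k s s' ∧ s'.real 0 k = x)
    (hf : ∀ s, Rel s w r →
      Halts Pf s tf fun s' => Rel s' w r ∧ Keep (k + 1) s s' ∧ s'.real 0 (k + 1) = y) :
    Halts (.block [Pe, Pf, .instr i]) s (te + tf + 1) fun s' =>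
      Rel s' w r ∧ Keep k s s' ∧ s'.real 0 k = op x y := by
  refine Halts.mono (t := te + (tf + 1)) (Halts.block_cons <| he.mono le_rfl ?_) (by omega)
    (fun _ h => h)
  rintro s₁ ⟨h1, h2, h3⟩
  refine Halts.block_cons <| (hf s₁ h1).mono le_rfl ?_
  rintro s₂ ⟨g1, g2, g3⟩
  refine Halts.block_single <| Halts.instr ?_
  rw [hi]
  refine ⟨⟨g1.1, fun a => ?_⟩, ⟨fun j hj => ?_, fun j hj => ?_⟩, ?_⟩
  · rw [← g1.2]; ext; simp [State.setReal, Loc.array]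
  · have e1 : j ≠ k := by omega
    simp [State.setReal, Loc.array, Loc.index, e1, g2.1 j (by omega), h2.1 j hj]
  · exact (g2.2 j (by omega)).trans (h2.2 j hj)
  · simp [State.setReal, Loc.array, Loc.index, g3, g2.1 k (by omega), h3]

/-- `Keep k` belongs to the postcondition so that intermediate results survive: a first operand
waits in temporary `k` while the second is evaluated at level `k + 1`. -/
theorem RExpr.halts (e : RExpr) {B : ℕ} {r : ℕ → ℕ → ℝ} : ∀ (k : ℕ) {s : State} {w : ℕ → ℕ},
    Rel s w r → (∀ v, w v ≤ B) → Halts (e.compile k) s (e.cost B) fun s' =>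
      Rel s' w r ∧ Keep k s s' ∧ s'.real 0 k = e.eval r w := by
  induction e with
  | lit c =>
    intro k s w hs _
    refine Halts.mono (t := 1 + 1) (Halts.seq <| Halts.instr <| Halts.instr ?_) le_rfl
      (fun _ h => h)
    refine ⟨⟨?_, fun a => ?_⟩, ⟨fun j hj => ?_, fun j hj => ?_⟩, ?_⟩
    · rw [← hs.1]; ext; simp [Instr.apply, State.setWord, State.setReal, Loc.array]
    · rw [← hs.2]; ext; simp [Instr.apply, State.setWord, State.setReal, Loc.array]
    · have e1 : j ≠ k := by omega
      simp [Instr.apply, State.setWord, State.setReal, Loc.array, Loc.index, e1]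
    · have e1 : j ≠ 3 * k := by omega
      simp [Instr.apply, State.setWord, State.setReal, Loc.array, Loc.index, e1]
    · simp [Instr.apply, State.setWord, State.setReal, State.getWord, Loc.array, Loc.index,
        RExpr.eval]
  | cast v =>
    intro k s w hs _
    refine Halts.instr ⟨⟨hs.1, fun a => ?_⟩, ⟨fun j hj => ?_, fun j hj => rfl⟩, ?_⟩
    · rw [← hs.2]; ext; simp [Instr.apply, State.setReal, Loc.array]
    · have e1 : j ≠ k := by omega
      simp [Instr.apply, State.setReal, Loc.array, Loc.index, e1]
    · simp [Instr.apply, State.setReal, State.getWord, Loc.array, Loc.index, RExpr.eval, hs.1]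
  | get a ix =>
    intro k s w hs hB
    refine Halts.seq <| (ix.halts k hs.1 hB).mono le_rfl ?_
    rintro s₁ ⟨h1, h2, h3, h4⟩
    refine Halts.instr ⟨⟨h2, fun a => ?_⟩, ⟨fun j hj => ?_, h3⟩, ?_⟩
    · rw [← hs.2]; ext; simp [Instr.apply, State.setReal, Loc.array, h1]
    · have e1 : j ≠ k := by omega
      simp [Instr.apply, State.setReal, Loc.array, Loc.index, e1, h1]
    · simp [Instr.apply, State.setReal, State.getReal, Loc.array, Loc.index, RExpr.eval, h1, h4,
        hs.2]
  | add e f he hf =>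
    intro k s w hs hB
    exact binop_halts (op := (· + ·)) (fun _ => rfl) (he k hs hB) fun s hs => hf (k + 1) hs hB
  | sub e f he hf =>
    intro k s w hs hB
    exact binop_halts (op := (· - ·)) (fun _ => rfl) (he k hs hB) fun s hs => hf (k + 1) hs hB
  | mul e f he hf =>
    intro k s w hs hB
    exact binop_halts (op := (· * ·)) (fun _ => rfl) (he k hs hB) fun s hs => hf (k + 1) hs hB
  | div e f he hf =>
    intro k s w hs hB
    exact binop_halts (op := (· / ·)) (fun _ => rfl) (he k hs hB) fun s hs => hf (k + 1) hs hB
  | sqrt e he =>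
    intro k s w hs hB
    refine Halts.seq <| (he k hs hB).mono le_rfl ?_
    rintro s₁ ⟨h1, h2, h3⟩
    refine Halts.instr ⟨⟨h1.1, fun a => ?_⟩, ⟨fun j hj => ?_, h2.2⟩, ?_⟩
    · rw [← h1.2]; ext; simp [Instr.apply, State.setReal, Loc.array]
    · have e1 : j ≠ k := by omega
      simp [Instr.apply, State.setReal, Loc.array, Loc.index, e1, h2.1 j hj]
    · simp [Instr.apply, State.setReal, State.getReal, Loc.array, Loc.index, RExpr.eval, h3]
  | ifLt e f x y he hf hx hy =>
    intro k s w hs hB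
    refine Halts.mono (t := e.cost B + (f.cost B + (x.cost B + y.cost B + 1)))
      (Halts.block_cons <| (he k hs hB).mono le_rfl ?_) (by simp only [RExpr.cost]; omega)
      (fun _ h => h)
    rintro s₁ ⟨h1, h2, h3⟩
    refine Halts.block_cons <| (hf (k + 1) h1 hB).mono le_rfl ?_
    rintro s₂ ⟨g1, g2, g3⟩
    have hk : Keep k s s₂ := h2.trans g2 (by omega)
    have hc : Test.Holds s₂ (.rlt (.cell 0 k) (.cell 0 (k + 1))) ↔ e.eval r w < f.eval r w := by
      simp [Test.Holds, State.getReal, Loc.array, Loc.index, g3, g2.1 k (by omega), h3]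
    refine Halts.block_single <| Halts.ite (fun h => ?_) (fun h => ?_)
    · refine (hx k g1 hB).mono le_rfl ?_
      rintro s₃ ⟨f1, f2, f3⟩
      exact ⟨f1, hk.trans f2 le_rfl, by rw [f3, RExpr.eval, if_pos (hc.1 h)]⟩
    · refine (hy k g1 hB).mono le_rfl ?_
      rintro s₃ ⟨f1, f2, f3⟩
      exact ⟨f1, hk.trans f2 le_rfl, by rw [f3, RExpr.eval, if_neg (mt hc.2 h)]⟩
  | sum v m e he =>
    intro k s w hs hB
    have hcost : 1 + (1 + (w m * ((e.cost B + 1) + 3) + 5)) ≤ (RExpr.sum v m e).cost B := by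
      have := Nat.mul_le_mul_right (e.cost B + 4) (hB m)
      have h4 : e.cost B + 1 + 3 = e.cost B + 4 := by omega
      simp only [RExpr.cost, h4]
      omega
    refine Halts.mono (Halts.block_cons <| Halts.instr <| Halts.block_cons <| Halts.instr <|
      Halts.block_single <| countLoop_halts (w := w) (fun i ρ => (∀ a, ρ (a + 1) = r a) ∧
        (∀ j < k, ρ 0 j = s.real 0 j) ∧
        ρ 0 k = ∑ i ∈ range i, e.eval r (update w v i)) ?_ ?_ ?_) hcost ?_
    · rw [← hs.1]; ext; simp [Instr.apply, State.setWord, State.setReal, Loc.array]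
    · refine ⟨fun a => ?_, fun j hj => ?_, ?_⟩
      · rw [← hs.2]; ext; simp [Instr.apply, State.setWord, State.setReal, Loc.array]
      · have e1 : j ≠ k := by omega
        simp [Instr.apply, State.setWord, State.setReal, Loc.array, Loc.index, e1]
      · simp [Instr.apply, State.setWord, State.setReal, State.getWord, Loc.array, Loc.index]
    · rintro i hi s₁ h1 ⟨h2, h3, h4⟩
      have hB' : ∀ x, update w v i x ≤ B := fun x => by
        by_cases hx : x = v
        · subst hx; rw [update_self]; exact hi.le.trans (hB m)
        · rw [update_of_ne hx]; exact hB x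
      refine Halts.seq <| (he (k + 1) ⟨h1, h2⟩ hB').mono le_rfl ?_
      rintro s₂ ⟨g1, g2, g3⟩
      refine Halts.instr ⟨g1.1, g2.2, fun a => ?_, fun j hj => ?_, ?_⟩
      · rw [← g1.2]; ext; simp [Instr.apply, State.setReal, Loc.array]
      · have e1 : j ≠ k := by omega
        simp [Instr.apply, State.setReal, Loc.array, Loc.index, e1, g2.1 j (by omega), h3 j hj]
      · simp [Instr.apply, State.setReal, State.getReal, Loc.array, Loc.index, g3,
          g2.1 k (by omega), h4, sum_range_succ]
    · rintro s₁ ⟨h1, h2, h3, h4, h5⟩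
      refine ⟨⟨h1, h3⟩, ⟨h4, fun j hj => ?_⟩, h5⟩
      have e1 : j ≠ 3 * k := by omega
      rw [h2 j hj]
      simp [Instr.apply, State.setWord, State.setReal, Loc.array, Loc.index, e1]

theorem Cmd.halts (c : Cmd) {B : ℕ} : ∀ (k : ℕ) {s : State} {w : ℕ → ℕ} {r : ℕ → ℕ → ℝ},
    Rel s w r → (∀ v, w v ≤ B) → Halts (c.compile k) s (c.cost B) fun s' =>
      Rel s' w (c.eval w r) ∧ Keep k s s' := by
  induction c with
  | set a ix e =>
    intro k s w r hs hB
    refine Halts.mono (t := e.cost B + (ix.cost B + 1))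
      (Halts.block_cons <| (e.halts k hs hB).mono le_rfl ?_) (by simp only [Cmd.cost]; omega)
      (fun _ h => h)
    rintro s₁ ⟨h1, h2, h3⟩
    refine Halts.block_cons <| (ix.halts (k + 1) h1.1 hB).mono le_rfl ?_
    rintro s₂ ⟨g1, g2, g3, g4⟩
    refine Halts.block_single <| Halts.instr ⟨⟨g2, fun b => ?_⟩, ⟨fun j hj => ?_, fun j hj => ?_⟩⟩
    · ext i
      by_cases hb : b = a
      · subst hb
        by_cases hi : i = ix.eval w
        · simp [Instr.apply, State.setReal, State.getReal, Loc.array, Loc.index, g1, g4, h3,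
            Cmd.eval, put, hi]
        · simp [Instr.apply, State.setReal, State.getReal, Loc.array, Loc.index, g1, g4,
            Cmd.eval, put, hi, h1.2]
      · simp [Instr.apply, State.setReal, State.getReal, Loc.array, g1,
            Cmd.eval, put, hb, h1.2]
    · simp [Instr.apply, State.setReal, Loc.array, g1, h2.1 j hj]
    · exact (g3 j (by omega)).trans (h2.2 j hj)
  | seq c d hc hd =>
    intro k s w r hs hB
    refine Halts.seq <| (hc k hs hB).mono le_rfl ?_
    rintro s₁ ⟨h1, h2⟩
    refine (hd k h1 hB).mono le_rfl ?_
    rintro s₂ ⟨g1, g2⟩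
    exact ⟨g1, h2.trans g2 le_rfl⟩
  | rep v m c hc =>
    intro k s w r hs hB
    have hcost : w m * (c.cost B + 3) + 5 ≤ (Cmd.rep v m c).cost B := by
      have := Nat.mul_le_mul_right (c.cost B + 3) (hB m)
      simp only [Cmd.cost]; omega
    refine Halts.mono (countLoop_halts (w := w) (fun i ρ =>
      (∀ a, ρ (a + 1) = iter (fun i r' => c.eval (update w v i) r') r i a) ∧
        (∀ j < k, ρ 0 j = s.real 0 j)) hs.1 ⟨hs.2, fun _ _ => rfl⟩ ?_) hcost ?_
    · rintro i hi s₁ h1 ⟨h2, h3⟩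
      have hB' : ∀ x, update w v i x ≤ B := fun x => by
        by_cases hx : x = v
        · subst hx; rw [update_self]; exact hi.le.trans (hB m)
        · rw [update_of_ne hx]; exact hB x
      refine (hc (k + 1) ⟨h1, h2⟩ hB').mono le_rfl ?_
      rintro s₂ ⟨g1, g2⟩
      exact ⟨g1.1, g2.2, g1.2, fun j hj => (g2.1 j (by omega)).trans (h3 j hj)⟩
    · rintro s₁ ⟨h1, h2, h3, h4⟩
      exact ⟨⟨h1, h3⟩, h4, h2⟩

/-! ### Polynomial bounds on the cost of commands. -/

/-- Functions bounded by a polynomial. -/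
def PolyBounded (f : ℕ → ℕ) : Prop := ∃ K, ∀ B, f B ≤ K * (B + 1) ^ K

theorem PolyBounded.const (c : ℕ) : PolyBounded fun _ => c :=
  ⟨c, fun B => Nat.le_mul_of_pos_right _ (by positivity)⟩

theorem PolyBounded.add {f g : ℕ → ℕ} (hf : PolyBounded f) (hg : PolyBounded g) :
    PolyBounded fun B => f B + g B := by
  obtain ⟨K, hK⟩ := hf
  obtain ⟨M, hM⟩ := hg
  refine ⟨K + M, fun B => ?_⟩
  calc f B + g B ≤ K * (B + 1) ^ K + M * (B + 1) ^ M := add_le_add (hK B) (hM B)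
    _ ≤ K * (B + 1) ^ (K + M) + M * (B + 1) ^ (K + M) := by gcongr <;> omega
    _ = _ := by ring

theorem PolyBounded.mul {f g : ℕ → ℕ} (hf : PolyBounded f) (hg : PolyBounded g) :
    PolyBounded fun B => f B * g B := by
  obtain ⟨K, hK⟩ := hf
  obtain ⟨M, hM⟩ := hg
  refine ⟨K * M + K + M, fun B => ?_⟩
  calc f B * g B ≤ K * (B + 1) ^ K * (M * (B + 1) ^ M) := Nat.mul_le_mul (hK B) (hM B)
    _ = K * M * (B + 1) ^ (K + M) := by ring
    _ ≤ (K * M + K + M) * (B + 1) ^ (K * M + K + M) := by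
      gcongr
      · omega
      · omega
      · exact Nat.le_add_left K (K * M)

theorem PolyBounded.id : PolyBounded fun B => B := ⟨1, fun B => by simp⟩

theorem Ix.polyBounded_cost (ix : Ix) : PolyBounded fun B => ix.cost B := by
  cases ix with
  | const c => exact .const 1
  | var v => exact .const 1
  | lin v m u c => exact ((PolyBounded.const 3).mul .id).add (.const 5)

theorem RExpr.polyBounded_cost (e : RExpr) : PolyBounded fun B => e.cost B := by
  induction e with
  | lit c => exact .const 2
  | cast v => exact .const 1
  | get a ix => exact ix.polyBounded_cost.add (.const 1)
  | add e f he hf => exact (he.add hf).add (.const 1)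
  | sub e f he hf => exact (he.add hf).add (.const 1)
  | mul e f he hf => exact (he.add hf).add (.const 1)
  | div e f he hf => exact (he.add hf).add (.const 1)
  | sqrt e he => exact he.add (.const 1)
  | ifLt e f x y he hf hx hy => exact (((he.add hf).add hx).add hy).add (.const 1)
  | sum v m e he => exact (PolyBounded.id.mul (he.add (.const 4))).add (.const 7)

theorem Cmd.polyBounded_cost (c : Cmd) : PolyBounded fun B => c.cost B := by
  induction c with
  | set a ix e => exact (e.polyBounded_cost.add ix.polyBounded_cost).add (.const 1)
  | seq c d hc hd => exact hc.add hd
  | rep v m c hc => exact (PolyBounded.id.mul (hc.add (.const 3))).add (.const 5)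

end RealRAM

namespace RealRAM

open Finset Function

/-! ### Reading the result of vector assignments -/

/-- The expression does not mention the array `a`. -/
def RExpr.Avoids (a : ℕ) : RExpr → Prop
  | .lit _ => True
  | .cast _ => True
  | .get b _ => b ≠ a
  | .add e f => e.Avoids a ∧ f.Avoids a
  | .sub e f => e.Avoids a ∧ f.Avoids a
  | .mul e f => e.Avoids a ∧ f.Avoids a
  | .div e f => e.Avoids a ∧ f.Avoids a
  | .sqrt e => e.Avoids a
  | .ifLt e f x y => e.Avoids a ∧ f.Avoids a ∧ x.Avoids a ∧ y.Avoids a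
  | .sum _ _ e => e.Avoids a

/-- A vector assignment evaluates its expression anew in every round, when the target is already
partly overwritten. If the expression avoids the target, every round sees the original values. -/
theorem RExpr.eval_congr {a : ℕ} {r r' : ℕ → ℕ → ℝ} (hr : ∀ b, b ≠ a → r' b = r b) (e : RExpr)
    (h : e.Avoids a) (w : ℕ → ℕ) : e.eval r' w = e.eval r w := by
  induction e generalizing w with
  | lit c => rfl
  | cast v => rfl
  | get b ix => simp [RExpr.eval, hr b h]
  | add e f he hf => simp_all [RExpr.Avoids, RExpr.eval]
  | sub e f he hf => simp_all [RExpr.Avoids, RExpr.eval]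
  | mul e f he hf => simp_all [RExpr.Avoids, RExpr.eval]
  | div e f he hf => simp_all [RExpr.Avoids, RExpr.eval]
  | sqrt e he => simp_all [RExpr.Avoids, RExpr.eval]
  | ifLt e f x y he hf hx hy => simp_all [RExpr.Avoids, RExpr.eval]
  | sum v m e he => simp_all [RExpr.Avoids, RExpr.eval]

/-- Rules for `RExpr.Avoids`. -/
theorem RExpr.avoids_iff : (∀ a c, (RExpr.lit c).Avoids a ↔ True) ∧
    (∀ a v, (RExpr.cast v).Avoids a ↔ True) ∧
    (∀ a b ix, (RExpr.get b ix).Avoids a ↔ b ≠ a) ∧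
    (∀ a e f, (RExpr.add e f).Avoids a ↔ e.Avoids a ∧ f.Avoids a) ∧
    (∀ a e f, (RExpr.sub e f).Avoids a ↔ e.Avoids a ∧ f.Avoids a) ∧
    (∀ a e f, (RExpr.mul e f).Avoids a ↔ e.Avoids a ∧ f.Avoids a) ∧
    (∀ a e f, (RExpr.div e f).Avoids a ↔ e.Avoids a ∧ f.Avoids a) ∧
    (∀ a e, (RExpr.sqrt e).Avoids a ↔ e.Avoids a) ∧
    (∀ a e f x y, (RExpr.ifLt e f x y).Avoids a ↔
      e.Avoids a ∧ f.Avoids a ∧ x.Avoids a ∧ y.Avoids a) ∧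
    ∀ a v m e, (RExpr.sum v m e).Avoids a ↔ e.Avoids a := by
  simp [RExpr.Avoids]

/-- Assignment to cell `0` of an array. -/
def Cmd.scal (a : ℕ) (e : RExpr) : Cmd := .set a (.const 0) e

/-- Assignment to the cells `v < m` of an array. -/
def Cmd.vec (v m a : ℕ) (e : RExpr) : Cmd := .rep v m (.set a (.var v) e)

/-- Assignment to the cells `j * m + v`, `v < m`, of an array. -/
def Cmd.row (j v m a : ℕ) (e : RExpr) : Cmd := .rep v m (.set a (.lin j m v 0) e)

theorem Cmd.eval_seq (c d : Cmd) (w : ℕ → ℕ) (r : ℕ → ℕ → ℝ) :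
    (Cmd.seq c d).eval w r = d.eval w (c.eval w r) := rfl

theorem Cmd.eval_scal_self (a : ℕ) (e : RExpr) (w : ℕ → ℕ) (r : ℕ → ℕ → ℝ) :
    (Cmd.scal a e).eval w r a 0 = e.eval r w := by
  simp [Cmd.scal, Cmd.eval, put, Ix.eval]

theorem Cmd.eval_scal_of_ne {a b : ℕ} (h : b ≠ a) (e : RExpr) (w : ℕ → ℕ) (r : ℕ → ℕ → ℝ) :
    (Cmd.scal a e).eval w r b = r b := by
  simp [Cmd.scal, Cmd.eval, put, h]

theorem iter_of_forall {f : ℕ → (ℕ → ℕ → ℝ) → ℕ → ℕ → ℝ} {r : ℕ → ℕ → ℝ}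
    (I : ℕ → (ℕ → ℕ → ℝ) → Prop) (N : ℕ) (h0 : I 0 r)
    (h : ∀ i < N, ∀ r, I i r → I (i + 1) (f i r)) : I N (iter f r N) := by
  induction N with
  | zero => exact h0
  | succ N ih => exact h N (by omega) _ (ih fun i hi => h i (by omega))

theorem Cmd.eval_rep_of_forall {v m : ℕ} {c : Cmd} {w : ℕ → ℕ} {r : ℕ → ℕ → ℝ}
    (I : ℕ → (ℕ → ℕ → ℝ) → Prop) (h0 : I 0 r)
    (h : ∀ i < w m, ∀ r, I i r → I (i + 1) (c.eval (update w v i) r)) :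
    I (w m) ((Cmd.rep v m c).eval w r) :=
  iter_of_forall I _ h0 h

theorem Cmd.eval_vec {a : ℕ} {e : RExpr} (h : e.Avoids a) (v m : ℕ) (w : ℕ → ℕ)
    (r : ℕ → ℕ → ℝ) : (∀ b, b ≠ a → (Cmd.vec v m a e).eval w r b = r b) ∧
      ∀ x, (Cmd.vec v m a e).eval w r a x =
        if x < w m then e.eval r (update w v x) else r a x := by
  refine Cmd.eval_rep_of_forall (fun i r' => (∀ b, b ≠ a → r' b = r b) ∧
    ∀ x, r' a x = if x < i then e.eval r (update w v x) else r a x) (by simp) ?_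
  rintro i hi r' ⟨h1, h2⟩
  refine ⟨fun b hb => by simp [Cmd.eval, put, hb, h1 b hb], fun x => ?_⟩
  simp only [Cmd.eval, put, update_self, Ix.eval, RExpr.eval_congr h1 e h]
  rcases lt_trichotomy x i with hx | hx | hx
  · simp [hx.ne, hx, h2, Nat.lt_succ_of_lt hx]
  · simp [hx]
  · rw [update_of_ne hx.ne', h2, if_neg (by omega), if_neg (by omega)]

theorem Cmd.eval_vec_of_ne {a b : ℕ} {e : RExpr} (h : b ≠ a) (he : e.Avoids a) (v m : ℕ)
    (w : ℕ → ℕ) (r : ℕ → ℕ → ℝ) : (Cmd.vec v m a e).eval w r b = r b :=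
  (Cmd.eval_vec he v m w r).1 b h

theorem Cmd.eval_vec_self {a : ℕ} {e : RExpr} (he : e.Avoids a) (v m : ℕ)
    (w : ℕ → ℕ) (r : ℕ → ℕ → ℝ) (x : ℕ) : (Cmd.vec v m a e).eval w r a x =
      if x < w m then e.eval r (update w v x) else r a x :=
  (Cmd.eval_vec he v m w r).2 x

/-- Uniqueness of quotient and remainder: writes to different rows or columns do not collide. -/
theorem Nat.mul_add_eq_mul_add {n j k i x : ℕ} (hi : i < n) (hx : x < n) :
    j * n + i = k * n + x ↔ j = k ∧ i = x := by
  constructor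
  · intro h
    have h1 : (j * n + i) / n = (k * n + x) / n := by rw [h]
    rw [mul_comm j, mul_comm k, Nat.mul_add_div (by omega), Nat.mul_add_div (by omega),
      Nat.div_eq_of_lt hi, Nat.div_eq_of_lt hx] at h1
    simp only [add_zero] at h1
    subst h1
    exact ⟨rfl, by omega⟩
  · rintro ⟨rfl, rfl⟩; rfl

theorem Cmd.eval_row {a : ℕ} {e : RExpr} (h : e.Avoids a) {j v m : ℕ} (hj : j ≠ v)
    (hm : m ≠ v) (w : ℕ → ℕ) (r : ℕ → ℕ → ℝ) :
    (∀ b, b ≠ a → (Cmd.row j v m a e).eval w r b = r b) ∧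
      ∀ k, ∀ x < w m, (Cmd.row j v m a e).eval w r a (k * w m + x) =
        if k = w j then e.eval r (update w v x) else r a (k * w m + x) := by
  -- With `x < w m` inside the condition, the claim is the loop invariant after `w m` rounds.
  suffices H : (∀ b, b ≠ a → (Cmd.row j v m a e).eval w r b = r b) ∧
      ∀ k, ∀ x < w m, (Cmd.row j v m a e).eval w r a (k * w m + x) =
        if k = w j ∧ x < w m then e.eval r (update w v x) else r a (k * w m + x) by
    refine ⟨H.1, fun k x hx => ?_⟩
    rw [H.2 k x hx]; simp [hx]
  refine Cmd.eval_rep_of_forall (fun i r' => (∀ b, b ≠ a → r' b = r b) ∧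
    ∀ k, ∀ x < w m, r' a (k * w m + x) =
      if k = w j ∧ x < i then e.eval r (update w v x) else r a (k * w m + x)) (by simp) ?_
  rintro i hi r' ⟨h1, h2⟩
  refine ⟨fun b hb => by simp [Cmd.eval, put, hb, h1 b hb], fun k x hx => ?_⟩
  simp only [Cmd.eval, put, update_self, Ix.eval, RExpr.eval_congr h1 e h, update_of_ne hj,
    update_of_ne hm, add_zero, update_apply, Nat.mul_add_eq_mul_add hx hi, h2 k x hx]
  by_cases hk : k = w j
  · rcases lt_trichotomy x i with hxi | hxi | hxi
    · simp [hxi.ne, hxi, hk, Nat.lt_succ_of_lt hxi]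
    · simp [hxi, hk]
    · simp [hk, hxi.ne', hxi.not_gt, Nat.not_le.2 hxi]
  · simp [hk]

theorem Cmd.eval_row_of_ne {a b : ℕ} {e : RExpr} (hb : b ≠ a) (h : e.Avoids a) {j v m : ℕ}
    (hj : j ≠ v) (hm : m ≠ v) (w : ℕ → ℕ) (r : ℕ → ℕ → ℝ) :
    (Cmd.row j v m a e).eval w r b = r b :=
  (Cmd.eval_row h hj hm w r).1 b hb

theorem Cmd.eval_row_self {a : ℕ} {e : RExpr} (h : e.Avoids a) {j v m : ℕ}
    (hj : j ≠ v) (hm : m ≠ v) (w : ℕ → ℕ) (r : ℕ → ℕ → ℝ) {k x : ℕ} (hx : x < w m) :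
    (Cmd.row j v m a e).eval w r a (k * w m + x) =
      if k = w j then e.eval r (update w v x) else r a (k * w m + x) :=
  (Cmd.eval_row h hj hm w r).2 k x hx

/-! ### The algorithm

Word variables: `0, 1, 2` hold `n, d, p`; `3, 4, 5` are loop variables. Real arrays: `0, 1, 2` hold
`X, y, Z`; `3` is `ε`, `4` is `δ`, `5` is `ε δ²`, `6` is `1`, `7` is the output, `8` a flag; `9` and
`10` hold the orthonormalized residual and instrument spaces, `11, 12, 13` are used for the
orthonormalization; `14` is the width of the net, `15` the radius of the ball of dual vectors, `16`
the number of iterations, `17` the best value so far; `18, …, 22` hold the position in the net. -/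

/-- Cell `0` of an array. -/
def RExpr.cell (a : ℕ) : RExpr := .get a (.const 0)

/-- The cell of an array given by a word variable. -/
def RExpr.at (a v : ℕ) : RExpr := .get a (.var v)

/-- Row `j`, column `v` of an array of rows of length `n`. -/
def RExpr.ent (a j v : ℕ) : RExpr := .get a (.lin j 0 v 0)

/-- Parameters, and the trivial cases. -/
def exitCmd : Cmd :=
  .seq (.scal 5 (.mul (.cell 3) (.mul (.cell 4) (.cell 4)))) <|
  .seq (.scal 6 (.lit 1)) <|
  .seq (.scal 7 (.ifLt (.cell 3) (.div (.lit 1) (.lit 2)) (.lit 0) (.cast 0))) <|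
  .scal 8 (.ifLt (.cell 3) (.div (.lit 1) (.lit 2))
    (.ifLt (.cell 5) (.lit 1) (.lit 0) (.lit 1)) (.lit 1))

/-- One step of the Gram–Schmidt process. -/
def gramSchmidtStep (a : ℕ) : Cmd :=
  .seq (.vec 5 4 12 (.sum 3 0 (.mul (.ent a 4 3) (.ent a 5 3)))) <|
  .seq (.vec 3 0 11 (.sub (.ent a 4 3) (.sum 5 4 (.mul (.at 12 5) (.ent a 5 3))))) <|
  .seq (.scal 13 (.sqrt (.sum 3 0 (.mul (.at 11 3) (.at 11 3))))) <|
  .row 4 3 0 a (.div (.at 11 3) (.cell 13))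

/-- The Gram–Schmidt process for the rows of the array `a`; their number is word `m`. -/
def gramSchmidtCmd (a m : ℕ) : Cmd := .rep 4 m (gramSchmidtStep a)

/-- Load the instruments and the residual space. -/
def loadCmd : Cmd :=
  .seq (.rep 4 2 (.row 4 3 0 10 (.get 2 (.lin 3 2 4 0)))) <|
  .rep 4 1 (.row 4 3 0 9 (.ifLt (.add (.cast 4) (.lit 1)) (.cast 1) (.get 0 (.lin 3 1 4 1))
    (.at 1 3)))

/-- Set the parameters of the main loop. -/
def paramCmd : Cmd :=
  .seq (.scal 14 (.div (.mul (.lit 2) (.cast 1)) (.cell 5))) <|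
  .seq (.scal 15 (.div (.cast 0) (.mul (.cell 4) (.cell 4)))) <|
  .seq (.scal 16 (.mul (.cast 0) (.cell 15))) <|
  .seq (.scal 17 (.lit 0)) <|
  .seq (.scal 18 (.lit 0)) <|
  .seq (.vec 4 1 19 (.lit 0)) <|
  .seq (.vec 4 1 20 (.lit 0)) <|
  .scal 21 (.lit 0)

/-- Preparation of the main loop. -/
def setupCmd : Cmd :=
  .seq loadCmd <| .seq (gramSchmidtCmd 10 2) <| .seq (gramSchmidtCmd 9 1) paramCmd

/-- The current point of the net, and the initial values of the primal-dual iteration. -/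
def pointCmd : Cmd :=
  .seq (.scal 24 (.sub (.cell 14)
    (.sum 4 1 (.ifLt (.at 20 4) (.lit 0) (.sub (.lit 0) (.at 20 4)) (.at 20 4))))) <|
  .seq (.vec 4 1 23 (.ifLt (.add (.cast 4) (.lit 1)) (.cast 1) (.at 20 4) (.cell 24))) <|
  .seq (.vec 3 0 25 (.sum 4 1 (.mul (.at 23 4) (.ent 9 4 3)))) <|
  .seq (.scal 26 (.sqrt (.sum 3 0 (.mul (.at 25 3) (.at 25 3))))) <|
  .seq (.vec 3 0 27 (.div (.at 25 3) (.cell 26))) <|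
  .seq (.vec 5 2 28 (.lit 0)) <|
  .seq (.vec 5 2 29 (.lit 0)) <|
  .seq (.vec 3 0 30 (.lit 0)) <|
  .seq (.vec 3 0 31 (.lit 0)) <|
  .scal 32 (.lit 0)

/-- The step of the dual vector in the primal-dual iteration. -/
def dualStepCmd : Cmd :=
  .seq (.vec 5 2 33 (.add (.at 28 5)
    (.mul (.cell 15) (.sum 3 0 (.mul (.ent 10 5 3) (.mul (.at 27 3) (.at 31 3))))))) <|
  .seq (.scal 37 (.sqrt (.sum 5 2 (.mul (.at 33 5) (.at 33 5))))) <|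
  .vec 5 2 28 (.ifLt (.cell 15) (.cell 37)
    (.mul (.at 33 5) (.div (.cell 15) (.cell 37))) (.at 33 5))

/-- The step of the weights in the primal-dual iteration. -/
def weightStepCmd : Cmd :=
  .seq (.vec 3 0 36 (.add (.at 30 3) (.div (.sub (.lit 1) (.mul (.at 27 3)
    (.sum 5 2 (.mul (.at 28 5) (.ent 10 5 3))))) (.cell 15)))) <|
  .seq (.vec 3 0 34 (.ifLt (.at 36 3) (.lit 0) (.lit 0)
    (.ifLt (.lit 1) (.at 36 3) (.lit 1) (.at 36 3)))) <|
  .seq (.vec 3 0 31 (.sub (.mul (.lit 2) (.at 34 3)) (.at 30 3))) <|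
  .vec 3 0 30 (.at 34 3)

/-- Accumulation of the dual vectors. -/
def accumulateCmd : Cmd :=
  .seq (.vec 5 2 35 (.add (.at 29 5) (.at 28 5))) <|
  .seq (.vec 5 2 29 (.at 35 5)) <|
  .scal 32 (.add (.cell 32) (.lit 1))

/-- One step of the primal-dual iteration. -/
def stepCmd : Cmd := .seq dualStepCmd <| .seq weightStepCmd accumulateCmd

/-- The value at the current point of the net. -/
def valueCmd : Cmd :=
  .seq (.vec 3 0 36 (.mul (.at 27 3)
    (.sum 5 2 (.mul (.div (.at 29 5) (.cell 32)) (.ent 10 5 3))))) <|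
  .seq (.scal 38 (.sum 3 0 (.ifLt (.at 36 3) (.lit 1) (.sub (.lit 1) (.at 36 3)) (.lit 0)))) <|
  .scal 17 (.ifLt (.lit 0) (.cell 24)
    (.ifLt (.cell 17) (.cell 38) (.cell 38) (.cell 17)) (.cell 17))

/-- Advance one coordinate of the position in the net, if there is a carry. -/
def carryCmd : Cmd :=
  .seq (.scal 39 (.ifLt (.lit 0) (.cell 22)
    (.ifLt (.mul (.lit 2) (.cell 14)) (.add (.cell 18) (.lit 1)) (.lit 1) (.lit 0)) (.lit 0))) <|
  .seq (.scal 40 (.ifLt (.lit 0) (.cell 22)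
    (.ifLt (.mul (.lit 2) (.cell 14)) (.add (.cell 18) (.lit 1)) (.lit 0) (.lit 1)) (.lit 0))) <|
  .seq (.scal 18 (.ifLt (.lit 0) (.cell 39) (.sub (.cell 18) (.at 19 4))
    (.add (.cell 18) (.cell 40)))) <|
  .seq (.set 20 (.var 4) (.ifLt (.lit 0) (.cell 39) (.lit 0) (.ifLt (.lit 0) (.cell 40)
    (.ifLt (.lit 0) (.at 20 4) (.sub (.lit 0) (.at 20 4)) (.sub (.lit 1) (.at 20 4)))
    (.at 20 4)))) <|
  .seq (.set 19 (.var 4) (.ifLt (.lit 0) (.cell 39) (.lit 0) (.add (.at 19 4) (.cell 40)))) <|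
  .seq (.scal 22 (.sub (.cell 22) (.cell 40))) <|
  .scal 21 (.ifLt (.add (.cast 4) (.lit 1)) (.cast 1) (.cell 21) (.cell 40))

/-- Advance the position in the net. -/
def nextCmd : Cmd := .seq (.scal 22 (.lit 1)) (.rep 4 1 carryCmd)

/-- The output of the main branch. -/
def outputCmd : Cmd :=
  .scal 7 (.add (.add (.sub (.cast 0) (.cell 17)) (.mul (.lit 2) (.mul (.cell 3) (.cast 0))))
    (.lit 1))

/-- The body of the main loop. -/
def pointProgram : Program := .block
  [pointCmd.compile 0, .loop (.rlt (.cell 33 0) (.cell 17 0)) (stepCmd.compile 0),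
    valueCmd.compile 0, nextCmd.compile 0]

/-- The part of the program after the trivial cases. -/
def mainProgram : Program := .seq (setupCmd.compile 0) <|
  .ite (.rlt (.cell 22 0) (.cell 14 0))
    (.seq (.loop (.rlt (.cell 22 0) (.cell 7 0)) pointProgram) (outputCmd.compile 0))
    (.instr .skip)

/-- The program that approximates the stability of instrumental variables regression. -/
def ivProgram : Program := .block
  [.instr (.rmove (.cell 4 0) (.cell 0 0)), .instr (.rmove (.cell 5 0) (.cell 0 1)),
    exitCmd.compile 0,
    .ite (.rlt (.cell 9 0) (.cell 7 0)) mainProgram (.instr .skip),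
    .instr (.rmove (.cell 0 0) (.cell 8 0))]

/-! ### Effect of the straight-line pieces -/

theorem sum_range_ite_lt (m : ℕ) (f g : ℕ → ℝ) :
    ∑ i ∈ range m, (if i < m then f i else g i) = ∑ i ∈ range m, f i :=
  sum_congr rfl fun _ hi => if_pos (mem_range.1 hi)

theorem exitCmd_eval (w : ℕ → ℕ) (r : ℕ → ℕ → ℝ) :
    (∀ b, b ∉ ({5, 6, 7, 8} : Finset ℕ) → exitCmd.eval w r b = r b) ∧
    exitCmd.eval w r 5 0 = r 3 0 * (r 4 0 * r 4 0) ∧ exitCmd.eval w r 6 0 = 1 ∧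
    exitCmd.eval w r 7 0 = (if r 3 0 < 1 / 2 then 0 else (w 0 : ℝ)) ∧
    exitCmd.eval w r 8 0 =
      if r 3 0 < 1 / 2 then if r 3 0 * (r 4 0 * r 4 0) < 1 then 0 else 1 else 1 := by
  refine ⟨fun b hb => ?_, ?_, ?_, ?_, ?_⟩
  · simp only [Finset.mem_insert, Finset.mem_singleton, not_or] at hb
    obtain ⟨h5, h6, h7, h8⟩ := hb
    simp only [exitCmd, Cmd.eval_seq, Cmd.eval_scal_of_ne h5, Cmd.eval_scal_of_ne h6,
      Cmd.eval_scal_of_ne h7, Cmd.eval_scal_of_ne h8]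
  all_goals
    simp [exitCmd, Cmd.eval_seq, Cmd.eval_scal_of_ne, Cmd.eval_scal_self, RExpr.eval, RExpr.cell,
      Ix.eval]

theorem paramCmd_eval (w : ℕ → ℕ) (r : ℕ → ℕ → ℝ) :
    (∀ b, b ∉ ({14, 15, 16, 17, 18, 19, 20, 21} : Finset ℕ) → paramCmd.eval w r b = r b) ∧
    paramCmd.eval w r 14 0 = 2 * w 1 / r 5 0 ∧
    paramCmd.eval w r 15 0 = w 0 / (r 4 0 * r 4 0) ∧
    paramCmd.eval w r 16 0 = w 0 * (w 0 / (r 4 0 * r 4 0)) ∧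
    paramCmd.eval w r 17 0 = 0 ∧ paramCmd.eval w r 18 0 = 0 ∧
    (∀ j < w 1, paramCmd.eval w r 19 j = 0) ∧ (∀ j < w 1, paramCmd.eval w r 20 j = 0) ∧
    paramCmd.eval w r 21 0 = 0 := by
  refine ⟨fun b hb => ?_, ?_, ?_, ?_, ?_, ?_, fun j hj => ?_, fun j hj => ?_, ?_⟩
  · simp only [Finset.mem_insert, Finset.mem_singleton, not_or] at hb
    obtain ⟨h1, h2, h3, h4, h5, h6, h7, h8⟩ := hb
    simp [paramCmd, Cmd.eval_seq, Cmd.eval_scal_of_ne, Cmd.eval_vec_of_ne, RExpr.avoids_iff, *]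
  all_goals
    simp [paramCmd, Cmd.eval_seq, Cmd.eval_scal_of_ne, Cmd.eval_scal_self, Cmd.eval_vec_of_ne,
      Cmd.eval_vec_self, RExpr.avoids_iff, RExpr.eval, RExpr.cell, Ix.eval, *]

theorem pointCmd_eval (w : ℕ → ℕ) (r : ℕ → ℕ → ℝ) :
    (∀ b, b < 23 → pointCmd.eval w r b = r b) ∧
    ∃ (c N : ℝ) (u : ℕ → ℝ), c = r 14 0 - ∑ j ∈ range (w 1), |r 20 j| ∧
      (∀ i, u i = ∑ j ∈ range (w 1), (if j + 1 < w 1 then r 20 j else c) * r 9 (j * w 0 + i)) ∧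
      N = √(∑ i ∈ range (w 0), u i * u i) ∧
      pointCmd.eval w r 24 0 = c ∧
      (∀ i < w 0, pointCmd.eval w r 27 i = u i / N) ∧
      (∀ k < w 2, pointCmd.eval w r 28 k = 0) ∧ (∀ k < w 2, pointCmd.eval w r 29 k = 0) ∧
      (∀ i < w 0, pointCmd.eval w r 30 i = 0) ∧ (∀ i < w 0, pointCmd.eval w r 31 i = 0) ∧
      pointCmd.eval w r 32 0 = 0 := by
  have habs : ∀ x : ℝ, (if x < 0 then -x else x) = |x| := fun x => by
    split_ifs with h
    · exact (abs_of_neg h).symm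
    · exact (abs_of_nonneg (not_lt.1 h)).symm
  have hcast : ∀ x : ℕ, ((x : ℝ) + 1 < (w 1 : ℝ)) ↔ x + 1 < w 1 := fun x => by
    exact_mod_cast Iff.rfl
  refine ⟨fun b hb => ?_, _, _, _, rfl, fun i => rfl, rfl, ?_, fun i hi => ?_, fun i hi => ?_,
    fun i hi => ?_, fun i hi => ?_, fun i hi => ?_, ?_⟩
  · have h1 : b ≠ 23 := by omega
    have h2 : b ≠ 24 := by omega
    have h3 : b ≠ 25 := by omega
    have h4 : b ≠ 26 := by omega
    have h5 : b ≠ 27 := by omega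
    have h6 : b ≠ 28 := by omega
    have h7 : b ≠ 29 := by omega
    have h8 : b ≠ 30 := by omega
    have h9 : b ≠ 31 := by omega
    have h10 : b ≠ 32 := by omega
    simp [pointCmd, Cmd.eval_seq, Cmd.eval_scal_of_ne, Cmd.eval_vec_of_ne, RExpr.avoids_iff,
      RExpr.cell, RExpr.at, RExpr.ent, *]
  all_goals
    simp +contextual [pointCmd, Cmd.eval_seq, Cmd.eval_scal_of_ne, Cmd.eval_scal_self,
      Cmd.eval_vec_of_ne, Cmd.eval_vec_self, RExpr.avoids_iff, RExpr.eval, RExpr.cell, RExpr.at,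
      RExpr.ent, Ix.eval, sum_range_ite_lt, *]

/-- The projection to the unit interval. -/
noncomputable def clampUnit (x : ℝ) : ℝ := if x < 0 then 0 else if 1 < x then 1 else x

/-- A gradient step of length `R` for the dual vector, followed by projection to the ball of radius
`R`. The step is assembled in array `33`, because an assignment must not read its own target. -/
theorem dualStepCmd_eval (w : ℕ → ℕ) (r : ℕ → ℕ → ℝ) :
    (∀ b, b ∉ ({28, 33, 37} : Finset ℕ) → dualStepCmd.eval w r b = r b) ∧
    ∃ (a : ℕ → ℝ) (N : ℝ), (∀ k, a k = r 28 k + r 15 0 *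
        ∑ i ∈ range (w 0), r 10 (k * w 0 + i) * (r 27 i * r 31 i)) ∧
      N = √(∑ k ∈ range (w 2), a k * a k) ∧
      (∀ k < w 2, dualStepCmd.eval w r 28 k = if r 15 0 < N then a k * (r 15 0 / N) else a k) := by
  refine ⟨fun b hb => ?_, _, _, fun k => rfl, rfl, fun k hk => ?_⟩
  · simp only [Finset.mem_insert, Finset.mem_singleton, not_or] at hb
    obtain ⟨h1, h2, h3⟩ := hb
    simp [dualStepCmd, Cmd.eval_seq, Cmd.eval_scal_of_ne, Cmd.eval_vec_of_ne, RExpr.avoids_iff,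
      RExpr.cell, RExpr.at, RExpr.ent, *]
  · simp [dualStepCmd, Cmd.eval_seq, Cmd.eval_scal_of_ne, Cmd.eval_scal_self,
      Cmd.eval_vec_of_ne, Cmd.eval_vec_self, RExpr.avoids_iff, RExpr.eval, RExpr.cell, RExpr.at,
      RExpr.ent, Ix.eval, sum_range_ite_lt, hk]

/-- A gradient step of length `1 / R` for the weights, followed by projection to the unit cube.
Array `31` receives the extrapolation that the next dual step uses. -/
theorem weightStepCmd_eval (w : ℕ → ℕ) (r : ℕ → ℕ → ℝ) :
    (∀ b, b ∉ ({30, 31, 34, 36} : Finset ℕ) → weightStepCmd.eval w r b = r b) ∧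
      (∀ i < w 0, weightStepCmd.eval w r 30 i = clampUnit (r 30 i + (1 - r 27 i *
        ∑ k ∈ range (w 2), r 28 k * r 10 (k * w 0 + i)) / r 15 0)) ∧
      (∀ i < w 0, weightStepCmd.eval w r 31 i = 2 * weightStepCmd.eval w r 30 i - r 30 i) := by
  refine ⟨fun b hb => ?_, fun i hi => ?_, fun i hi => ?_⟩
  · simp only [Finset.mem_insert, Finset.mem_singleton, not_or] at hb
    obtain ⟨h1, h2, h3, h4⟩ := hb
    simp [weightStepCmd, Cmd.eval_seq, Cmd.eval_vec_of_ne, RExpr.avoids_iff,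
      RExpr.cell, RExpr.at, RExpr.ent, *]
  all_goals
    simp [weightStepCmd, Cmd.eval_seq, Cmd.eval_vec_of_ne, Cmd.eval_vec_self, RExpr.avoids_iff,
      RExpr.eval, RExpr.cell, RExpr.at, RExpr.ent, Ix.eval, clampUnit, hi]

theorem accumulateCmd_eval (w : ℕ → ℕ) (r : ℕ → ℕ → ℝ) :
    (∀ b, b ∉ ({29, 32, 35} : Finset ℕ) → accumulateCmd.eval w r b = r b) ∧
      (∀ k < w 2, accumulateCmd.eval w r 29 k = r 29 k + r 28 k) ∧
      accumulateCmd.eval w r 32 0 = r 32 0 + 1 := by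
  refine ⟨fun b hb => ?_, fun k hk => ?_, ?_⟩
  · simp only [Finset.mem_insert, Finset.mem_singleton, not_or] at hb
    obtain ⟨h1, h2, h3⟩ := hb
    simp [accumulateCmd, Cmd.eval_seq, Cmd.eval_scal_of_ne, Cmd.eval_vec_of_ne, RExpr.avoids_iff,
      RExpr.cell, RExpr.at, *]
  · simp [accumulateCmd, Cmd.eval_seq, Cmd.eval_scal_of_ne,
      Cmd.eval_vec_self, RExpr.avoids_iff, RExpr.eval, RExpr.cell, RExpr.at, Ix.eval, hk]
  · simp [accumulateCmd, Cmd.eval_seq, Cmd.eval_scal_self, Cmd.eval_vec_of_ne,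
      RExpr.avoids_iff, RExpr.eval, RExpr.cell, RExpr.at, Ix.eval]

theorem stepCmd_eval (w : ℕ → ℕ) (r : ℕ → ℕ → ℝ) :
    (∀ b, b < 28 → stepCmd.eval w r b = r b) ∧
    ∃ (a : ℕ → ℝ) (N : ℝ), (∀ k, a k = r 28 k + r 15 0 *
        ∑ i ∈ range (w 0), r 10 (k * w 0 + i) * (r 27 i * r 31 i)) ∧
      N = √(∑ k ∈ range (w 2), a k * a k) ∧
      (∀ k < w 2, stepCmd.eval w r 28 k = if r 15 0 < N then a k * (r 15 0 / N) else a k) ∧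
      (∀ i < w 0, stepCmd.eval w r 30 i = clampUnit (r 30 i + (1 - r 27 i *
        ∑ k ∈ range (w 2), stepCmd.eval w r 28 k * r 10 (k * w 0 + i)) / r 15 0)) ∧
      (∀ i < w 0, stepCmd.eval w r 31 i = 2 * stepCmd.eval w r 30 i - r 30 i) ∧
      (∀ k < w 2, stepCmd.eval w r 29 k = r 29 k + stepCmd.eval w r 28 k) ∧
      stepCmd.eval w r 32 0 = r 32 0 + 1 := by
  obtain ⟨f1, a, N, ha, hN, h28⟩ := dualStepCmd_eval w r
  obtain ⟨f2, h30, h31⟩ := weightStepCmd_eval w (dualStepCmd.eval w r)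
  obtain ⟨f3, h29, h32⟩ := accumulateCmd_eval w (weightStepCmd.eval w (dualStepCmd.eval w r))
  have e : ∀ b, stepCmd.eval w r b =
    accumulateCmd.eval w (weightStepCmd.eval w (dualStepCmd.eval w r)) b := fun b => rfl
  have e28 : stepCmd.eval w r 28 = dualStepCmd.eval w r 28 := by
    rw [e, f3 28 (by decide), f2 28 (by decide)]
  have e30 : stepCmd.eval w r 30 = weightStepCmd.eval w (dualStepCmd.eval w r) 30 := by
    rw [e, f3 30 (by decide)]
  refine ⟨fun b hb => ?_, a, N, ha, hN, fun k hk => ?_, fun i hi => ?_, fun i hi => ?_,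
    fun k hk => ?_, ?_⟩
  · rw [e, f3, f2, f1] <;> simp only [Finset.mem_insert, Finset.mem_singleton, not_or] <;> omega
  · rw [e28, h28 k hk]
  · rw [e30, e28, h30 i hi, f1 30 (by decide), f1 27 (by decide), f1 10 (by decide),
      f1 15 (by decide)]
  · rw [e30, e, f3 31 (by decide), h31 i hi, f1 30 (by decide)]
  · rw [e28, e, h29 k hk, f2 29 (by decide), f1 29 (by decide), f2 28 (by decide)]
  · rw [e, h32, f2 32 (by decide), f1 32 (by decide)]

theorem valueCmd_eval (w : ℕ → ℕ) (r : ℕ → ℕ → ℝ) :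
    (∀ b, b ∉ ({17, 36, 38} : Finset ℕ) → valueCmd.eval w r b = r b) ∧
    ∃ val : ℝ, val = ∑ i ∈ range (w 0), max 0 (1 - r 27 i *
        ∑ k ∈ range (w 2), r 29 k / r 32 0 * r 10 (k * w 0 + i)) ∧
      valueCmd.eval w r 17 0 = if 0 < r 24 0 then max (r 17 0) val else r 17 0 := by
  have hmax : ∀ x : ℝ, (if x < 1 then 1 - x else 0) = max 0 (1 - x) := fun x => by
    split_ifs with h
    · exact (max_eq_right (by linarith)).symm
    · exact (max_eq_left (by linarith)).symm
  have hmax' : ∀ x y : ℝ, (if x < y then y else x) = max x y := fun x y => by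
    split_ifs with h
    · exact (max_eq_right h.le).symm
    · exact (max_eq_left (not_lt.1 h)).symm
  refine ⟨fun b hb => ?_, _, rfl, ?_⟩
  · simp only [Finset.mem_insert, Finset.mem_singleton, not_or] at hb
    obtain ⟨h1, h2, h3⟩ := hb
    simp [valueCmd, Cmd.eval_seq, Cmd.eval_scal_of_ne, Cmd.eval_vec_of_ne, RExpr.avoids_iff,
      RExpr.cell, RExpr.at, RExpr.ent, *]
  · simp +contextual [valueCmd, Cmd.eval_seq, Cmd.eval_scal_of_ne, Cmd.eval_scal_self,
      Cmd.eval_vec_of_ne, Cmd.eval_vec_self, RExpr.avoids_iff, RExpr.eval, RExpr.cell, RExpr.at,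
      RExpr.ent, Ix.eval, hmax, hmax']
    split_ifs
    · congr 1
      exact sum_congr rfl fun i hi => by rw [if_pos (mem_range.1 hi)]
    · rfl

theorem Cmd.eval_setVar_of_ne {a b : ℕ} (h : b ≠ a) (v : ℕ) (e : RExpr) (w : ℕ → ℕ)
    (r : ℕ → ℕ → ℝ) : (Cmd.set a (.var v) e).eval w r b = r b := by
  simp [Cmd.eval, put, h]

theorem Cmd.eval_setVar_self (a v : ℕ) (e : RExpr) (w : ℕ → ℕ) (r : ℕ → ℕ → ℝ) :
    (Cmd.set a (.var v) e).eval w r a = update (r a) (w v) (e.eval r w) := by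
  simp [Cmd.eval, put, Ix.eval]

/-- Successor in the enumeration `0, 1, -1, 2, -2, …` of the integers. -/
noncomputable def zigzagNext (x : ℝ) : ℝ := if 0 < x then -x else 1 - x

/-- The three cases are: no carry, a carry that resets the coordinate and moves on, and a carry that
is absorbed. The last coordinate sets cell `21` to `1` exactly when it absorbs the carry, which is
the signal that the enumeration is over. -/
theorem carryCmd_eval (w : ℕ → ℕ) (r : ℕ → ℕ → ℝ) :
    (∀ b, b ∉ ({18, 19, 20, 21, 22, 39, 40} : Finset ℕ) → carryCmd.eval w r b = r b) ∧
    (r 22 0 = 0 → carryCmd.eval w r 18 0 = r 18 0 ∧ carryCmd.eval w r 19 = r 19 ∧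
      carryCmd.eval w r 20 = r 20 ∧ carryCmd.eval w r 22 0 = 0 ∧
      carryCmd.eval w r 21 0 = if w 4 + 1 < w 1 then r 21 0 else 0) ∧
    (r 22 0 = 1 → 2 * r 14 0 < r 18 0 + 1 →
      carryCmd.eval w r 18 0 = r 18 0 - r 19 (w 4) ∧
      carryCmd.eval w r 19 = update (r 19) (w 4) 0 ∧
      carryCmd.eval w r 20 = update (r 20) (w 4) 0 ∧ carryCmd.eval w r 22 0 = 1 ∧
      carryCmd.eval w r 21 0 = if w 4 + 1 < w 1 then r 21 0 else 0) ∧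
    (r 22 0 = 1 → r 18 0 + 1 ≤ 2 * r 14 0 →
      carryCmd.eval w r 18 0 = r 18 0 + 1 ∧
      carryCmd.eval w r 19 = update (r 19) (w 4) (r 19 (w 4) + 1) ∧
      carryCmd.eval w r 20 = update (r 20) (w 4) (zigzagNext (r 20 (w 4))) ∧
      carryCmd.eval w r 22 0 = 0 ∧
      carryCmd.eval w r 21 0 = if w 4 + 1 < w 1 then r 21 0 else 1) := by
  have hcast : ((w 4 : ℝ) + 1 < (w 1 : ℝ)) ↔ w 4 + 1 < w 1 := by exact_mod_cast Iff.rfl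
  refine ⟨fun b hb => ?_, fun h => ?_, fun h h' => ?_, fun h h' => ?_⟩
  · simp only [Finset.mem_insert, Finset.mem_singleton, not_or] at hb
    obtain ⟨h1, h2, h3, h4, h5, h6, h7⟩ := hb
    simp [carryCmd, Cmd.eval_seq, Cmd.eval_scal_of_ne, Cmd.eval_setVar_of_ne, *]
  · simp [carryCmd, Cmd.eval_seq, Cmd.eval_scal_of_ne, Cmd.eval_scal_self,
      Cmd.eval_setVar_of_ne, Cmd.eval_setVar_self, RExpr.eval, RExpr.cell, RExpr.at,
      Ix.eval, hcast, h]
  · simp [carryCmd, Cmd.eval_seq, Cmd.eval_scal_of_ne, Cmd.eval_scal_self,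
      Cmd.eval_setVar_of_ne, Cmd.eval_setVar_self, RExpr.eval, RExpr.cell, RExpr.at,
      Ix.eval, hcast, h, h']
  · simp [carryCmd, Cmd.eval_seq, Cmd.eval_scal_of_ne, Cmd.eval_scal_self,
      Cmd.eval_setVar_of_ne, Cmd.eval_setVar_self, RExpr.eval, RExpr.cell, RExpr.at,
      Ix.eval, hcast, h, not_lt.2 h', zigzagNext]

end RealRAM

/-! ### The primal-dual iteration for bilinear saddle point problems -/

section PrimalDual

variable {E F : Type*} [NormedAddCommGroup E] [InnerProductSpace ℝ E]
  [NormedAddCommGroup F] [InnerProductSpace ℝ F]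

open scoped RealInnerProductSpace

/-- One step of the primal-dual iteration decreases the potential by the duality gap. -/
theorem primalDual_step (K : E →ₗ[ℝ] F) (KT : F → E) (hKT : ∀ f a, ⟪KT f, a⟫ = ⟪f, K a⟫)
    (hK : ∀ a, ‖K a‖ ≤ ‖a‖) (e : F) {R : ℝ} (hR : 0 < R) {x x' b : E} {v v' g w : F}
    (h₁ : ⟪x + R • KT (v + g) - x', b - x'⟫ ≤ 0)
    (h₂ : ⟪v + R⁻¹ • (e - K x') - v', w - v'⟫ ≤ 0) :
    ⟪w, e - K x'⟫ - ⟪v', e - K b⟫ ≤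
      (R / 2 * ‖w - v‖ ^ 2 + 1 / (2 * R) * ‖b - x‖ ^ 2 + R / 2 * ‖g‖ ^ 2 - ⟪g, K (b - x)⟫) -
      (R / 2 * ‖w - v'‖ ^ 2 + 1 / (2 * R) * ‖b - x'‖ ^ 2 + R / 2 * ‖v' - v‖ ^ 2 -
        ⟪v' - v, K (b - x')⟫) := by
  have e₁ : ⟪x - x', b - x'⟫ + R * ⟪v + g, K (b - x')⟫ ≤ 0 := by
    rw [← hKT, ← real_inner_smul_left, ← inner_add_left]
    convert h₁ using 2; abel
  have e₂ : ⟪v - v', w - v'⟫ + R⁻¹ * ⟪e - K x', w - v'⟫ ≤ 0 := by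
    rw [← real_inner_smul_left, ← inner_add_left]
    convert h₂ using 2; abel
  have e₃ : R * ⟪v - v', w - v'⟫ + ⟪e - K x', w - v'⟫ ≤ 0 := by
    have := mul_nonpos_of_nonneg_of_nonpos hR.le e₂
    rwa [mul_add, ← mul_assoc, mul_inv_cancel₀ hR.ne', one_mul] at this
  have e₄ : R⁻¹ * ⟪x - x', b - x'⟫ + ⟪v + g, K (b - x')⟫ ≤ 0 := by
    have := mul_nonpos_of_nonneg_of_nonpos (inv_pos.2 hR).le e₁
    rwa [mul_add, ← mul_assoc, inv_mul_cancel₀ hR.ne', one_mul] at this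
  have i₁ : 2 * ⟪v - v', w - v'⟫ = ‖w - v'‖ ^ 2 + ‖v' - v‖ ^ 2 - ‖w - v‖ ^ 2 := by
    have : w - v = (w - v') - (v - v') := by abel
    rw [this, norm_sub_sq_real (w - v') (v - v'), norm_sub_rev v' v, real_inner_comm]; ring
  have i₂ : 2 * ⟪x - x', b - x'⟫ = ‖b - x'‖ ^ 2 + ‖x' - x‖ ^ 2 - ‖b - x‖ ^ 2 := by
    have : b - x = (b - x') - (x - x') := by abel
    rw [this, norm_sub_sq_real (b - x') (x - x'), norm_sub_rev x' x, real_inner_comm]; ring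
  -- The only term that does not telescope. The inequality between arithmetic and geometric means
  -- applies because the step sizes `R` and `1 / R` have product `1` and `K` does not increase
  -- norms.
  have c₁ : ⟪g, K (x' - x)⟫ ≤ R / 2 * ‖g‖ ^ 2 + 1 / (2 * R) * ‖x' - x‖ ^ 2 := by
    have h := (real_inner_le_norm g (K (x' - x))).trans
      (mul_le_mul_of_nonneg_left (hK (x' - x)) (norm_nonneg g))
    have : 0 ≤ R / 2 * (‖g‖ - R⁻¹ * ‖x' - x‖) ^ 2 := by positivity
    have e : R / 2 * (‖g‖ - R⁻¹ * ‖x' - x‖) ^ 2 =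
        R / 2 * ‖g‖ ^ 2 + 1 / (2 * R) * ‖x' - x‖ ^ 2 - ‖g‖ * ‖x' - x‖ := by
      field_simp; ring
    linarith
  have i₃ : ⟪w, e - K x'⟫ - ⟪v', e - K b⟫ = ⟪e - K x', w - v'⟫ + ⟪v', K (b - x')⟫ := by
    rw [real_inner_comm]
    simp only [inner_sub_left, inner_sub_right, map_sub, real_inner_comm]
    ring
  -- The extrapolated `v + g` stands in for the unknown `v'`; the correction consists of two cross
  -- terms of the potential and the term bounded in `c₁`.
  have i₄ : ⟪v', K (b - x')⟫ = ⟪v + g, K (b - x')⟫ + ⟪v' - v, K (b - x')⟫ - ⟪g, K (b - x)⟫ +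
      ⟪g, K (x' - x)⟫ := by
    simp only [inner_add_left, inner_sub_left, inner_sub_right, map_sub]
    ring
  have r₁ : 1 / (2 * R) = R⁻¹ / 2 := by field_simp
  have j₁ := congrArg (R / 2 * ·) i₁
  have j₂ := congrArg (R⁻¹ / 2 * ·) i₂
  rw [r₁] at c₁ ⊢
  rw [i₃, i₄]
  linarith

/-- The duality gap, summed over the primal-dual iteration, is bounded. -/
theorem primalDual_gap (K : E →ₗ[ℝ] F) (KT : F → E) (hKT : ∀ f a, ⟪KT f, a⟫ = ⟪f, K a⟫)
    (hK : ∀ a, ‖K a‖ ≤ ‖a‖) (e : F) {R : ℝ} (hR : 0 < R) {b : E} {w : F}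
    {x : ℕ → E} {v vb : ℕ → F} (hx : x 0 = 0) (hv : v 0 = 0) (hvb : vb 0 = 0) (m : ℕ)
    (h₁ : ∀ t < m, ⟪x t + R • KT (vb t) - x (t + 1), b - x (t + 1)⟫ ≤ 0)
    (h₂ : ∀ t < m, ⟪v t + R⁻¹ • (e - K (x (t + 1))) - v (t + 1), w - v (t + 1)⟫ ≤ 0)
    (h₃ : ∀ t < m, vb (t + 1) = (2 : ℝ) • v (t + 1) - v t) :
    ∑ t ∈ Finset.range m, (⟪w, e - K (x (t + 1))⟫ - ⟪v (t + 1), e - K b⟫) ≤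
      R / 2 * ‖w‖ ^ 2 + 1 / (2 * R) * ‖b‖ ^ 2 := by
  -- Squared distances to the comparison pair, weighted by the step sizes, together with the
  -- extrapolation error.
  set Φ : ℕ → ℝ := fun t => R / 2 * ‖w - v t‖ ^ 2 + 1 / (2 * R) * ‖b - x t‖ ^ 2 +
    R / 2 * ‖vb t - v t‖ ^ 2 - ⟪vb t - v t, K (b - x t)⟫ with hΦ
  have hstep : ∀ t < m, ⟪w, e - K (x (t + 1))⟫ - ⟪v (t + 1), e - K b⟫ ≤ Φ t - Φ (t + 1) := by
    intro t ht
    have hd : vb (t + 1) - v (t + 1) = v (t + 1) - v t := by rw [h₃ t ht, two_smul]; abel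
    have := primalDual_step K KT hKT hK e hR (x := x t) (v := v t) (g := vb t - v t)
      (by simpa using h₁ t ht) (h₂ t ht)
    simpa only [hΦ, hd] using this
  -- The cross term of the potential is dominated by its squares, as in the bound `c₁` for a single
  -- step.
  have hpos : 0 ≤ Φ m := by
    have h := (real_inner_le_norm (vb m - v m) (K (b - x m))).trans
      (mul_le_mul_of_nonneg_left (hK (b - x m)) (norm_nonneg (vb m - v m)))
    have h' : 0 ≤ R / 2 * (‖vb m - v m‖ - R⁻¹ * ‖b - x m‖) ^ 2 := by positivity
    have e : R / 2 * (‖vb m - v m‖ - R⁻¹ * ‖b - x m‖) ^ 2 = R / 2 * ‖vb m - v m‖ ^ 2 +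
        1 / (2 * R) * ‖b - x m‖ ^ 2 - ‖vb m - v m‖ * ‖b - x m‖ := by
      field_simp; ring
    have h'' : 0 ≤ R / 2 * ‖w - v m‖ ^ 2 := by positivity
    simp only [hΦ]
    linarith
  calc _ ≤ ∑ t ∈ Finset.range m, (Φ t - Φ (t + 1)) :=
        Finset.sum_le_sum fun t ht => hstep t (Finset.mem_range.1 ht)
    _ = Φ 0 - Φ m := Finset.sum_range_sub' Φ m
    _ ≤ Φ 0 := by linarith
    _ = _ := by simp [hΦ, hx, hv, hvb]

end PrimalDual

/-! ### The hinge loss and linear programming duality -/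

/-- The hinge loss of a dual vector `z` for residuals `u`. -/
noncomputable def hingeLoss {n : ℕ} (u z : Fin n → ℝ) : ℝ := ∑ i, max 0 (1 - u i * z i)

/-- Each summand is `1`-Lipschitz in the product `uᵢ zᵢ`, and Cauchy–Schwarz sums the changes. This
converts the resolution of the net into an error of the loss. -/
theorem hingeLoss_le_add {n : ℕ} (u v z : Fin n → ℝ) :
    hingeLoss v z ≤ hingeLoss u z + ‖WithLp.toLp 2 (u - v)‖ * ‖WithLp.toLp 2 z‖ := by
  have h : hingeLoss v z ≤ hingeLoss u z + ∑ i, |(u - v) i| * |z i| := by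
    rw [hingeLoss, hingeLoss, ← Finset.sum_add_distrib]
    refine Finset.sum_le_sum fun i _ => max_le (by positivity) ?_
    have h1 := le_max_right 0 (1 - u i * z i)
    have h2 := le_abs_self ((u - v) i * z i)
    rw [abs_mul, Pi.sub_apply] at h2
    rw [Pi.sub_apply]
    linarith
  refine h.trans (add_le_add le_rfl ?_)
  rw [EuclideanSpace.norm_eq, EuclideanSpace.norm_eq, ← Real.sqrt_mul (by positivity)]
  refine Real.le_sqrt_of_sq_le ?_
  simpa using Finset.sum_mul_sq_le_sq_mul_sq Finset.univ (fun i => |(u - v) i|) (fun i => |z i|)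

/-- Weak duality: the total weight of a solution of the weighted estimating equations is at most
the hinge loss of any dual vector. -/
theorem sum_le_hingeLoss {n p : ℕ} {Z : Matrix (Fin n) (Fin p) ℝ} {w u : Fin n → ℝ}
    (hw : ∀ i, w i ∈ Set.Icc (0 : ℝ) 1) (h : Zᵀ *ᵥ (w * u) = 0) (α : Fin p → ℝ) :
    ∑ i, w i ≤ hingeLoss u (Z *ᵥ α) := by
  -- The estimating equations say that `w * u` is orthogonal to the range of `Z`, so the product
  -- term may be subtracted for free.
  have h0 : ∑ i, w i * (u i * (Z *ᵥ α) i) = 0 := by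
    have : (w * u) ⬝ᵥ (Z *ᵥ α) = 0 := by
      rw [Matrix.dotProduct_mulVec, ← Matrix.mulVec_transpose, h, zero_dotProduct]
    simpa [dotProduct, mul_assoc] using this
  calc ∑ i, w i = ∑ i, w i * (1 - u i * (Z *ᵥ α) i) := by
        simp only [mul_sub, mul_one, Finset.sum_sub_distrib, h0, sub_zero]
    _ ≤ _ := Finset.sum_le_sum fun i _ => by
        have h1 := le_max_left 0 (1 - u i * (Z *ᵥ α) i)
        have h2 := le_max_right 0 (1 - u i * (Z *ᵥ α) i)
        calc w i * (1 - u i * (Z *ᵥ α) i) ≤ w i * max 0 (1 - u i * (Z *ᵥ α) i) :=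
              mul_le_mul_of_nonneg_left h2 (hw i).1
          _ ≤ 1 * max 0 (1 - u i * (Z *ᵥ α) i) := mul_le_mul_of_nonneg_right (hw i).2 h1
          _ = _ := one_mul _

/-- Strong duality: a lower bound on all hinge losses is a total weight attained by a solution of
the weighted estimating equations. -/
theorem exists_weights_of_le_hingeLoss {n p : ℕ} (Z : Matrix (Fin n) (Fin p) ℝ) (u : Fin n → ℝ)
    (m : ℝ) (h : ∀ α : Fin p → ℝ, m ≤ hingeLoss u (Z *ᵥ α)) :
    ∃ w : Fin n → ℝ, (∀ i, w i ∈ Set.Icc (0 : ℝ) 1) ∧ Zᵀ *ᵥ (w * u) = 0 ∧ m ≤ ∑ i, w i := by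
  by_contra! hcon
  -- If no weights attain `m`, the compact convex image of the unit cube under `Λ` misses the closed
  -- ray above `(0, m)`. A functional separating the two, suitably scaled, yields a dual vector of
  -- loss below `m`.
  let Λ : (Fin n → ℝ) →ₗ[ℝ] (Fin p → ℝ) × ℝ :=
    { toFun := fun w => (Zᵀ *ᵥ (w * u), ∑ i, w i)
      map_add' := fun a b => by
        simp [add_mul, Matrix.mulVec_add, Finset.sum_add_distrib]
      map_smul' := fun c a => by
        simp [Matrix.mulVec_smul, Finset.mul_sum] }
  have hΛ : Continuous Λ := Λ.continuous_of_finiteDimensional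
  set S : Set ((Fin p → ℝ) × ℝ) := Λ '' Set.Icc 0 1 with hS
  set T : Set ((Fin p → ℝ) × ℝ) := {0} ×ˢ Set.Ici m with hT
  have hdisj : Disjoint S T := by
    rw [Set.disjoint_left]
    rintro _ ⟨w, hw, rfl⟩ ⟨h1, h2⟩
    exact absurd h2 (not_le.2 (hcon w (fun i => ⟨hw.1 i, hw.2 i⟩) h1))
  obtain ⟨f, a, b, hfa, hab, hfb⟩ := geometric_hahn_banach_compact_closed
    ((convex_Icc 0 1).linear_image Λ) (isCompact_Icc.image hΛ)
    ((convex_singleton (0 : Fin p → ℝ)).prod (convex_Ici m))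
    (isClosed_singleton.prod isClosed_Ici) hdisj
  set l : ℝ := f (0, 1) with hl
  have hf0 : ∀ s : ℝ, f (0, s) = s * l := fun s => by
    have : ((0 : Fin p → ℝ), s) = s • ((0 : Fin p → ℝ), (1 : ℝ)) := by simp
    rw [this, map_smul, smul_eq_mul]
  have ha0 : 0 < a := by
    have := hfa (Λ 0) ⟨0, ⟨le_rfl, zero_le_one⟩, rfl⟩
    simpa using this
  have hlm : ∀ s, m ≤ s → b < s * l := fun s hs => by
    rw [← hf0]; exact hfb (0, s) ⟨rfl, hs⟩
  -- Otherwise the functional would be nonpositive at the point of height `max m 0` of the ray,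
  -- whereas it exceeds `b > a > 0` on the whole ray.
  have hl0 : 0 < l := by
    by_contra! hneg
    have h1 := hlm (max m 0) (le_max_left _ _)
    have h2 : max m 0 * l ≤ 0 := mul_nonpos_of_nonneg_of_nonpos (le_max_right _ _) hneg
    linarith
  let α : Fin p → ℝ := fun k => -(l⁻¹ * f (Pi.single k 1, 0))
  have hfx : ∀ x : Fin p → ℝ, f (x, 0) = -l * (x ⬝ᵥ α) := fun x => by
    have hx : (x, (0 : ℝ)) = ∑ k, x k • ((Pi.single k 1 : Fin p → ℝ), (0 : ℝ)) := by
      ext1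
      · simp only [Prod.fst_sum, Prod.smul_mk]
        exact pi_eq_sum_univ' x
      · simp [Prod.snd_sum]
    rw [hx, map_sum, dotProduct, Finset.mul_sum]
    refine Finset.sum_congr rfl fun k _ => ?_
    simp only [map_smul, smul_eq_mul, α]
    field_simp
  classical
  -- The vertex of the cube that maximizes the functional; its value there is `l` times the hinge
  -- loss of `Z *ᵥ α`.
  let w : Fin n → ℝ := fun i => if 0 < 1 - u i * (Z *ᵥ α) i then 1 else 0
  have hw : w ∈ Set.Icc (0 : Fin n → ℝ) 1 := by
    constructor <;> intro i <;> simp only [w] <;> split_ifs <;> simp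
  have hsum : ∑ i, w i * (1 - u i * (Z *ᵥ α) i) = hingeLoss u (Z *ᵥ α) :=
    Finset.sum_congr rfl fun i _ => by
      simp only [w]
      split_ifs with h
      · rw [one_mul, max_eq_right h.le]
      · rw [zero_mul, max_eq_left (not_lt.1 h)]
  have h1 : f (Λ w) = l * hingeLoss u (Z *ᵥ α) := by
    have : Λ w = (Zᵀ *ᵥ (w * u), 0) + (0, ∑ i, w i) := by simp [Λ]
    rw [this, map_add, hfx, hf0, ← hsum, Matrix.mulVec_transpose, ← Matrix.dotProduct_mulVec]
    simp only [dotProduct, Pi.mul_apply, mul_sub, mul_one, Finset.sum_sub_distrib]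
    rw [Finset.sum_congr rfl fun i _ => mul_assoc (w i) (u i) _]
    ring
  have h2 := hfa (Λ w) ⟨w, hw, rfl⟩
  have h3 := hlm m le_rfl
  have h4 := mul_le_mul_of_nonneg_left (h α) hl0.le
  linarith

/-- Under anti-concentration, shrinking a dual vector to the ball of radius `n / δ²` increases the
hinge loss by at most `2 ε n`. -/
theorem exists_smul_hingeLoss_le {n : ℕ} {ε δ : ℝ} (hδ : 0 < δ) (hn : 0 < n)
    {u z : Fin n → ℝ} (hu : FewSmallEntries ε δ u) (hz : FewSmallEntries ε δ z)
    (hu1 : ‖WithLp.toLp 2 u‖ = 1) :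
    ∃ c : ℝ, ‖WithLp.toLp 2 (c • z)‖ ≤ n / (δ * δ) ∧
      hingeLoss u (c • z) ≤ hingeLoss u z + 2 * ε * n := by
  have hε : 0 ≤ 2 * ε * n := by
    have : (0 : ℝ) ≤ ε * n := (Nat.cast_nonneg _).trans hu
    linarith
  set R : ℝ := n / (δ * δ) with hR
  have hn' : (0 : ℝ) < n := by exact_mod_cast hn
  have hR0 : 0 < R := by positivity
  set N : ℝ := ‖WithLp.toLp 2 z‖ with hN
  rcases le_or_gt N R with hNR | hNR
  · exact ⟨1, by simpa using hNR, by simpa using hε⟩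
  have hN0 : 0 < N := hR0.trans hNR
  refine ⟨R / N, ?_, ?_⟩
  · rw [WithLp.toLp_smul, norm_smul, Real.norm_of_nonneg (by positivity), div_mul_cancel₀ _ hN0.ne']
  set A : Set (Fin n) := {i | |u i| < δ / √(n : ℝ) * ‖WithLp.toLp 2 u‖} with hA
  set A' : Set (Fin n) := {i | |z i| < δ / √(n : ℝ) * ‖WithLp.toLp 2 z‖} with hA'
  classical
  have hcard : ∑ i, (if i ∈ A ∪ A' then (1 : ℝ) else 0) ≤ 2 * ε * n := by
    rw [Finset.sum_boole]
    have h1 : (Finset.univ.filter fun i => i ∈ A ∪ A').card = (A ∪ A').ncard := by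
      rw [← Set.ncard_coe_finset]; congr 1; ext; simp
    rw [h1]
    have h2 : ((A ∪ A').ncard : ℝ) ≤ A.ncard + A'.ncard := by
      exact_mod_cast Set.ncard_union_le A A'
    have h3 : (A.ncard : ℝ) ≤ ε * n := hu
    have h4 : (A'.ncard : ℝ) ≤ ε * n := hz
    linarith
  calc hingeLoss u ((R / N) • z)
      ≤ ∑ i, (max 0 (1 - u i * z i) + if i ∈ A ∪ A' then (1 : ℝ) else 0) := ?_
    _ ≤ _ := by rw [Finset.sum_add_distrib]; exact add_le_add le_rfl hcard
  refine Finset.sum_le_sum fun i _ => ?_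
  have hc1 : R / N ≤ 1 := (div_le_one hN0).2 hNR.le
  have hc0 : 0 < R / N := by positivity
  have e : u i * ((R / N) • z) i = R / N * (u i * z i) := by
    simp only [Pi.smul_apply, smul_eq_mul]; ring
  rw [e]
  have hif : (0 : ℝ) ≤ if i ∈ A ∪ A' then (1 : ℝ) else 0 := by split_ifs <;> norm_num
  have h1 := le_max_right 0 (1 - u i * z i)
  have h0 := le_max_left 0 (1 - u i * z i)
  -- A nonpositive product only gains from shrinking. For a positive product the new loss is below
  -- `1`, which the indicator pays for on the exceptional sets.
  rcases le_or_gt (u i * z i) 0 with hneg | hpos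
  · have : u i * z i ≤ R / N * (u i * z i) := by nlinarith
    exact max_le (by linarith) (by linarith)
  · have hp : 0 < R / N * (u i * z i) := by positivity
    by_cases hi : i ∈ A ∪ A'
    · rw [if_pos hi]
      exact max_le (by linarith) (by linarith)
    · rw [if_neg hi]
      simp only [Set.mem_union, not_or, hA, hA', Set.mem_ofPred_eq, not_lt, hu1, mul_one] at hi
      -- Off both exceptional sets the product is at least `δ² N / n = N / R`, so after scaling by
      -- `R / N` it is still at least `1` and the loss vanishes. This dictates the radius `n / δ²`.
      have hk : δ / √(n : ℝ) * (δ / √(n : ℝ) * N) ≤ |u i| * |z i| :=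
        mul_le_mul hi.1 hi.2 (by positivity) (abs_nonneg _)
      rw [← abs_mul, abs_of_pos hpos] at hk
      have hk' : N / R = δ / √(n : ℝ) * (δ / √(n : ℝ) * N) := by
        rw [hR]; field_simp; exact Real.sq_sqrt hn'.le
      rw [← hk'] at hk
      have : 1 ≤ R / N * (u i * z i) := by
        calc (1 : ℝ) = R / N * (N / R) := by field_simp
          _ ≤ _ := mul_le_mul_of_nonneg_left hk hc0.le
      exact max_le (by linarith) (by linarith)

/-! ### Gram–Schmidt vectors, where dependent vectors lead to zero vectors -/

section GramSchmidt

open InnerProductSpace Finset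
open scoped RealInnerProductSpace

variable {E : Type*} [NormedAddCommGroup E] [InnerProductSpace ℝ E]

/-- The recursion in the form that the machine computes: the earlier rows are already normalized,
and rows that became zero contribute nothing. -/
theorem gramSchmidt_eq_sub_sum_normed (f : ℕ → E) (n : ℕ) :
    gramSchmidt ℝ f n =
      f n - ∑ i ∈ range n, ⟪f n, gramSchmidtNormed ℝ f i⟫ • gramSchmidtNormed ℝ f i := by
  have h := gramSchmidt_def'' ℝ f n
  rw [eq_sub_iff_add_eq]
  conv_rhs => rw [h]
  rw [Nat.Iio_eq_range]
  congr 1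
  refine sum_congr rfl fun i _ => ?_
  simp only [gramSchmidtNormed, inner_smul_right, smul_smul, real_inner_comm]
  congr 1
  simp
  ring

theorem inner_gramSchmidtNormed_of_ne (f : ℕ → E) {i j : ℕ} (h : i ≠ j) :
    ⟪gramSchmidtNormed ℝ f i, gramSchmidtNormed ℝ f j⟫ = 0 := by
  simp [gramSchmidtNormed, inner_smul_left, inner_smul_right, gramSchmidt_orthogonal ℝ f h]

theorem inner_gramSchmidtNormed_sum (f : ℕ → E) {m j : ℕ} (hj : j < m) (c : ℕ → ℝ) :
    ⟪gramSchmidtNormed ℝ f j, ∑ i ∈ range m, c i • gramSchmidtNormed ℝ f i⟫ =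
      c j * ‖gramSchmidtNormed ℝ f j‖ ^ 2 := by
  rw [inner_sum, sum_eq_single_of_mem j (mem_range.2 hj)]
  · rw [inner_smul_right, real_inner_self_eq_norm_sq]
  · intro i _ hi
    rw [inner_smul_right, inner_gramSchmidtNormed_of_ne f hi.symm, mul_zero]

theorem norm_sq_sum_gramSchmidtNormed (f : ℕ → E) (m : ℕ) (c : ℕ → ℝ) :
    ‖∑ i ∈ range m, c i • gramSchmidtNormed ℝ f i‖ ^ 2 =
      ∑ i ∈ range m, c i ^ 2 * ‖gramSchmidtNormed ℝ f i‖ ^ 2 := by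
  rw [← real_inner_self_eq_norm_sq, sum_inner]
  refine sum_congr rfl fun i hi => ?_
  rw [real_inner_smul_left, inner_gramSchmidtNormed_sum f (mem_range.1 hi)]
  ring

theorem norm_gramSchmidtNormed_eq (f : ℕ → E) (i : ℕ) :
    gramSchmidtNormed ℝ f i = 0 ∨ ‖gramSchmidtNormed ℝ f i‖ = 1 := by
  by_cases h : gramSchmidtNormed ℝ f i = 0
  · exact Or.inl h
  · exact Or.inr (gramSchmidtNormed_unit_length' h)

/-- Only an inequality, because some of the normalized vectors may be zero. -/
theorem norm_sq_sum_gramSchmidtNormed_le (f : ℕ → E) (m : ℕ) (c : ℕ → ℝ) :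
    ‖∑ i ∈ range m, c i • gramSchmidtNormed ℝ f i‖ ^ 2 ≤ ∑ i ∈ range m, c i ^ 2 := by
  rw [norm_sq_sum_gramSchmidtNormed]
  refine sum_le_sum fun i _ => ?_
  rcases norm_gramSchmidtNormed_eq f i with h | h
  · simp [h, sq_nonneg]
  · simp [h]

theorem span_gramSchmidtNormed_Iio (f : ℕ → E) (m : ℕ) :
    Submodule.span ℝ (gramSchmidtNormed ℝ f '' Set.Iio m) = Submodule.span ℝ (f '' Set.Iio m) := by
  rw [span_gramSchmidtNormed, span_gramSchmidt_Iio]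

theorem sum_gramSchmidtNormed_mem (f : ℕ → E) (m : ℕ) (c : ℕ → ℝ) :
    ∑ i ∈ range m, c i • gramSchmidtNormed ℝ f i ∈ Submodule.span ℝ (f '' Set.Iio m) := by
  rw [← span_gramSchmidtNormed_Iio]
  exact Submodule.sum_mem _ fun i hi => Submodule.smul_mem _ _
    (Submodule.subset_span ⟨i, mem_range.1 hi, rfl⟩)

/-- The expansion survives zero vectors in the system: they reproduce themselves trivially, and by
linearity it suffices to check the generators. -/
theorem sum_inner_gramSchmidtNormed (f : ℕ → E) {m : ℕ} {v : E}
    (hv : v ∈ Submodule.span ℝ (f '' Set.Iio m)) :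
    ∑ i ∈ range m, ⟪gramSchmidtNormed ℝ f i, v⟫ • gramSchmidtNormed ℝ f i = v := by
  rw [← span_gramSchmidtNormed_Iio] at hv
  induction hv using Submodule.span_induction with
  | mem x hx =>
    obtain ⟨j, hj, rfl⟩ := hx
    rw [sum_eq_single_of_mem j (mem_range.2 hj)]
    · rcases norm_gramSchmidtNormed_eq f j with h | h
      · simp [h]
      · rw [real_inner_self_eq_norm_sq, h, one_pow, one_smul]
    · intro i _ hi
      rw [inner_gramSchmidtNormed_of_ne f hi, zero_smul]
  | zero => simp
  | add x y _ _ hx hy => simp only [inner_add_right, add_smul, sum_add_distrib, hx, hy]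
  | smul a x _ hx => simp only [inner_smul_right, mul_smul, ← smul_sum, hx]

theorem sum_sq_inner_gramSchmidtNormed (f : ℕ → E) {m : ℕ} {v : E}
    (hv : v ∈ Submodule.span ℝ (f '' Set.Iio m)) :
    ∑ i ∈ range m, ⟪gramSchmidtNormed ℝ f i, v⟫ ^ 2 = ‖v‖ ^ 2 := by
  conv_rhs => rw [← sum_inner_gramSchmidtNormed f hv, norm_sq_sum_gramSchmidtNormed]
  refine sum_congr rfl fun i _ => ?_
  rcases norm_gramSchmidtNormed_eq f i with h | h
  · simp [h]
  · simp [h]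

end GramSchmidt

/-! ### Rounding -/

open Finset in
/-- Nonnegative numbers can be rounded such that all partial sums are rounded down. -/
theorem exists_rounding (x : ℕ → ℝ) (hx : ∀ j, 0 ≤ x j) :
    ∃ a : ℕ → ℕ, (∀ j, |x j - a j| ≤ 1) ∧ ∀ k, (∑ j ∈ range k, (a j : ℝ)) ≤ ∑ j ∈ range k, x j ∧
      ∑ j ∈ range k, x j ≤ ∑ j ∈ range k, (a j : ℝ) + 1 := by
  -- The integers are the increments of the floors of the partial sums `S k`, so their own partial
  -- sums telescope to these floors.
  set S : ℕ → ℝ := fun k => ∑ j ∈ range k, x j with hS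
  have hS0 : ∀ k, 0 ≤ S k := fun k => sum_nonneg fun j _ => hx j
  have hSs : ∀ k, S (k + 1) = S k + x k := fun k => sum_range_succ _ _
  have hmono : ∀ k, ⌊S k⌋₊ ≤ ⌊S (k + 1)⌋₊ := fun k =>
    Nat.floor_mono (by rw [hSs]; linarith [hx k])
  have hcast : ∀ k, ((⌊S (k + 1)⌋₊ - ⌊S k⌋₊ : ℕ) : ℝ) = ⌊S (k + 1)⌋₊ - ⌊S k⌋₊ := fun k =>
    Nat.cast_sub (hmono k)
  refine ⟨fun j => ⌊S (j + 1)⌋₊ - ⌊S j⌋₊, fun j => ?_, fun k => ?_⟩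
  · rw [hcast]
    have h1 := Nat.floor_le (hS0 j)
    have h2 := Nat.floor_le (hS0 (j + 1))
    have h3 := Nat.lt_floor_add_one (S j)
    have h4 := Nat.lt_floor_add_one (S (j + 1))
    have h5 := hSs j
    rw [abs_le]
    constructor <;> linarith
  · have : ∑ j ∈ range k, ((⌊S (j + 1)⌋₊ - ⌊S j⌋₊ : ℕ) : ℝ) = ⌊S k⌋₊ := by
      simp only [hcast]
      rw [sum_range_sub (fun k => (⌊S k⌋₊ : ℝ))]
      simp [hS]
    rw [this]
    exact ⟨Nat.floor_le (hS0 k), (Nat.lt_floor_add_one (S k)).le⟩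

/-- The enumeration `0, 1, -1, 2, -2, …` of the integers. -/
noncomputable def zigzag : ℕ → ℝ
  | 0 => 0
  | t + 1 => RealRAM.zigzagNext (zigzag t)

theorem zigzag_two_mul (a : ℕ) :
    zigzag (2 * a) = -(a : ℝ) ∧ zigzag (2 * a + 1) = a + 1 := by
  have key : ∀ a : ℕ, zigzag (2 * a) = -(a : ℝ) → zigzag (2 * a + 1) = a + 1 := fun a ha => by
    have : ¬ (0 : ℝ) < -(a : ℝ) := by simp
    rw [zigzag, ha, RealRAM.zigzagNext, if_neg this]; ring
  suffices h : zigzag (2 * a) = -(a : ℝ) from ⟨h, key a h⟩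
  induction a with
  | zero => simp [zigzag]
  | succ a ih =>
    have h : 2 * (a + 1) = (2 * a + 1) + 1 := by ring
    have : (0 : ℝ) < a + 1 := by positivity
    rw [h, zigzag, key a ih, RealRAM.zigzagNext, if_pos this]; push_cast; ring

/-- The integer of absolute value `a` with the sign of `c` is as far from `c` as `a` is from `|c|`.
Its place in the enumeration is at most `2 * a`, whence the budget `2 * L` of the odometer. -/
theorem exists_zigzag_eq (c : ℝ) (a : ℕ) :
    ∃ t ≤ 2 * a, |zigzag t| = a ∧ |c - zigzag t| = |(|c| - a)| := by
  rcases le_or_gt c 0 with hc | hc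
  · refine ⟨2 * a, le_rfl, ?_, ?_⟩
    · rw [(zigzag_two_mul a).1]; simp
    · rw [(zigzag_two_mul a).1, abs_of_nonpos hc, ← abs_neg]; ring_nf
  · cases a with
    | zero => exact ⟨0, le_rfl, by simp [zigzag], by simp [zigzag]⟩
    | succ a =>
      refine ⟨2 * a + 1, by omega, ?_, ?_⟩
      · rw [(zigzag_two_mul a).2]; push_cast; exact abs_of_nonneg (by positivity)
      · rw [(zigzag_two_mul a).2, abs_of_pos hc]; push_cast; rfl

/-- One `‖u - v‖` pays for moving the vector and one for changing the normalization from `‖u‖` to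
`‖v‖`. -/
theorem norm_inv_smul_sub_le {E : Type*} [NormedAddCommGroup E] [NormedSpace ℝ E] {u v : E}
    (hu : u ≠ 0) (hv : v ≠ 0) : ‖‖u‖⁻¹ • u - ‖v‖⁻¹ • v‖ ≤ 2 * ‖u - v‖ / ‖v‖ := by
  have hu' := norm_pos_iff.2 hu
  have hv' := norm_pos_iff.2 hv
  have e : ‖u‖⁻¹ • u - ‖v‖⁻¹ • v = ‖v‖⁻¹ • (u - v) + (‖u‖⁻¹ - ‖v‖⁻¹) • u := by
    rw [smul_sub, sub_smul]; abel
  have h1 : ‖(‖u‖⁻¹ - ‖v‖⁻¹) • u‖ = ‖v‖⁻¹ * |‖v‖ - ‖u‖| := by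
    rw [norm_smul, Real.norm_eq_abs]
    have : ‖u‖⁻¹ - ‖v‖⁻¹ = ‖u‖⁻¹ * (‖v‖⁻¹ * (‖v‖ - ‖u‖)) := by field_simp
    rw [this, abs_mul, abs_mul, abs_of_pos (inv_pos.2 hu'), abs_of_pos (inv_pos.2 hv')]
    field_simp
  have h2 : |‖v‖ - ‖u‖| ≤ ‖u - v‖ := by
    rw [abs_sub_comm]; exact abs_norm_sub_norm_le u v
  calc _ ≤ ‖‖v‖⁻¹ • (u - v)‖ + ‖(‖u‖⁻¹ - ‖v‖⁻¹) • u‖ := by rw [e]; exact norm_add_le _ _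
    _ = ‖v‖⁻¹ * ‖u - v‖ + ‖v‖⁻¹ * |‖v‖ - ‖u‖| := by
      rw [h1, norm_smul, norm_inv, norm_norm]
    _ ≤ ‖v‖⁻¹ * ‖u - v‖ + ‖v‖⁻¹ * ‖u - v‖ := by gcongr
    _ = _ := by ring

/-! ### The net of directions in the residual space -/

section Net

open InnerProductSpace Finset
open scoped RealInnerProductSpace

variable {E : Type*} [NormedAddCommGroup E] [InnerProductSpace ℝ E]

/-- The last coefficient of the point of the net with position `t`. -/
noncomputable def netWeight (L : ℝ) (d : ℕ) (t : ℕ → ℕ) : ℝ :=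
  L - ∑ j ∈ range d, |zigzag (t j)|

/-- The point of the net with position `t`. -/
noncomputable def netPoint (L : ℝ) (d : ℕ) (f : ℕ → E) (t : ℕ → ℕ) : E :=
  ∑ j ∈ range d, (if j + 1 < d then zigzag (t j) else netWeight L d t) • gramSchmidtNormed ℝ f j

/-- Directions with positive last coefficient are close to the direction of a point of the net. -/
theorem exists_netPoint_near (f : ℕ → E) (k : ℕ) {γ : ℝ} (hγ : 0 < γ) {v : E}
    (hv : v ∈ Submodule.span ℝ (f '' Set.Iio (k + 1))) (hpos : 0 < ⟪gramSchmidtNormed ℝ f k, v⟫) :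
    ∃ t : ℕ → ℕ, (∀ j, k ≤ j → t j = 0) ∧
      (∑ j ∈ range (k + 1), (t j : ℝ)) ≤ 2 * (2 * (k + 1 : ℕ) / γ) ∧
      0 < netWeight (2 * (k + 1 : ℕ) / γ) (k + 1) t ∧
      ‖‖netPoint (2 * (k + 1 : ℕ) / γ) (k + 1) f t‖⁻¹ •
        netPoint (2 * (k + 1 : ℕ) / γ) (k + 1) f t - ‖v‖⁻¹ • v‖ ≤ γ := by
  set L : ℝ := 2 * (k + 1 : ℕ) / γ with hL
  have hL0 : 0 < L := by positivity
  set c : ℕ → ℝ := fun j => ⟪gramSchmidtNormed ℝ f j, v⟫ with hc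
  set M : ℝ := ∑ j ∈ range (k + 1), |c j| with hM
  have hM0 : 0 < M := by
    have : |c k| ≤ M := single_le_sum (fun j _ => abs_nonneg (c j)) (mem_range.2 k.lt_succ_self)
    exact (abs_pos.2 hpos.ne').trans_le this
  -- Scale `v` so that the absolute values of its coefficients add up to `L`.
  set s : ℝ := L / M with hs
  have hs0 : 0 < s := by positivity
  obtain ⟨a, ha1, ha2⟩ := exists_rounding (fun j => |s * c j|) fun j => abs_nonneg _
  choose t₀ ht₀ ht₁ ht₂ using fun j => exists_zigzag_eq (s * c j) (a j)
  -- The last coefficient is not rounded: it receives what the others leave of `L`, so its position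
  -- stays `0`.
  set t : ℕ → ℕ := fun j => if j < k then t₀ j else 0 with ht
  have hsum : ∀ g : ℕ → ℝ, g 0 = 0 →
      ∑ j ∈ range (k + 1), g (t j) = ∑ j ∈ range k, g (t₀ j) := fun g hg => by
    rw [sum_range_succ]
    simp only [ht, lt_irrefl, if_false, hg, add_zero]
    exact sum_congr rfl fun j hj => by rw [if_pos (mem_range.1 hj)]
  have hsc : ∑ j ∈ range k, |s * c j| + s * c k = L := by
    have : L = s * M := by rw [hs]; field_simp
    rw [this, hM, sum_range_succ, mul_add, mul_sum, abs_of_pos hpos]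
    simp only [abs_mul, abs_of_pos hs0]
    rfl
  have hw : netWeight L (k + 1) t = L - ∑ j ∈ range k, (a j : ℝ) := by
    rw [netWeight, hsum (fun x => |zigzag x|) (by simp [zigzag])]
    simp only [ht₁]
  have hsck : 0 < s * c k := mul_pos hs0 hpos
  have hwpos : 0 < netWeight L (k + 1) t := by
    rw [hw]; linarith [(ha2 k).1]
  refine ⟨t, fun j hj => if_neg (not_lt.2 hj), ?_, hwpos, ?_⟩
  · rw [hsum (fun x => (x : ℝ)) Nat.cast_zero]
    calc ∑ j ∈ range k, (t₀ j : ℝ) ≤ ∑ j ∈ range k, 2 * (a j : ℝ) :=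
          sum_le_sum fun j _ => by exact_mod_cast ht₀ j
      _ = 2 * ∑ j ∈ range k, (a j : ℝ) := (mul_sum _ _ _).symm
      _ ≤ 2 * L := by linarith [(ha2 k).1]
  set z : ℕ → ℝ := fun j => if j + 1 < k + 1 then zigzag (t j) else netWeight L (k + 1) t with hz
  set u : E := netPoint L (k + 1) f t with hu
  have hbk : ‖gramSchmidtNormed ℝ f k‖ = 1 := by
    rcases norm_gramSchmidtNormed_eq f k with h | h
    · rw [h, inner_zero_left] at hpos; exact absurd hpos (lt_irrefl _)
    · exact h
  have hu0 : u ≠ 0 := by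
    intro h0
    have h1 := inner_gramSchmidtNormed_sum f k.lt_succ_self z
    have h2 : ∑ j ∈ range (k + 1), z j • gramSchmidtNormed ℝ f j = u := rfl
    rw [h2, h0, inner_zero_right, hbk] at h1
    simp only [hz, lt_irrefl, if_false] at h1
    linarith
  have hv0 : v ≠ 0 := by
    rintro rfl; rw [inner_zero_right] at hpos; exact absurd hpos (lt_irrefl _)
  have hsv : s • v = ∑ j ∈ range (k + 1), (s * c j) • gramSchmidtNormed ℝ f j := by
    conv_lhs => rw [← sum_inner_gramSchmidtNormed f hv, smul_sum]
    simp only [smul_smul, hc]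
  -- Every coefficient moves by at most `1`. For the last one this is the control of the partial
  -- sums in `exists_rounding`, which also keeps it positive.
  have hdist : ‖u - s • v‖ ^ 2 ≤ (k + 1 : ℕ) := by
    have : u - s • v = ∑ j ∈ range (k + 1), (z j - s * c j) • gramSchmidtNormed ℝ f j := by
      rw [hsv, hu, netPoint, ← sum_sub_distrib]
      simp only [sub_smul, hz]
    rw [this]
    refine (norm_sq_sum_gramSchmidtNormed_le f _ _).trans ?_
    have : ∀ j ∈ range (k + 1), (z j - s * c j) ^ 2 ≤ 1 := fun j hj => by
      rw [sq_le_one_iff_abs_le_one]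
      rcases Nat.lt_succ_iff_lt_or_eq.1 (mem_range.1 hj) with h | rfl
      · simp only [hz, ht, add_lt_add_iff_right, h, if_true]
        rw [abs_sub_comm, ht₂]
        have := ha1 j
        simpa using this
      · simp only [hz, lt_irrefl, if_false, hw]
        rw [abs_le]
        constructor <;> linarith [(ha2 j).1, (ha2 j).2]
    simpa using sum_le_card_nsmul _ _ _ this
  -- Cauchy–Schwarz gives `‖s • v‖ ≥ L / √(k + 1)`. With `hdist`, the directions differ by at most
  -- `2 (k + 1) / L = γ`, which explains the width `L`.
  have hnorm : L ^ 2 ≤ (k + 1 : ℕ) * ‖s • v‖ ^ 2 := by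
    have h1 : (∑ j ∈ range (k + 1), |c j|) ^ 2 ≤ (k + 1 : ℕ) * ∑ j ∈ range (k + 1), |c j| ^ 2 := by
      simpa using sq_sum_le_card_mul_sum_sq (s := range (k + 1)) (f := fun j => |c j|)
    simp only [sq_abs] at h1
    rw [sum_sq_inner_gramSchmidtNormed f hv, ← hM] at h1
    have h2 : L = s * M := by rw [hs]; field_simp
    rw [norm_smul, Real.norm_of_nonneg hs0.le, h2, mul_pow, mul_pow]
    calc s ^ 2 * M ^ 2 ≤ s ^ 2 * ((k + 1 : ℕ) * ‖v‖ ^ 2) := by gcongr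
      _ = _ := by ring
  have hsv0 : s • v ≠ 0 := smul_ne_zero hs0.ne' hv0
  have hvv : ‖s • v‖⁻¹ • (s • v) = ‖v‖⁻¹ • v := by
    rw [norm_smul, Real.norm_of_nonneg hs0.le, smul_smul]
    congr 1; field_simp
  rw [← hvv]
  refine (norm_inv_smul_sub_le hu0 hsv0).trans ?_
  rw [div_le_iff₀ (norm_pos_iff.2 hsv0)]
  refine abs_le_of_sq_le_sq' ?_ (by positivity) |>.2
  have hLγ : L * γ = 2 * (k + 1 : ℕ) := by rw [hL]; field_simp
  have hk0 : (0 : ℝ) < (k + 1 : ℕ) := by positivity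
  have h3 : (2 * (k + 1 : ℕ) : ℝ) ^ 2 ≤ (k + 1 : ℕ) * (γ * ‖s • v‖) ^ 2 := by
    rw [← hLγ, mul_pow, mul_pow]
    calc L ^ 2 * γ ^ 2 ≤ (k + 1 : ℕ) * ‖s • v‖ ^ 2 * γ ^ 2 := by gcongr
      _ = _ := by ring
  have h4 : 4 * ((k + 1 : ℕ) : ℝ) ≤ (γ * ‖s • v‖) ^ 2 := by
    refine le_of_mul_le_mul_left ?_ hk0
    linarith
  rw [mul_pow]
  linarith

end Net

/-! ### Enumeration of the positions in the net -/

section Odometer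

open Finset Function

/-- Process coordinate `j`; the flag signals that there is a carry. -/
def odometerStep (d B j : ℕ) (s : (ℕ → ℕ) × Bool) : (ℕ → ℕ) × Bool :=
  if s.2 then
    if ∑ i ∈ range d, s.1 i + 1 ≤ B then (update s.1 j (s.1 j + 1), false)
    else (update s.1 j 0, true)
  else s

/-- Process the first `j` coordinates. -/
def odometerFold (d B : ℕ) (a : ℕ → ℕ) : ℕ → (ℕ → ℕ) × Bool
  | 0 => (a, true)
  | j + 1 => odometerStep d B j (odometerFold d B a j)

/-- The next position. -/
def odometerNext (d B : ℕ) (a : ℕ → ℕ) : ℕ → ℕ := (odometerFold d B a d).1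

/-- Set the first `k` coordinates to `0`. -/
def resetBelow (k : ℕ) (a : ℕ → ℕ) : ℕ → ℕ := fun j => if j < k then 0 else a j

theorem odometerFold_of_le (d B : ℕ) (a : ℕ → ℕ) {i j : ℕ} (h : j ≤ i) :
    (odometerFold d B a j).1 i = a i := by
  induction j with
  | zero => rfl
  | succ j ih =>
    have h' : i ≠ j := by omega
    simp only [odometerFold, odometerStep]
    split_ifs <;> simp [h', ih (by omega)]

/-- Below `k` the budget is exhausted even after all preceding coordinates are reset, so the carry
passes through; coordinate `k` is the first that can absorb it. -/
theorem odometerNext_eq {d B k : ℕ} (hk : k < d) {a : ℕ → ℕ}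
    (h : ∀ i < k, B < ∑ j ∈ range d, resetBelow i a j + 1)
    (hk' : ∑ j ∈ range d, resetBelow k a j + 1 ≤ B) :
    odometerNext d B a = update (resetBelow k a) k (a k + 1) := by
  have h1 : ∀ j ≤ k, odometerFold d B a j = (resetBelow j a, true) := by
    intro j hj
    induction j with
    | zero => exact Prod.ext (by ext; simp [odometerFold, resetBelow]) rfl
    | succ j ih =>
      have := h j (by omega)
      rw [odometerFold, ih (by omega), odometerStep, if_pos rfl, if_neg (by simp only; omega)]
      ext i
      · by_cases hi : i = j
        · subst hi; simp [resetBelow]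
        · have : i < j + 1 ↔ i < j := by omega
          simp [resetBelow, hi, this]
      · rfl
  have h2 : ∀ j, odometerFold d B a (k + 1 + j) = (update (resetBelow k a) k (a k + 1), false) := by
    intro j
    induction j with
    | zero =>
      rw [add_zero, odometerFold, h1 k le_rfl, odometerStep, if_pos rfl, if_pos hk']
      simp [resetBelow]
    | succ j ih => rw [← add_assoc, odometerFold, ih, odometerStep]; simp
  obtain ⟨e, rfl⟩ : ∃ e, d = k + 1 + e := ⟨d - (k + 1), by omega⟩
  rw [odometerNext, h2]

theorem sum_range_update {d k : ℕ} (hk : k < d) (a : ℕ → ℕ) :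
    ∑ j ∈ range d, update a k (a k + 1) j = ∑ j ∈ range d, a j + 1 := by
  rw [← add_sum_erase _ _ (mem_range.2 hk), ← add_sum_erase (range d) a (mem_range.2 hk)]
  rw [update_self, sum_congr rfl fun j hj => update_of_ne (ne_of_mem_erase hj) _ _]
  ring

/-- With slack `r` in the budget, the positions over the first `k` coordinates are visited in blocks
on which the top coordinate is constant, and Pascal's rule counts them. The clause on the final
position `e` says that the next carry runs through all `k` coordinates, which links consecutive
blocks. -/
theorem odometer_enumerates {d B k : ℕ} (hk : k < d) : ∀ (r : ℕ) (a : ℕ → ℕ),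
    (∀ j < k, a j = 0) → ∑ j ∈ range d, a j + r = B →
    (∀ i < (r + k).choose k, (∀ j, k ≤ j → (odometerNext d B)^[i] a j = a j)) ∧
    (∀ a' : ℕ → ℕ, (∀ j, k ≤ j → a' j = a j) → ∑ j ∈ range d, a' j ≤ B →
      ∃ i < (r + k).choose k, (odometerNext d B)^[i] a = a') ∧
    ∃ e, (odometerNext d B)^[(r + k).choose k - 1] a = e ∧ resetBelow k e = a ∧
      ∀ i < k, B < ∑ j ∈ range d, resetBelow i e j + 1 := by
  induction k with
  | zero =>
    intro r a _ _
    refine ⟨fun i hi j _ => ?_, fun a' h _ => ⟨0, by simp, funext fun j => (h j j.zero_le).symm⟩,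
      a, by simp, by ext; simp [resetBelow], fun i hi => absurd hi i.not_lt_zero⟩
    obtain rfl : i = 0 := by simpa using hi
    rfl
  | succ k ih =>
    have ih := ih (by omega)
    -- Coordinate `k` may now start at any value, and the positions with at least that value there
    -- are enumerated; in this form the induction on the slack `r` goes through.
    suffices H : ∀ (r : ℕ) (a : ℕ → ℕ), (∀ j < k, a j = 0) → ∑ j ∈ range d, a j + r = B →
        (∀ i < (r + (k + 1)).choose (k + 1),
          (∀ j, k + 1 ≤ j → (odometerNext d B)^[i] a j = a j)) ∧
        (∀ a' : ℕ → ℕ, (∀ j, k + 1 ≤ j → a' j = a j) → a k ≤ a' k → ∑ j ∈ range d, a' j ≤ B →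
          ∃ i < (r + (k + 1)).choose (k + 1), (odometerNext d B)^[i] a = a') ∧
        ∃ e, (odometerNext d B)^[(r + (k + 1)).choose (k + 1) - 1] a = e ∧
          (∀ j, k + 1 ≤ j → e j = a j) ∧
          ∀ i < k + 1, B < ∑ j ∈ range d, resetBelow i e j + 1 by
      intro r a ha hr
      obtain ⟨h1, h2, e, h3, h4, h5⟩ := H r a (fun j hj => ha j (by omega)) hr
      refine ⟨h1, fun a' g1 g2 => h2 a' g1 (by rw [ha k (by omega)]; omega) g2, e, h3, ?_, h5⟩
      ext j
      by_cases hj : j < k + 1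
      · simp [resetBelow, hj, ha j hj]
      · simp [resetBelow, hj, h4 j (by omega)]
    intro r
    induction r with
    | zero =>
      intro a ha hr
      obtain ⟨h1, h2, e, h3, h4, h5⟩ := ih 0 a ha hr
      simp only [zero_add, Nat.choose_self] at h1 h2 h3 ⊢
      refine ⟨fun i hi j hj => h1 i hi j (by omega), fun a' g1 g2 g3 => ?_, e, h3, fun j hj => ?_,
        fun i hi => ?_⟩
      · refine h2 a' (fun j hj => ?_) g3
        have hle : ∀ j ∈ range d, a j ≤ a' j := fun j _ => by
          rcases lt_trichotomy j k with h | h | h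
          · rw [ha j h]; omega
          · rw [h]; exact g2
          · rw [g1 j h]
        -- Without slack, a position dominating `a` within the budget has the same total, so its
        -- coordinate `k` cannot be larger.
        have heq : ∑ j ∈ range d, a j = ∑ j ∈ range d, a' j :=
          le_antisymm (sum_le_sum hle) (by omega)
        rcases hj.eq_or_lt with h | h
        · exact ((sum_eq_sum_iff_of_le hle).1 heq j (mem_range.2 (by omega))).symm
        · exact g1 j h
      · rw [← h4]; simp [resetBelow]; omega
      · rcases Nat.lt_succ_iff_lt_or_eq.1 hi with h | rfl
        · exact h5 i h
        · rw [h4]; omega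
    | succ r ihr =>
      intro a ha hr
      obtain ⟨h1, h2, e, h3, h4, h5⟩ := ih (r + 1) a ha hr
      have hm1 : 0 < (r + 1 + k).choose k := Nat.choose_pos (by omega)
      have hek : e k = a k := by rw [← h4]; simp [resetBelow]
      set a₁ : ℕ → ℕ := update a k (a k + 1) with ha₁
      have hnext : odometerNext d B e = a₁ := by
        rw [odometerNext_eq (by omega) h5 (by rw [h4]; omega), h4, hek]
      have hiter : (odometerNext d B)^[(r + 1 + k).choose k] a = a₁ := by
        rw [← Nat.sub_add_cancel hm1, iterate_succ_apply', h3, hnext]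
      have hs₁ : ∑ j ∈ range d, a₁ j + r = B := by
        rw [ha₁, sum_range_update (by omega)]; omega
      obtain ⟨g1, g2, e', g3, g4, g5⟩ := ihr a₁
        (fun j hj => by rw [ha₁, update_of_ne hj.ne, ha j hj]) hs₁
      have ha₁j : ∀ j, k + 1 ≤ j → a₁ j = a j := fun j hj => by
        rw [ha₁, update_of_ne (by omega)]
      -- Pascal's rule: first the block in which coordinate `k` keeps its value, then everything
      -- from the increment `a₁` on, with slack `r`.
      have hm : (r + 1 + (k + 1)).choose (k + 1) =
          (r + (k + 1)).choose (k + 1) + (r + 1 + k).choose k := by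
        have e1 : r + 1 + (k + 1) = (r + 1 + k) + 1 := by omega
        have e2 : r + (k + 1) = r + 1 + k := by omega
        rw [e1, Nat.choose_succ_succ', e2, add_comm]
      have hm2 : 0 < (r + (k + 1)).choose (k + 1) := Nat.choose_pos (by omega)
      rw [hm]
      refine ⟨fun i hi j hj => ?_, fun a' f1 f2 f3 => ?_, e', ?_, fun j hj => ?_, g5⟩
      · rcases lt_or_ge i ((r + 1 + k).choose k) with h | h
        · exact h1 i h j (by omega)
        · obtain ⟨i', rfl⟩ : ∃ i', i = i' + (r + 1 + k).choose k  :=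
            ⟨i - (r + 1 + k).choose k, by omega⟩
          rw [iterate_add_apply, hiter, g1 i' (by omega) j hj, ha₁j j hj]
      · rcases f2.eq_or_lt with h | h
        · obtain ⟨i, hi, hia⟩ := h2 a' (fun j hj => by
            rcases hj.eq_or_lt with h' | h'
            · rw [← h', h]
            · exact f1 j h') f3
          exact ⟨i, by omega, hia⟩
        · obtain ⟨i, hi, hia⟩ := g2 a' (fun j hj => by rw [f1 j hj, ha₁j j hj])
            (by rw [ha₁, update_self]; omega) f3
          exact ⟨i + (r + 1 + k).choose k, by omega, by rw [iterate_add_apply, hiter, hia]⟩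
      · have : (r + (k + 1)).choose (k + 1) + (r + 1 + k).choose k - 1 =
            ((r + (k + 1)).choose (k + 1) - 1) + (r + 1 + k).choose k := by omega
        rw [this, iterate_add_apply, hiter, g3]
      · rw [g4 j hj, ha₁j j hj]

/-- The number of positions. -/
def odometerLength (k B : ℕ) : ℕ := (B + k).choose k

/-- The odometer with `k + 1` coordinates runs through all positions that use the first `k`
coordinates only, and then sets the last coordinate to `1`. -/
theorem odometer_spec (k B : ℕ) (hB : 0 < B) :
    (∀ i < odometerLength k B, (odometerNext (k + 1) B)^[i] 0 k = 0) ∧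
    (odometerNext (k + 1) B)^[odometerLength k B] 0 k = 1 ∧
    ∀ a : ℕ → ℕ, (∀ j, k ≤ j → a j = 0) → ∑ j ∈ range (k + 1), a j ≤ B →
      ∃ i < odometerLength k B, (odometerNext (k + 1) B)^[i] 0 = a := by
  obtain ⟨h1, h2, e, h3, h4, h5⟩ :=
    odometer_enumerates (d := k + 1) (B := B) k.lt_succ_self B 0 (fun _ _ => rfl) (by simp)
  have hm : 0 < (B + k).choose k := Nat.choose_pos (by omega)
  refine ⟨fun i hi => h1 i hi k le_rfl, ?_, fun a ha ha' => h2 a ha ha'⟩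
  -- From the final position the carry resets all lower coordinates and reaches coordinate `k`; the
  -- total is then `0`, and `0 < B` lets it be absorbed.
  rw [odometerLength, ← Nat.sub_add_cancel hm, iterate_succ_apply', h3,
    odometerNext_eq k.lt_succ_self h5 (by rw [h4]; simp; omega), update_self]
  have : e k = 0 := by
    have := congrFun h4 k
    simpa [resetBelow] using this
  rw [this]

end Odometer

namespace RealRAM

open Finset Function InnerProductSpace
open scoped RealInnerProductSpace

/-! ### Vectors in memory -/

/-- The first `n` values of a sequence as a vector. -/
noncomputable def vecOf (n : ℕ) (g : ℕ → ℝ) : EuclideanSpace ℝ (Fin n) :=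
  WithLp.toLp 2 fun i => g i

/-- Row `j` of an array of rows of length `n`. -/
noncomputable def rowVec (n : ℕ) (r : ℕ → ℕ → ℝ) (a j : ℕ) : EuclideanSpace ℝ (Fin n) :=
  vecOf n fun i => r a (j * n + i)

theorem vecOf_congr {n : ℕ} {g h : ℕ → ℝ} (H : ∀ i < n, g i = h i) : vecOf n g = vecOf n h := by
  ext i; exact H i i.2

theorem inner_vecOf (n : ℕ) (g h : ℕ → ℝ) :
    ⟪vecOf n g, vecOf n h⟫ = ∑ i ∈ range n, g i * h i := by
  rw [PiLp.inner_apply, Finset.sum_range]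
  exact sum_congr rfl fun i _ => by simp [vecOf, mul_comm]

theorem norm_vecOf (n : ℕ) (g : ℕ → ℝ) : ‖vecOf n g‖ = √(∑ i ∈ range n, g i * g i) := by
  rw [← inner_vecOf, real_inner_self_eq_norm_sq, Real.sqrt_sq (norm_nonneg _)]

theorem norm_vecOf_sq (n : ℕ) (g : ℕ → ℝ) : ‖vecOf n g‖ ^ 2 = ∑ i ∈ range n, g i ^ 2 := by
  rw [← real_inner_self_eq_norm_sq, inner_vecOf]
  exact sum_congr rfl fun i _ => (sq _).symm

/-! ### Orthonormalization -/

/-- Division by `0` gives `0`, so a dependent row becomes the zero vector, in agreement with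
`gramSchmidtNormed`. -/
theorem gramSchmidtStep_eval {a : ℕ} (ha : a ∉ ({11, 12, 13} : Finset ℕ)) {w : ℕ → ℕ} {n : ℕ}
    (hn : w 0 = n) (r : ℕ → ℕ → ℝ) :
    (∀ b, b ∉ ({a, 11, 12, 13} : Finset ℕ) → (gramSchmidtStep a).eval w r b = r b) ∧
    ∃ T : EuclideanSpace ℝ (Fin n), T = rowVec n r a (w 4) - ∑ k ∈ range (w 4),
        ⟪rowVec n r a (w 4), rowVec n r a k⟫ • rowVec n r a k ∧
      (gramSchmidtStep a).eval w r 13 0 = ‖T‖ ∧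
      ∀ k, rowVec n ((gramSchmidtStep a).eval w r) a k =
        if k = w 4 then ‖T‖⁻¹ • T else rowVec n r a k := by
  subst hn
  simp only [Finset.mem_insert, Finset.mem_singleton, not_or] at ha
  obtain ⟨h1, h2, h3⟩ := ha
  have h1' : 11 ≠ a := Ne.symm h1
  have h3' : 13 ≠ a := Ne.symm h3
  set g : ℕ → ℝ := fun i => r a (w 4 * w 0 + i) - ∑ k ∈ range (w 4),
    (∑ x ∈ range (w 0), r a (w 4 * w 0 + x) * r a (k * w 0 + x)) * r a (k * w 0 + i) with hg
  have hT : vecOf (w 0) g = rowVec (w 0) r a (w 4) - ∑ k ∈ range (w 4),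
      ⟪rowVec (w 0) r a (w 4), rowVec (w 0) r a k⟫ • rowVec (w 0) r a k := by
    simp only [rowVec, inner_vecOf]
    ext i
    simp [vecOf, hg]
  have h13 : (gramSchmidtStep a).eval w r 13 0 = ‖vecOf (w 0) g‖ := by
    rw [norm_vecOf]
    simp [gramSchmidtStep, Cmd.eval_seq, Cmd.eval_scal_self,
      Cmd.eval_vec_of_ne, Cmd.eval_vec_self, Cmd.eval_row_of_ne, RExpr.avoids_iff, RExpr.eval,
      RExpr.cell, RExpr.at, RExpr.ent, Ix.eval, sum_range_ite_lt, h1, h2, h1', h3', hg]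
  refine ⟨fun b hb => ?_, vecOf (w 0) g, hT, h13, fun k => ?_⟩
  · simp only [Finset.mem_insert, Finset.mem_singleton, not_or] at hb
    obtain ⟨g1, g2, g3, g4⟩ := hb
    simp [gramSchmidtStep, Cmd.eval_seq, Cmd.eval_scal_of_ne, Cmd.eval_vec_of_ne,
      Cmd.eval_row_of_ne, RExpr.avoids_iff, RExpr.cell, RExpr.at, RExpr.ent, h1, h2, h1', h3',
      g1, g2, g3, g4]
  · have hk : ∀ i < w 0, (gramSchmidtStep a).eval w r a (k * w 0 + i) =
        if k = w 4 then ‖vecOf (w 0) g‖⁻¹ * g i else r a (k * w 0 + i) := fun i hi => by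
      rw [norm_vecOf]
      simp [gramSchmidtStep, Cmd.eval_seq, Cmd.eval_scal_of_ne, Cmd.eval_scal_self,
        Cmd.eval_vec_of_ne, Cmd.eval_vec_self, Cmd.eval_row_self, RExpr.avoids_iff, RExpr.eval,
        RExpr.cell, RExpr.at, RExpr.ent, Ix.eval, sum_range_ite_lt, h1, h2, h3, h1', h3', hg,
        hi, div_eq_inv_mul]
    rw [rowVec, vecOf_congr hk]
    split_ifs
    · ext i; simp [vecOf]
    · rfl

theorem gramSchmidtCmd_eval {a m : ℕ} (ha : a ∉ ({11, 12, 13} : Finset ℕ)) (w : ℕ → ℕ)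
    (r : ℕ → ℕ → ℝ) :
    (∀ b, b ∉ ({a, 11, 12, 13} : Finset ℕ) → (gramSchmidtCmd a m).eval w r b = r b) ∧
    (∀ j < w m, rowVec (w 0) ((gramSchmidtCmd a m).eval w r) a j =
      gramSchmidtNormed ℝ (rowVec (w 0) r a) j) ∧
    ∀ k, w m = k + 1 →
      (gramSchmidtCmd a m).eval w r 13 0 = ‖gramSchmidt ℝ (rowVec (w 0) r a) k‖ := by
  set f := rowVec (w 0) r a with hf
  have key := Cmd.eval_rep_of_forall (v := 4) (m := m) (c := gramSchmidtStep a) (w := w) (r := r)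
    (fun i r' => (∀ b, b ∉ ({a, 11, 12, 13} : Finset ℕ) → r' b = r b) ∧
      (∀ j < i, rowVec (w 0) r' a j = gramSchmidtNormed ℝ f j) ∧
      (∀ j, i ≤ j → rowVec (w 0) r' a j = f j) ∧
      ∀ k, i = k + 1 → r' 13 0 = ‖gramSchmidt ℝ f k‖) (by simp [hf]) ?_
  · exact ⟨key.1, key.2.1, key.2.2.2⟩
  rintro i hi r' ⟨h1, h2, h3, -⟩
  obtain ⟨g1, T, g2, g3, g4⟩ := gramSchmidtStep_eval ha (w := update w 4 i) (n := w 0) rfl r'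
  have e4 : update w 4 i 4 = i := rfl
  rw [e4] at g2
  simp only [e4] at g4
  have hT : T = gramSchmidt ℝ f i := by
    rw [g2, gramSchmidt_eq_sub_sum_normed, h3 i le_rfl]
    congr 1
    exact sum_congr rfl fun k hk => by rw [h2 k (mem_range.1 hk)]
  refine ⟨fun b hb => (g1 b hb).trans (h1 b hb), fun j hj => ?_, fun j hj => ?_, fun k hk => ?_⟩
  · refine (g4 j).trans ?_
    rcases Nat.lt_succ_iff_lt_or_eq.1 hj with h | rfl
    · rw [if_neg h.ne]; exact h2 j h
    · rw [if_pos rfl, hT]; simp [gramSchmidtNormed]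
  · refine (g4 j).trans ?_
    rw [if_neg (by omega)]; exact h3 j (by omega)
  · obtain rfl : i = k := by omega
    rw [g3, hT]

theorem loadCmd_eval (w : ℕ → ℕ) (r : ℕ → ℕ → ℝ) :
    (∀ b, b ∉ ({9, 10} : Finset ℕ) → loadCmd.eval w r b = r b) ∧
    (∀ k < w 2, ∀ x < w 0, loadCmd.eval w r 10 (k * w 0 + x) = r 2 (x * w 2 + k)) ∧
    ∀ j < w 1, ∀ x < w 0, loadCmd.eval w r 9 (j * w 0 + x) =
      if j + 1 < w 1 then r 0 (x * w 1 + j + 1) else r 1 x := by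
  set r₁ := (Cmd.rep 4 2 (.row 4 3 0 10 (.get 2 (.lin 3 2 4 0)))).eval w r with hr₁
  have k₁ : (∀ b, b ≠ 10 → r₁ b = r b) ∧
      ∀ k < w 2, ∀ x < w 0, r₁ 10 (k * w 0 + x) = r 2 (x * w 2 + k) := by
    refine Cmd.eval_rep_of_forall (fun i r' => (∀ b, b ≠ 10 → r' b = r b) ∧
      ∀ k < i, ∀ x < w 0, r' 10 (k * w 0 + x) = r 2 (x * w 2 + k)) (by simp) ?_
    rintro i hi r' ⟨h1, h2⟩
    obtain ⟨g1, g2⟩ := Cmd.eval_row (a := 10) (e := .get 2 (.lin 3 2 4 0)) (j := 4) (v := 3)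
      (m := 0) (by simp [RExpr.avoids_iff]) (by decide) (by decide) (update w 4 i) r'
    refine ⟨fun b hb => (g1 b hb).trans (h1 b hb), fun k hk x hx => ?_⟩
    refine (g2 k x hx).trans ?_
    rcases Nat.lt_succ_iff_lt_or_eq.1 hk with h | rfl
    · rw [if_neg (by simpa using h.ne)]; exact h2 k h x hx
    · simp [RExpr.eval, Ix.eval, h1]
  have k₂ : (∀ b, b ≠ 9 → loadCmd.eval w r b = r₁ b) ∧
      ∀ j < w 1, ∀ x < w 0, loadCmd.eval w r 9 (j * w 0 + x) =
        if j + 1 < w 1 then r₁ 0 (x * w 1 + j + 1) else r₁ 1 x := by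
    rw [loadCmd, Cmd.eval_seq, ← hr₁]
    refine Cmd.eval_rep_of_forall (fun i r' => (∀ b, b ≠ 9 → r' b = r₁ b) ∧
      ∀ j < i, ∀ x < w 0, r' 9 (j * w 0 + x) =
        if j + 1 < w 1 then r₁ 0 (x * w 1 + j + 1) else r₁ 1 x) (by simp) ?_
    rintro i hi r' ⟨h1, h2⟩
    obtain ⟨g1, g2⟩ := Cmd.eval_row (a := 9) (e := .ifLt (.add (.cast 4) (.lit 1)) (.cast 1)
      (.get 0 (.lin 3 1 4 1)) (.at 1 3)) (j := 4) (v := 3)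
      (m := 0) (by simp [RExpr.avoids_iff, RExpr.at]) (by decide) (by decide) (update w 4 i) r'
    refine ⟨fun b hb => (g1 b hb).trans (h1 b hb), fun k hk x hx => ?_⟩
    refine (g2 k x hx).trans ?_
    have hcast : ∀ x : ℕ, ((x : ℝ) + 1 < (w 1 : ℝ)) ↔ x + 1 < w 1 := fun x => by
      exact_mod_cast Iff.rfl
    rcases Nat.lt_succ_iff_lt_or_eq.1 hk with h | rfl
    · rw [if_neg (by simpa using h.ne)]; exact h2 k h x hx
    · simp [RExpr.eval, RExpr.at, Ix.eval, h1, hcast]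
  refine ⟨fun b hb => ?_, fun k hk x hx => ?_, fun j hj x hx => ?_⟩
  · simp only [Finset.mem_insert, Finset.mem_singleton, not_or] at hb
    rw [k₂.1 b hb.1, k₁.1 b hb.2]
  · rw [k₂.1 10 (by decide), k₁.2 k hk x hx]
  · rw [k₂.2 j hj x hx, k₁.1 0 (by decide), k₁.1 1 (by decide)]

/-- The columns of the instruments in memory. -/
noncomputable def instrumentVec (w : ℕ → ℕ) (r : ℕ → ℕ → ℝ) (k : ℕ) :
    EuclideanSpace ℝ (Fin (w 0)) :=
  vecOf (w 0) fun x => if k < w 2 then r 2 (x * w 2 + k) else 0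

/-- The columns of the covariates in memory, except for the first, followed by the responses. -/
noncomputable def residualVec (w : ℕ → ℕ) (r : ℕ → ℕ → ℝ) (j : ℕ) :
    EuclideanSpace ℝ (Fin (w 0)) :=
  vecOf (w 0) fun x => if j + 1 < w 1 then r 0 (x * w 1 + j + 1) else r 1 x

theorem gramSchmidt_congr {E : Type*} [NormedAddCommGroup E] [InnerProductSpace ℝ E]
    {f g : ℕ → E} {m : ℕ} (h : ∀ j < m, f j = g j) (j : ℕ) (hj : j < m) :
    gramSchmidt ℝ f j = gramSchmidt ℝ g j := by
  induction j using Nat.strong_induction_on with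
  | _ j ih =>
    rw [gramSchmidt_def, gramSchmidt_def, h j hj]
    congr 1
    refine sum_congr rfl fun i hi => ?_
    rw [ih i (mem_Iio.1 hi) ((mem_Iio.1 hi).trans hj)]

theorem gramSchmidtNormed_congr {E : Type*} [NormedAddCommGroup E] [InnerProductSpace ℝ E]
    {f g : ℕ → E} {m : ℕ} (h : ∀ j < m, f j = g j) (j : ℕ) (hj : j < m) :
    gramSchmidtNormed ℝ f j = gramSchmidtNormed ℝ g j := by
  rw [gramSchmidtNormed, gramSchmidtNormed, gramSchmidt_congr h j hj]

/-- The residual space is orthonormalized last, so array `13` still holds the norm of its last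
Gram–Schmidt vector. That vector is `y` minus its projection to the remaining columns, and its norm
decides whether `y` depends on them. -/
theorem setupCmd_eval (w : ℕ → ℕ) (r : ℕ → ℕ → ℝ) (hd : 0 < w 1) :
    (∀ b < 9, setupCmd.eval w r b = r b) ∧
    (∀ k < w 2, rowVec (w 0) (setupCmd.eval w r) 10 k =
      gramSchmidtNormed ℝ (instrumentVec w r) k) ∧
    (∀ j < w 1, rowVec (w 0) (setupCmd.eval w r) 9 j =
      gramSchmidtNormed ℝ (residualVec w r) j) ∧
    setupCmd.eval w r 13 0 = ‖gramSchmidt ℝ (residualVec w r) (w 1 - 1)‖ ∧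
    setupCmd.eval w r 14 0 = 2 * w 1 / r 5 0 ∧
    setupCmd.eval w r 15 0 = w 0 / (r 4 0 * r 4 0) ∧
    setupCmd.eval w r 16 0 = w 0 * (w 0 / (r 4 0 * r 4 0)) ∧
    setupCmd.eval w r 17 0 = 0 ∧ setupCmd.eval w r 18 0 = 0 ∧
    (∀ j < w 1, setupCmd.eval w r 19 j = 0) ∧ (∀ j < w 1, setupCmd.eval w r 20 j = 0) ∧
    setupCmd.eval w r 21 0 = 0 := by
  set r₁ := loadCmd.eval w r with hr₁
  set r₂ := (gramSchmidtCmd 10 2).eval w r₁ with hr₂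
  set r₃ := (gramSchmidtCmd 9 1).eval w r₂ with hr₃
  have hr : setupCmd.eval w r = paramCmd.eval w r₃ := rfl
  obtain ⟨l1, l2, l3⟩ := loadCmd_eval w r
  rw [← hr₁] at l1 l2 l3
  obtain ⟨g1, g2, -⟩ := gramSchmidtCmd_eval (a := 10) (m := 2) (by decide) w r₁
  rw [← hr₂] at g1 g2
  obtain ⟨f1, f2, f3⟩ := gramSchmidtCmd_eval (a := 9) (m := 1) (by decide) w r₂
  rw [← hr₃] at f1 f2 f3
  obtain ⟨p1, p14, p15, p16, p17, p18, p19, p20, p21⟩ := paramCmd_eval w r₃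
  have small : ∀ b < 9, r₃ b = r b := fun b hb => by
    rw [f1, g1, l1] <;> simp only [Finset.mem_insert, Finset.mem_singleton, not_or] <;> omega
  have e9 : rowVec (w 0) r₂ 9 = rowVec (w 0) r₁ 9 := by
    ext j; simp only [rowVec, g1 9 (by decide)]
  have i10 : ∀ k < w 2, rowVec (w 0) r₁ 10 k = instrumentVec w r k := fun k hk =>
    vecOf_congr fun x hx => by rw [l2 k hk x hx, if_pos hk]
  have i9 : ∀ j < w 1, rowVec (w 0) r₁ 9 j = residualVec w r j := fun j hj =>
    vecOf_congr fun x hx => by rw [l3 j hj x hx]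
  rw [hr, p14, p15, p16, small 4 (by decide), small 5 (by decide)]
  refine ⟨fun b hb => ?_, fun k hk => ?_, fun j hj => ?_, ?_, rfl, rfl, rfl, p17, p18, p19, p20,
    p21⟩
  · rw [p1, small b hb]
    simp only [Finset.mem_insert, Finset.mem_singleton, not_or]; omega
  · have : rowVec (w 0) (paramCmd.eval w r₃) 10 k = rowVec (w 0) r₂ 10 k := by
      simp only [rowVec, p1 10 (by decide), f1 10 (by decide)]
    rw [this, g2 k hk, gramSchmidtNormed_congr i10 k hk]
  · have : rowVec (w 0) (paramCmd.eval w r₃) 9 j = rowVec (w 0) r₃ 9 j := by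
      simp only [rowVec, p1 9 (by decide)]
    rw [this, f2 j hj, e9, gramSchmidtNormed_congr i9 j hj]
  · rw [p1 13 (by decide), f3 (w 1 - 1) (by omega), e9,
      gramSchmidt_congr i9 (w 1 - 1) (by omega)]

/-! ### The odometer in memory -/

/-- The memory holds the position `a`. -/
def HoldsPosition (d : ℕ) (r : ℕ → ℕ → ℝ) (a : ℕ → ℕ) : Prop :=
  (∀ j < d, r 19 j = a j) ∧ (∀ j < d, r 20 j = zigzag (a j)) ∧
    r 18 0 = (∑ j ∈ range d, a j : ℕ)

/-- Cell `21` records only whether the last coordinate was incremented. Since `a k = 0` beforehand,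
this is the new value of that coordinate. -/
theorem nextCmd_eval {w : ℕ → ℕ} {r : ℕ → ℕ → ℝ} {k : ℕ} (hd : w 1 = k + 1) (h14 : 0 ≤ r 14 0)
    {a : ℕ → ℕ} (ha : HoldsPosition (k + 1) r a) (hak : a k = 0) :
    (∀ b, b ∉ ({18, 19, 20, 21, 22, 39, 40} : Finset ℕ) → nextCmd.eval w r b = r b) ∧
    HoldsPosition (k + 1) (nextCmd.eval w r) (odometerNext (k + 1) ⌊2 * r 14 0⌋₊ a) ∧
    nextCmd.eval w r 21 0 = odometerNext (k + 1) ⌊2 * r 14 0⌋₊ a k := by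
  set B := ⌊2 * r 14 0⌋₊ with hB
  set F := odometerFold (k + 1) B a with hF
  -- For integers, comparison with the real number `2 * L` is the same as comparison with its floor,
  -- so the machine need not compute the floor.
  have hBle : ∀ s : ℕ, s + 1 ≤ B ↔ (s : ℝ) + 1 ≤ 2 * r 14 0 := fun s => by
    rw [hB, Nat.le_floor_iff (by linarith)]; push_cast; rfl
  set r₀ := (Cmd.scal 22 (.lit 1)).eval w r with hr₀
  have h₀ : ∀ b, b ≠ 22 → r₀ b = r b := fun b hb => Cmd.eval_scal_of_ne hb _ _ _
  have h22 : r₀ 22 0 = 1 := by rw [hr₀, Cmd.eval_scal_self]; simp [RExpr.eval]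
  have key := Cmd.eval_rep_of_forall (v := 4) (m := 1) (c := carryCmd) (w := w) (r := r₀)
    (fun i r' => (∀ b, b ∉ ({18, 19, 20, 21, 22, 39, 40} : Finset ℕ) → r' b = r b) ∧
      HoldsPosition (k + 1) r' (F i).1 ∧ r' 22 0 = (if (F i).2 then 1 else 0) ∧
      (i = k + 1 → r' 21 0 = (F (k + 1)).1 k)) ?_ ?_
  · rw [hd] at key
    exact ⟨key.1, key.2.1, key.2.2.2 rfl⟩
  · refine ⟨fun b hb => h₀ b fun h => hb (by simp [h]), ⟨?_, ?_, ?_⟩, by simpa [hF, odometerFold],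
      by simp⟩
    · rw [h₀ 19 (by decide)]; exact ha.1
    · rw [h₀ 20 (by decide)]; exact ha.2.1
    · rw [h₀ 18 (by decide)]; exact ha.2.2
  rintro i hi r' ⟨f1, ⟨f19, f20, f18⟩, f22, -⟩
  obtain ⟨c0, c1, c2, c3⟩ := carryCmd_eval (update w 4 i) r'
  have e4 : update w 4 i 4 = i := rfl
  have e1 : update w 4 i 1 = k + 1 := hd
  rw [hd] at hi
  simp only [e4, e1] at c1 c2 c3
  have e14 : r' 14 0 = r 14 0 := by rw [f1 14 (by decide)]
  have hFi : F (i + 1) = odometerStep (k + 1) B i (F i) := rfl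
  have hak' : (F i).1 k = 0 := by rw [hF, odometerFold_of_le _ _ _ (by omega), hak]
  refine ⟨fun b hb => (c0 b hb).trans (f1 b hb), ?_⟩
  by_cases hc : (F i).2 = true
  swap
  · rw [if_neg hc] at f22
    obtain ⟨g18, g19, g20, g22, g21⟩ := c1 f22
    have hFs : F (i + 1) = F i := by rw [hFi, odometerStep, if_neg hc]
    refine ⟨⟨?_, ?_, ?_⟩, ?_, fun h => ?_⟩
    · rw [g19, hFs]; exact f19
    · rw [g20, hFs]; exact f20
    · rw [g18, hFs]; exact f18
    · rw [g22, hFs, if_neg hc]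
    · rw [g21, ← h, if_neg (lt_irrefl _), hFs, hak', Nat.cast_zero]
  rw [if_pos hc] at f22
  have hsum : ∀ y, ∑ j ∈ range (k + 1), update (F i).1 i y j + (F i).1 i =
      ∑ j ∈ range (k + 1), (F i).1 j + y := fun y => by
    rw [sum_update_of_mem (mem_range.2 hi), sdiff_singleton_eq_erase,
      ← add_sum_erase (range (k + 1)) (F i).1 (mem_range.2 hi)]
    ring
  by_cases hs : ∑ j ∈ range (k + 1), (F i).1 j + 1 ≤ B
  · obtain ⟨g18, g19, g20, g22, g21⟩ := c3 f22 (by rw [f18, e14]; exact (hBle _).1 hs)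
    have hFs : F (i + 1) = (update (F i).1 i ((F i).1 i + 1), false) := by
      rw [hFi, odometerStep, if_pos hc, if_pos hs]
    rw [hFs]
    refine ⟨⟨fun j hj => ?_, fun j hj => ?_, ?_⟩, ?_, fun h => ?_⟩
    · rw [g19]
      by_cases hji : j = i
      · subst hji; simp [f19 j hj]
      · simp [hji, f19 j hj]
    · rw [g20]
      by_cases hji : j = i
      · subst hji; simp [f20 j hj, zigzag]
      · simp [hji, f20 j hj]
    · rw [g18, f18]
      have := hsum ((F i).1 i + 1)
      have h' : ∑ j ∈ range (k + 1), update (F i).1 i ((F i).1 i + 1) j =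
        ∑ j ∈ range (k + 1), (F i).1 j + 1 := by omega
      simp only [h']; push_cast; rfl
    · rw [g22]; simp
    · obtain rfl : i = k := by omega
      rw [g21, if_neg (lt_irrefl _), ← h, hFs]; simp [hak']
  · obtain ⟨g18, g19, g20, g22, g21⟩ := c2 f22 (by
      rw [f18, e14]; exact not_le.1 fun h => hs ((hBle _).2 h))
    have hFs : F (i + 1) = (update (F i).1 i 0, true) := by
      rw [hFi, odometerStep, if_pos hc, if_neg hs]
    rw [hFs]
    refine ⟨⟨fun j hj => ?_, fun j hj => ?_, ?_⟩, ?_, fun h => ?_⟩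
    · rw [g19]
      by_cases hji : j = i
      · subst hji; simp
      · simp [hji, f19 j hj]
    · rw [g20]
      by_cases hji : j = i
      · subst hji; simp [zigzag]
      · simp [hji, f20 j hj]
    · rw [g18, f18, f19 i hi]
      have := hsum 0
      rw [sub_eq_iff_eq_add]
      exact_mod_cast this.symm
    · rw [g22]; simp
    · obtain rfl : i = k := by omega
      rw [g21, if_neg (lt_irrefl _), ← h, hFs]; simp

end RealRAM

namespace RealRAM

open Finset Function InnerProductSpace
open scoped RealInnerProductSpace

/-! ### The primal-dual iteration in memory -/

theorem clampUnit_mem (x : ℝ) : 0 ≤ clampUnit x ∧ clampUnit x ≤ 1 := by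
  unfold clampUnit; split_ifs <;> constructor <;> linarith

theorem clampUnit_variational (x : ℝ) {y : ℝ} (h0 : 0 ≤ y) (h1 : y ≤ 1) :
    (x - clampUnit x) * (y - clampUnit x) ≤ 0 := by
  unfold clampUnit; split_ifs <;> nlinarith

/-- The obtuse angle inequality of the projection to a ball, in the form that `primalDual_gap`
requires. -/
theorem projection_variational {E : Type*} [NormedAddCommGroup E] [InnerProductSpace ℝ E] {R : ℝ}
    (hR : 0 < R) (a : E) {x : E} (hx : x = if R < ‖a‖ then (R / ‖a‖) • a else a) :
    ‖x‖ ≤ R ∧ ∀ b : E, ‖b‖ ≤ R → ⟪a - x, b - x⟫ ≤ 0 := by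
  split_ifs at hx with h
  · have ha : 0 < ‖a‖ := hR.trans h
    subst hx
    refine ⟨?_, fun b hb => ?_⟩
    · rw [norm_smul, Real.norm_of_nonneg (by positivity), div_mul_cancel₀ _ ha.ne']
    · have e : a - (R / ‖a‖) • a = (1 - R / ‖a‖) • a := by rw [sub_smul, one_smul]
      have h1 : 0 ≤ 1 - R / ‖a‖ := by rw [sub_nonneg, div_le_one ha]; exact h.le
      rw [e, real_inner_smul_left, inner_sub_right, real_inner_smul_right,
        real_inner_self_eq_norm_sq]
      refine mul_nonpos_of_nonneg_of_nonpos h1 ?_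
      have h2 := real_inner_le_norm a b
      have h3 : ‖a‖ * ‖b‖ ≤ ‖a‖ * R := by gcongr
      have h4 : R / ‖a‖ * ‖a‖ ^ 2 = ‖a‖ * R := by field_simp
      linarith
  · subst hx
    exact ⟨not_lt.1 h, fun b _ => by simp⟩

/-- The map from coefficients of dual vectors to vectors of products with the residuals. -/
noncomputable def saddleMap (n p : ℕ) (u : ℕ → ℝ) (Q : ℕ → ℕ → ℝ) :
    EuclideanSpace ℝ (Fin p) →ₗ[ℝ] EuclideanSpace ℝ (Fin n) where
  toFun a := WithLp.toLp 2 fun i => u i * ∑ k, a k * Q k i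
  map_add' a b := by ext i; simp [add_mul, sum_add_distrib, mul_add]
  map_smul' c a := by ext i; simp [mul_sum, mul_assoc, mul_left_comm]

theorem saddleMap_vecOf (n p : ℕ) (u : ℕ → ℝ) (Q : ℕ → ℕ → ℝ) (c : ℕ → ℝ) :
    saddleMap n p u Q (vecOf p c) = vecOf n fun i => u i * ∑ k ∈ range p, c k * Q k i := by
  ext i
  simp [saddleMap, vecOf, Finset.sum_range]

theorem exists_vecOf {p : ℕ} (a : EuclideanSpace ℝ (Fin p)) : ∃ c : ℕ → ℝ, a = vecOf p c :=
  ⟨fun k => if h : k < p then a ⟨k, h⟩ else 0, by ext i; simp [vecOf]⟩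

theorem inner_saddleMap (n p : ℕ) (u : ℕ → ℝ) (Q : ℕ → ℕ → ℝ) (g : ℕ → ℝ)
    (a : EuclideanSpace ℝ (Fin p)) :
    ⟪vecOf p fun k => ∑ i ∈ range n, Q k i * (u i * g i), a⟫ =
      ⟪vecOf n g, saddleMap n p u Q a⟫ := by
  obtain ⟨c, rfl⟩ := exists_vecOf a
  rw [saddleMap_vecOf, inner_vecOf, inner_vecOf]
  simp only [sum_mul, mul_sum]
  rw [sum_comm]
  exact sum_congr rfl fun i _ => sum_congr rfl fun k _ => by ring

/-- The combination of the `Q k` does not increase the norm, and neither does multiplication by the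
entries of `u`, which are at most `1` in magnitude. This permits step sizes with product `1`. -/
theorem norm_saddleMap_le {n p : ℕ} {u : ℕ → ℝ} {Q : ℕ → ℕ → ℝ} (hu : ‖vecOf n u‖ ≤ 1)
    (hQ : ∀ c : ℕ → ℝ, ‖∑ k ∈ range p, c k • vecOf n (Q k)‖ ^ 2 ≤ ∑ k ∈ range p, c k ^ 2)
    (a : EuclideanSpace ℝ (Fin p)) : ‖saddleMap n p u Q a‖ ≤ ‖a‖ := by
  obtain ⟨c, rfl⟩ := exists_vecOf a
  refine (sq_le_sq₀ (norm_nonneg _) (norm_nonneg _)).1 ?_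
  rw [saddleMap_vecOf, norm_vecOf_sq, norm_vecOf_sq]
  refine le_trans ?_ (hQ c)
  have e : ∑ k ∈ range p, c k • vecOf n (Q k) = vecOf n fun i => ∑ k ∈ range p, c k * Q k i := by
    ext i; simp [vecOf]
  rw [e, norm_vecOf_sq]
  refine sum_le_sum fun i hi => ?_
  have h1 : u i ^ 2 ≤ 1 := by
    have h2 : u i ^ 2 ≤ ∑ i ∈ range n, u i ^ 2 :=
      single_le_sum (f := fun i => u i ^ 2) (fun j _ => sq_nonneg _) hi
    rw [← norm_vecOf_sq] at h2
    exact h2.trans (pow_le_one₀ (norm_nonneg _) hu)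
  rw [mul_pow]
  exact mul_le_of_le_one_left (sq_nonneg _) h1

/-- The hinge loss of a linear combination of dual vectors. -/
noncomputable def hingeValue (n p : ℕ) (u : ℕ → ℝ) (Q : ℕ → ℕ → ℝ) (c : ℕ → ℝ) : ℝ :=
  ∑ i ∈ range n, max 0 (1 - u i * ∑ k ∈ range p, c k * Q k i)

/-- The state of the memory in the primal-dual iteration, for residuals `u`, an orthonormal system
`Q` of dual vectors, and radius `R`. -/
structure IsPrimalDual (n p : ℕ) (u : ℕ → ℝ) (Q : ℕ → ℕ → ℝ) (R : ℝ) (ρ : ℕ → ℕ → ℕ → ℝ)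
    (m : ℕ) : Prop where
  dual_zero : ∀ k < p, ρ 0 28 k = 0
  acc_zero : ∀ k < p, ρ 0 29 k = 0
  weight_zero : ∀ i < n, ρ 0 30 i = 0
  extra_zero : ∀ i < n, ρ 0 31 i = 0
  dual_succ : ∀ t < m, ∃ (a : ℕ → ℝ) (N : ℝ), (∀ k, a k = ρ t 28 k + R *
        ∑ i ∈ range n, Q k i * (u i * ρ t 31 i)) ∧
      N = √(∑ k ∈ range p, a k * a k) ∧
      (∀ k < p, ρ (t + 1) 28 k = if R < N then a k * (R / N) else a k)
  weight_succ : ∀ t < m, ∀ i < n, ρ (t + 1) 30 i = clampUnit (ρ t 30 i + (1 - u i *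
        ∑ k ∈ range p, ρ (t + 1) 28 k * Q k i) / R)
  extra_succ : ∀ t < m, ∀ i < n, ρ (t + 1) 31 i = 2 * ρ (t + 1) 30 i - ρ t 30 i
  acc_succ : ∀ t < m, ∀ k < p, ρ (t + 1) 29 k = ρ t 29 k + ρ (t + 1) 28 k

/-- Comparison weights in the cube have squared norm at most `n` and dual vectors have norm at most
`R`. Starting from zero, the summed gap is therefore at most `R n / 2 + R / 2 ≤ n R`, and the
average over `m ≥ n R` rounds is at most `1`. The average is realized by the mean dual vector. -/
theorem IsPrimalDual.value_le {n p : ℕ} {u : ℕ → ℝ} {Q : ℕ → ℕ → ℝ} {R : ℝ} {ρ : ℕ → ℕ → ℕ → ℝ}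
    {m : ℕ} (h : IsPrimalDual n p u Q R ρ m) (hn : 0 < n) (hR : 0 < R) (hm : n * R ≤ m)
    (hu : ‖vecOf n u‖ ≤ 1)
    (hQ : ∀ c : ℕ → ℝ, ‖∑ k ∈ range p, c k • vecOf n (Q k)‖ ^ 2 ≤ ∑ k ∈ range p, c k ^ 2) :
    ‖vecOf p fun k => ρ m 29 k / m‖ ≤ R ∧ ∀ b : ℕ → ℝ, ‖vecOf p b‖ ≤ R →
      hingeValue n p u Q (fun k => ρ m 29 k / m) ≤ hingeValue n p u Q b + 1 := by
  have hn' : (1 : ℝ) ≤ n := by exact_mod_cast hn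
  have hm0 : (0 : ℝ) < m := lt_of_lt_of_le (by positivity) hm
  set K := saddleMap n p u Q with hK
  set x : ℕ → EuclideanSpace ℝ (Fin p) := fun t => vecOf p (ρ t 28) with hx
  set v : ℕ → EuclideanSpace ℝ (Fin n) := fun t => vecOf n (ρ t 30) with hv
  set vb : ℕ → EuclideanSpace ℝ (Fin n) := fun t => vecOf n (ρ t 31) with hvb
  have hproj : ∀ t < m, ‖x (t + 1)‖ ≤ R ∧ ∀ b, ‖b‖ ≤ R →
      ⟪x t + R • (vecOf p fun k => ∑ i ∈ range n, Q k i * (u i * ρ t 31 i)) - x (t + 1),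
        b - x (t + 1)⟫ ≤ 0 := by
    intro t ht
    obtain ⟨a, N, ha, hN, hs⟩ := h.dual_succ t ht
    have e : x t + R • (vecOf p fun k => ∑ i ∈ range n, Q k i * (u i * ρ t 31 i)) = vecOf p a := by
      ext k; simp [hx, vecOf, ha]
    rw [e]
    refine projection_variational hR (vecOf p a) ?_
    rw [norm_vecOf, ← hN]
    split_ifs with hif
    · ext k; simp only [hx, vecOf, hs k k.2, if_pos hif]; simp [mul_comm]
    · ext k; simp [hx, vecOf, hs k k.2, if_neg hif]
  have hacc : ∀ t ≤ m, vecOf p (ρ t 29) = ∑ s ∈ range t, x (s + 1) := by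
    intro t ht
    induction t with
    | zero => ext k; simp [vecOf, h.acc_zero k k.2]
    | succ t ih =>
      rw [sum_range_succ, ← ih (by omega)]
      ext k; simp [vecOf, hx, h.acc_succ t (by omega) k k.2]
  set xb : EuclideanSpace ℝ (Fin p) := vecOf p fun k => ρ m 29 k / m with hxb
  have hxbs : xb = (m : ℝ)⁻¹ • ∑ s ∈ range m, x (s + 1) := by
    rw [← hacc m le_rfl]
    ext k; simp [hxb, vecOf, div_eq_inv_mul]
  have hxbR : ‖xb‖ ≤ R := by
    rw [hxbs, norm_smul, norm_inv, RCLike.norm_natCast, inv_mul_le_iff₀ hm0]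
    calc _ ≤ ∑ s ∈ range m, ‖x (s + 1)‖ := norm_sum_le _ _
      _ ≤ ∑ s ∈ range m, R := sum_le_sum fun s hs => (hproj s (mem_range.1 hs)).1
      _ = _ := by simp
  refine ⟨hxbR, fun b hb => ?_⟩
  have hKT : ∀ (f : EuclideanSpace ℝ (Fin n)) (a : EuclideanSpace ℝ (Fin p)),
      ⟪vecOf p fun k => ∑ i : Fin n, Q k i * (u i * f i), a⟫ = ⟪f, K a⟫ := fun f a => by
    obtain ⟨g, rfl⟩ := exists_vecOf f
    rw [← inner_saddleMap]
    simp [vecOf, Finset.sum_range]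
  classical
  -- The best response of the weights to the averaged dual vector; against it the saddle function
  -- equals the hinge loss.
  let ω : ℕ → ℝ := fun i =>
    if 0 < 1 - u i * ∑ k ∈ range p, ρ m 29 k / m * Q k i then 1 else 0
  set e : EuclideanSpace ℝ (Fin n) := vecOf n fun _ => 1 with he
  have hω : ∀ i, 0 ≤ ω i ∧ ω i ≤ 1 := fun i => by
    simp only [ω]; split_ifs <;> constructor <;> norm_num
  have gap := primalDual_gap K (fun f => vecOf p fun k => ∑ i : Fin n, Q k i * (u i * f i)) hKT
    (norm_saddleMap_le hu hQ) e hR (b := vecOf p b) (w := vecOf n ω) (x := x) (v := v) (vb := vb)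
    (by ext k; simp [hx, vecOf, h.dual_zero k k.2])
    (by ext k; simp [hv, vecOf, h.weight_zero k k.2])
    (by ext k; simp [hvb, vecOf, h.extra_zero k k.2]) m
    (fun t ht => by
      have := (hproj t ht).2 (vecOf p b) hb
      convert this using 7
      simp only [Finset.sum_range, hvb, vecOf])
    (fun t ht => by
      have e1 : v t + R⁻¹ • (e - K (x (t + 1))) = vecOf n fun i => ρ t 30 i + (1 - u i *
          ∑ k ∈ range p, ρ (t + 1) 28 k * Q k i) / R := by
        rw [hx, hK, saddleMap_vecOf]
        ext i; simp [hv, he, vecOf, div_eq_inv_mul]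
      have e2 : v (t + 1) = vecOf n fun i => clampUnit (ρ t 30 i + (1 - u i *
          ∑ k ∈ range p, ρ (t + 1) 28 k * Q k i) / R) :=
        vecOf_congr fun i hi => h.weight_succ t ht i hi
      rw [e1, e2]
      set y : ℕ → ℝ := fun i => ρ t 30 i + (1 - u i *
          ∑ k ∈ range p, ρ (t + 1) 28 k * Q k i) / R with hy
      have e3 : vecOf n y - vecOf n (fun i => clampUnit (y i)) =
        vecOf n fun i => y i - clampUnit (y i) := rfl
      have e4 : vecOf n ω - vecOf n (fun i => clampUnit (y i)) =
        vecOf n fun i => ω i - clampUnit (y i) := rfl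
      rw [e3, e4, inner_vecOf]
      exact sum_nonpos fun i _ => clampUnit_variational _ (hω i).1 (hω i).2)
    (fun t ht => by ext i; simp [hv, hvb, vecOf, h.extra_succ t ht i i.2])
  have hloss : ⟪vecOf n ω, e - K xb⟫ = hingeValue n p u Q (fun k => ρ m 29 k / m) := by
    have : e - K xb = vecOf n fun i => 1 - u i * ∑ k ∈ range p, ρ m 29 k / m * Q k i := by
      rw [hxb, hK, saddleMap_vecOf]; rfl
    rw [this, inner_vecOf, hingeValue]
    refine sum_congr rfl fun i _ => ?_
    simp only [ω]
    split_ifs with hif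
    · rw [one_mul, max_eq_right hif.le]
    · rw [zero_mul, max_eq_left (not_lt.1 hif)]
  -- All iterates of the weights lie in the unit cube, so against a fixed `b` each of them stays
  -- below the hinge loss of `b`.
  have hlow : ∀ t < m, ⟪v (t + 1), e - K (vecOf p b)⟫ ≤ hingeValue n p u Q b := fun t ht => by
    have : e - K (vecOf p b) = vecOf n fun i => 1 - u i * ∑ k ∈ range p, b k * Q k i := by
      rw [hK, saddleMap_vecOf]; rfl
    rw [this, hv, inner_vecOf, hingeValue]
    refine sum_le_sum fun i hi => ?_
    rw [h.weight_succ t ht i (mem_range.1 hi)]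
    obtain ⟨c0, c1⟩ := clampUnit_mem (ρ t 30 i + (1 - u i *
      ∑ k ∈ range p, ρ (t + 1) 28 k * Q k i) / R)
    calc _ ≤ clampUnit _ * max 0 (1 - u i * ∑ k ∈ range p, b k * Q k i) :=
          mul_le_mul_of_nonneg_left (le_max_right _ _) c0
      _ ≤ 1 * max 0 (1 - u i * ∑ k ∈ range p, b k * Q k i) :=
          mul_le_mul_of_nonneg_right c1 (le_max_left _ _)
      _ = _ := one_mul _
  have hsum : ∑ t ∈ range m, ⟪vecOf n ω, e - K (x (t + 1))⟫ = m * ⟪vecOf n ω, e - K xb⟫ := by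
    rw [← inner_sum, ← real_inner_smul_right, sum_sub_distrib, ← map_sum, hxbs, map_smul,
      smul_sub, smul_inv_smul₀ hm0.ne']
    simp [Nat.cast_smul_eq_nsmul]
  have hωn : ‖vecOf n ω‖ ^ 2 ≤ n := by
    rw [norm_vecOf_sq]
    calc _ ≤ ∑ i ∈ range n, (1 : ℝ) :=
          sum_le_sum fun i _ => pow_le_one₀ (hω i).1 (hω i).2
      _ = n := by simp
  have hbR : ‖vecOf p b‖ ^ 2 ≤ R ^ 2 := by gcongr
  have hfin : (m : ℝ) * hingeValue n p u Q (fun k => ρ m 29 k / m) - m * hingeValue n p u Q b ≤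
      n * R := by
    calc _ ≤ ∑ t ∈ range m, (⟪vecOf n ω, e - K (x (t + 1))⟫ - ⟪v (t + 1), e - K (vecOf p b)⟫) := by
          rw [sum_sub_distrib, hsum, hloss]
          have : ∑ t ∈ range m, ⟪v (t + 1), e - K (vecOf p b)⟫ ≤ m * hingeValue n p u Q b := by
            simpa using sum_le_card_nsmul (range m) _ _ fun t ht => hlow t (mem_range.1 ht)
          linarith
      _ ≤ _ := gap
      _ ≤ R / 2 * n + 1 / (2 * R) * R ^ 2 := by gcongr
      _ = R / 2 * n + R / 2 * 1 := by field_simp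
      _ ≤ R / 2 * n + R / 2 * n := by gcongr
      _ = _ := by ring
  have : (m : ℝ) * (hingeValue n p u Q (fun k => ρ m 29 k / m) - hingeValue n p u Q b) ≤ m * 1 := by
    linarith
  linarith [le_of_mul_le_mul_left this hm0]

end RealRAM

namespace RealRAM

open Finset Function InnerProductSpace
open scoped RealInnerProductSpace

/-! ### The body of the main loop -/

theorem hingeValue_eq (n p : ℕ) (u : ℕ → ℝ) (Q : ℕ → ℕ → ℝ) (c : ℕ → ℝ) :
    hingeValue n p u Q c = hingeLoss (vecOf n u).ofLp (∑ k ∈ range p, c k • vecOf n (Q k)).ofLp := by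
  rw [hingeValue, hingeLoss, Finset.sum_range]
  simp [vecOf]

/-- `v` approximates the minimum over a ball of radius `R` in the span of `g` of the hinge loss
for the point of the net with position `a`. -/
def IsValue {n : ℕ} (L R : ℝ) (d p : ℕ) (f g : ℕ → EuclideanSpace ℝ (Fin n)) (a : ℕ → ℕ)
    (v : ℝ) : Prop :=
  (∃ z ∈ Submodule.span ℝ (g '' Set.Iio p), ‖z‖ ≤ R ∧
    v = hingeLoss (‖netPoint L d f a‖⁻¹ • netPoint L d f a).ofLp z.ofLp) ∧
  ∀ z ∈ Submodule.span ℝ (g '' Set.Iio p), ‖z‖ ≤ R →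
    v ≤ hingeLoss (‖netPoint L d f a‖⁻¹ • netPoint L d f a).ofLp z.ofLp + 1

/-- The memory is prepared for the main loop, with residuals `f` and instruments `g`. -/
structure IsReady (w : ℕ → ℕ) (k : ℕ) (L R : ℝ) (f g : ℕ → EuclideanSpace ℝ (Fin (w 0)))
    (r : ℕ → ℕ → ℝ) : Prop where
  dim : w 1 = k + 1
  samples : 0 < w 0
  width_pos : 0 < L
  radius_pos : 0 < R
  one : r 6 0 = 1
  width : r 14 0 = L
  radius : r 15 0 = R
  iterations : r 16 0 = w 0 * R
  residuals : ∀ j < w 1, rowVec (w 0) r 9 j = gramSchmidtNormed ℝ f j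
  instruments : ∀ j < w 2, rowVec (w 0) r 10 j = gramSchmidtNormed ℝ g j

theorem IsReady.congr {w : ℕ → ℕ} {k : ℕ} {L R : ℝ} {f g : ℕ → EuclideanSpace ℝ (Fin (w 0))}
    {r r' : ℕ → ℕ → ℝ} (h : IsReady w k L R f g r) (hr : ∀ b < 17, r' b = r b) :
    IsReady w k L R f g r' where
  dim := h.dim
  samples := h.samples
  width_pos := h.width_pos
  radius_pos := h.radius_pos
  one := by rw [hr 6 (by decide), h.one]
  width := by rw [hr 14 (by decide), h.width]
  radius := by rw [hr 15 (by decide), h.radius]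
  iterations := by rw [hr 16 (by decide), h.iterations]
  residuals j hj := by rw [← h.residuals j hj]; simp only [rowVec, hr 9 (by decide)]
  instruments j hj := by rw [← h.instruments j hj]; simp only [rowVec, hr 10 (by decide)]

theorem norm_inv_smul_self_le {E : Type*} [NormedAddCommGroup E] [NormedSpace ℝ E] (x : E) :
    ‖‖x‖⁻¹ • x‖ ≤ 1 := by
  rw [norm_smul, norm_inv, norm_norm]
  exact inv_mul_le_one

theorem IsReady.pointCmd_eval {w : ℕ → ℕ} {k : ℕ} {L R : ℝ}
    {f g : ℕ → EuclideanSpace ℝ (Fin (w 0))} {r : ℕ → ℕ → ℝ} (h : IsReady w k L R f g r)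
    {a : ℕ → ℕ} (ha : HoldsPosition (k + 1) r a) :
    (∀ b < 23, pointCmd.eval w r b = r b) ∧
    pointCmd.eval w r 24 0 = netWeight L (k + 1) a ∧
    vecOf (w 0) (pointCmd.eval w r 27) =
      ‖netPoint L (k + 1) f a‖⁻¹ • netPoint L (k + 1) f a ∧
    (∀ k < w 2, pointCmd.eval w r 28 k = 0) ∧ (∀ k < w 2, pointCmd.eval w r 29 k = 0) ∧
    (∀ i < w 0, pointCmd.eval w r 30 i = 0) ∧ (∀ i < w 0, pointCmd.eval w r 31 i = 0) ∧
    pointCmd.eval w r 32 0 = 0 := by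
  obtain ⟨f1, c, N, u, hc, hu, hN, h24, h27, h28, h29, h30, h31, h32⟩ := RealRAM.pointCmd_eval w r
  have hc' : c = netWeight L (k + 1) a := by
    rw [hc, h.width, netWeight, h.dim]
    congr 1
    exact sum_congr rfl fun j hj => by rw [ha.2.1 j (mem_range.1 hj)]
  have hP : vecOf (w 0) u = netPoint L (k + 1) f a := by
    have e : netPoint L (k + 1) f a = ∑ j ∈ range (k + 1),
        (if j + 1 < k + 1 then r 20 j else c) • rowVec (w 0) r 9 j := by
      rw [netPoint]
      refine sum_congr rfl fun j hj => ?_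
      rw [h.residuals j (by rw [h.dim]; exact mem_range.1 hj), ha.2.1 j (mem_range.1 hj), hc']
    rw [e]
    ext i
    simp [vecOf, rowVec, hu, h.dim, -ite_smul, -ite_mul]
  refine ⟨f1, h24.trans hc', ?_, h28, h29, h30, h31, h32⟩
  rw [vecOf_congr h27, ← hP, hN, ← norm_vecOf]
  ext i
  simp [vecOf, div_eq_inv_mul]

/-- Cost of the body of the main loop. -/
def pointCost (B m : ℕ) : ℕ :=
  pointCmd.cost B + (m * (stepCmd.cost B + 1) + 1 + (valueCmd.cost B + nextCmd.cost B))

theorem iterate_stepCmd_eval {w : ℕ → ℕ} {r : ℕ → ℕ → ℝ} (h32 : r 32 0 = 0) (t : ℕ) :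
    (∀ b < 28, (stepCmd.eval w)^[t] r b = r b) ∧ (stepCmd.eval w)^[t] r 32 0 = t := by
  induction t with
  | zero => simpa using h32
  | succ t ih =>
    obtain ⟨f1, -, -, -, -, -, -, -, -, g32⟩ := stepCmd_eval w ((stepCmd.eval w)^[t] r)
    rw [iterate_succ_apply']
    refine ⟨fun b hb => (f1 b hb).trans (ih.1 b hb), ?_⟩
    rw [g32, ih.2]; push_cast; rfl

/-- The round counter is a real cell compared with `n R`, so the loop runs `⌈n R⌉` times although
this integer is never computed. -/
theorem stepLoop_halts {w : ℕ → ℕ} {r : ℕ → ℕ → ℝ} {s : State} {B : ℕ} (hs : Rel s w r)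
    (hB : ∀ v, w v ≤ B) (h32 : r 32 0 = 0) :
    Halts (.loop (.rlt (.cell 33 0) (.cell 17 0)) (stepCmd.compile 0)) s
      (⌈r 16 0⌉₊ * (stepCmd.cost B + 1) + 1) fun s' =>
        Rel s' w ((stepCmd.eval w)^[⌈r 16 0⌉₊] r) := by
  have test : ∀ (s' : State) (t : ℕ), Rel s' w ((stepCmd.eval w)^[t] r) →
      ((Test.rlt (.cell 33 0) (.cell 17 0)).Holds s' ↔ (t : ℝ) < r 16 0) := fun s' t h => by
    change s'.real (32 + 1) 0 < s'.real (16 + 1) 0 ↔ _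
    rw [h.2, h.2, (iterate_stepCmd_eval h32 t).2, (iterate_stepCmd_eval h32 t).1 16 (by decide)]
  refine Halts.loop (fun t s' => Rel s' w ((stepCmd.eval w)^[t] r)) _ s hs ?_ ?_ ?_
  · intro t ht s' h
    exact (test s' t h).2 (Nat.lt_ceil.1 ht)
  · intro s' h
    rw [test s' _ h, not_lt]
    exact Nat.le_ceil _
  · intro t _ s' h
    refine (stepCmd.halts 0 h hB).mono le_rfl fun s'' h'' => ?_
    rw [iterate_succ_apply']
    exact h''.1

theorem isPrimalDual_iterate {w : ℕ → ℕ} {r : ℕ → ℕ → ℝ}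
    (h28 : ∀ k < w 2, r 28 k = 0) (h29 : ∀ k < w 2, r 29 k = 0)
    (h30 : ∀ i < w 0, r 30 i = 0) (h31 : ∀ i < w 0, r 31 i = 0) (h32 : r 32 0 = 0) (m : ℕ) :
    (∀ b < 28, (stepCmd.eval w)^[m] r b = r b) ∧ (stepCmd.eval w)^[m] r 32 0 = m ∧
    IsPrimalDual (w 0) (w 2) (r 27) (fun k i => r 10 (k * w 0 + i)) (r 15 0)
      (fun t => (stepCmd.eval w)^[t] r) m := by
  have key := iterate_stepCmd_eval (w := w) h32
  refine ⟨(key m).1, (key m).2, h28, h29, h30, h31, fun t _ => ?_, fun t _ i hi => ?_,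
    fun t _ i hi => ?_, fun t _ k hk => ?_⟩
  all_goals
    obtain ⟨-, a, N, ha, hN, g28, g30, g31, g29, -⟩ := stepCmd_eval w ((stepCmd.eval w)^[t] r)
    rw [(key t).1 15 (by decide)] at ha g28 g30
    rw [(key t).1 10 (by decide), (key t).1 27 (by decide)] at ha g30
    simp only [iterate_succ_apply']
  · exact ⟨a, N, ha, hN, g28⟩
  · exact g30 i hi
  · exact g31 i hi
  · exact g29 k hk

theorem IsReady.pointProgram_halts {w : ℕ → ℕ} {k : ℕ} {L R : ℝ}
    {f g : ℕ → EuclideanSpace ℝ (Fin (w 0))} {r : ℕ → ℕ → ℝ} (h : IsReady w k L R f g r)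
    {a : ℕ → ℕ} (ha : HoldsPosition (k + 1) r a) (hak : a k = 0) {s : State} {B : ℕ}
    (hs : Rel s w r) (hB : ∀ v, w v ≤ B) :
    Halts pointProgram s (pointCost B ⌈w 0 * R⌉₊) fun s' => ∃ r', Rel s' w r' ∧
      IsReady w k L R f g r' ∧ (∀ b < 9, r' b = r b) ∧
      HoldsPosition (k + 1) r' (odometerNext (k + 1) ⌊2 * L⌋₊ a) ∧
      r' 21 0 = odometerNext (k + 1) ⌊2 * L⌋₊ a k ∧
      ∃ v, IsValue L R (k + 1) (w 2) f g a v ∧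
        r' 17 0 = if 0 < netWeight L (k + 1) a then max (r 17 0) v else r 17 0 := by
  obtain ⟨f1, h24, h27, h28, h29, h30, h31, h32⟩ := h.pointCmd_eval ha
  set r₁ := pointCmd.eval w r with hr₁
  set m := ⌈w 0 * R⌉₊ with hm
  have h16 : r₁ 16 0 = w 0 * R := by rw [f1 16 (by decide), h.iterations]
  obtain ⟨g1, g32, hpd⟩ := isPrimalDual_iterate h28 h29 h30 h31 h32 m
  set r₂ := (stepCmd.eval w)^[m] r₁ with hr₂
  obtain ⟨v1, val, hval, v17⟩ := valueCmd_eval w r₂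
  set r₃ := valueCmd.eval w r₂ with hr₃
  have e3 : ∀ b < 17, r₃ b = r b := fun b hb => by
    rw [v1, g1 b (by omega), f1 b (by omega)]
    simp only [Finset.mem_insert, Finset.mem_singleton, not_or]; omega
  have p3 : ∀ b, 18 ≤ b → b < 23 → r₃ b = r b := fun b hb hb' => by
    rw [v1, g1 b (by omega), f1 b (by omega)]
    simp only [Finset.mem_insert, Finset.mem_singleton, not_or]; omega
  have ha3 : HoldsPosition (k + 1) r₃ a := by
    unfold HoldsPosition
    rw [p3 18 (by decide) (by decide), p3 19 (by decide) (by decide),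
      p3 20 (by decide) (by decide)]
    exact ha
  have h14 : r₃ 14 0 = L := by rw [e3 14 (by decide), h.width]
  obtain ⟨n1, n2, n3⟩ := nextCmd_eval h.dim (h14 ▸ h.width_pos.le) ha3 hak
  set r₄ := nextCmd.eval w r₃ with hr₄
  have e4 : ∀ b < 17, r₄ b = r b := fun b hb => by
    rw [n1, e3 b hb]
    simp only [Finset.mem_insert, Finset.mem_singleton, not_or]; omega
  have hrow : ∀ j < w 2, vecOf (w 0) (fun i => r₁ 10 (j * w 0 + i)) = gramSchmidtNormed ℝ g j :=
    fun j hj => by rw [← h.instruments j hj]; simp only [rowVec, f1 10 (by decide)]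
  have hcomb : ∀ c : ℕ → ℝ, ∑ j ∈ range (w 2), c j • vecOf (w 0) (fun i => r₁ 10 (j * w 0 + i)) =
      ∑ j ∈ range (w 2), c j • gramSchmidtNormed ℝ g j := fun c =>
    sum_congr rfl fun j hj => by rw [hrow j (mem_range.1 hj)]
  have hQ : ∀ c : ℕ → ℝ,
      ‖∑ j ∈ range (w 2), c j • vecOf (w 0) ((fun j i => r₁ 10 (j * w 0 + i)) j)‖ ^ 2 ≤
        ∑ j ∈ range (w 2), c j ^ 2 := fun c => by
    rw [hcomb]; exact norm_sq_sum_gramSchmidtNormed_le g (w 2) c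
  have h15 : r₁ 15 0 = R := by rw [f1 15 (by decide), h.radius]
  rw [h15] at hpd
  obtain ⟨q1, q2⟩ := hpd.value_le h.samples h.radius_pos (Nat.le_ceil _)
    (by rw [h27]; exact norm_inv_smul_self_le _) hQ
  have hvv : val = hingeValue (w 0) (w 2) (r₁ 27) (fun j i => r₁ 10 (j * w 0 + i))
      (fun j => r₂ 29 j / m) := by
    rw [hval, hingeValue, g32, g1 27 (by decide), g1 10 (by decide)]
  have hmain : Halts pointProgram s (pointCost B m) fun s' => Rel s' w r₄ := by
    refine Halts.block_cons ((pointCmd.halts 0 hs hB).mono le_rfl fun s₁ h₁ => ?_)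
    have hl := stepLoop_halts h₁.1 hB h32
    rw [← hr₁, h16] at hl
    refine Halts.block_cons (hl.mono le_rfl fun s₂ h₂ => ?_)
    refine Halts.block_cons ((valueCmd.halts 0 h₂ hB).mono le_rfl fun s₃ h₃ => ?_)
    exact (nextCmd.halts 0 h₃.1 hB).mono le_rfl fun s₄ h₄ => h₄.1
  refine hmain.mono le_rfl fun s' hs' => ⟨r₄, hs', h.congr e4, fun b hb => e4 b (by omega), ?_,
    ?_, val, ⟨⟨∑ j ∈ range (w 2), (r₂ 29 j / m) • gramSchmidtNormed ℝ g j,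
      sum_gramSchmidtNormed_mem g _ _, ?_, ?_⟩, fun z hz hzR => ?_⟩, ?_⟩
  · rw [← h14]; exact n2
  · rw [n3, h14]
  · refine (sq_le_sq₀ (norm_nonneg _) h.radius_pos.le).1 ?_
    refine (norm_sq_sum_gramSchmidtNormed_le g (w 2) _).trans ?_
    rw [← norm_vecOf_sq (w 2) fun j => r₂ 29 j / m]
    exact (sq_le_sq₀ (norm_nonneg _) h.radius_pos.le).2 q1
  · rw [hvv, hingeValue_eq, hcomb, h27]
  -- A competitor `z` in the span is represented by its Gram–Schmidt coefficients, which have the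
  -- same norm as `z`.
  · have e := sum_inner_gramSchmidtNormed g hz
    have e2 := sum_sq_inner_gramSchmidtNormed g hz
    have := q2 (fun j => ⟪gramSchmidtNormed ℝ g j, z⟫) (by
      refine (sq_le_sq₀ (norm_nonneg _) h.radius_pos.le).1 ?_
      rw [norm_vecOf_sq, e2]
      exact (sq_le_sq₀ (norm_nonneg _) h.radius_pos.le).2 hzR)
    rw [hvv]
    refine this.trans ?_
    rw [hingeValue_eq, hcomb, h27, e]
  · rw [n1 17 (by decide), v17, g1 24 (by decide), h24, g1 17 (by decide), f1 17 (by decide)]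

/-! ### The main loop -/

/-- The largest of the values at the positions with positive weight among the first `i` positions,
and at least `0`. -/
def IsBest {n : ℕ} (L R : ℝ) (k p : ℕ) (f g : ℕ → EuclideanSpace ℝ (Fin n)) (i : ℕ)
    (b : ℝ) : Prop :=
  (b = 0 ∨ ∃ a, 0 < netWeight L (k + 1) a ∧ IsValue L R (k + 1) p f g a b) ∧
  ∀ j < i, 0 < netWeight L (k + 1) ((odometerNext (k + 1) ⌊2 * L⌋₊)^[j] 0) →
    ∃ v ≤ b, IsValue L R (k + 1) p f g ((odometerNext (k + 1) ⌊2 * L⌋₊)^[j] 0) v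

/-- The test compares the last coordinate of the position with `1`: it is `0` throughout the
enumeration and becomes `1` immediately afterwards. -/
theorem IsReady.mainLoop_halts {w : ℕ → ℕ} {k : ℕ} {L R : ℝ}
    {f g : ℕ → EuclideanSpace ℝ (Fin (w 0))} {r : ℕ → ℕ → ℝ} (h : IsReady w k L R f g r)
    (hL : 1 ≤ 2 * L) (h17 : r 17 0 = 0) (h21 : r 21 0 = 0) (hpos : HoldsPosition (k + 1) r 0)
    {s : State} {B : ℕ} (hs : Rel s w r) (hB : ∀ v, w v ≤ B) :
    Halts (.loop (.rlt (.cell 22 0) (.cell 7 0)) pointProgram) s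
      (odometerLength k ⌊2 * L⌋₊ * (pointCost B ⌈w 0 * R⌉₊ + 1) + 1) fun s' =>
      ∃ r', Rel s' w r' ∧ (∀ b < 9, r' b = r b) ∧
        IsBest L R k (w 2) f g (odometerLength k ⌊2 * L⌋₊) (r' 17 0) := by
  set next := odometerNext (k + 1) ⌊2 * L⌋₊ with hnext
  obtain ⟨o1, o2, -⟩ := odometer_spec k ⌊2 * L⌋₊ (Nat.floor_pos.2 hL)
  refine (Halts.loop (fun i s' => ∃ r', Rel s' w r' ∧ IsReady w k L R f g r' ∧
    (∀ b < 9, r' b = r b) ∧ HoldsPosition (k + 1) r' (next^[i] 0) ∧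
    r' 21 0 = next^[i] 0 k ∧ IsBest L R k (w 2) f g i (r' 17 0)) _ s ?_ ?_ ?_ ?_).mono le_rfl ?_
  · exact ⟨r, hs, h, fun _ _ => rfl, hpos, by simp [h21], Or.inl h17, by simp⟩
  · rintro i hi s' ⟨r', e, hr, -, -, e21, -⟩
    change s'.real (21 + 1) 0 < s'.real (6 + 1) 0
    rw [e.2, e.2, e21, hr.one, o1 i hi]
    norm_num
  · rintro s' ⟨r', e, hr, -, -, e21, -⟩
    change ¬ s'.real (21 + 1) 0 < s'.real (6 + 1) 0
    rw [e.2, e.2, e21, hr.one, o2]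
    norm_num
  · rintro i hi s' ⟨r', e, hr, hr9, hp, e21, hb⟩
    refine (hr.pointProgram_halts hp (o1 i hi) e hB).mono le_rfl ?_
    rintro s'' ⟨r'', e', hr', hr9', hp', e21', v, hv, e17⟩
    refine ⟨r'', e', hr', fun b hb => (hr9' b hb).trans (hr9 b hb), ?_, ?_, ?_⟩
    · rw [iterate_succ_apply']; exact hp'
    · rw [iterate_succ_apply']; exact e21'
    · split_ifs at e17 with hif
      · refine ⟨?_, fun j hj hjw => ?_⟩
        · rcases max_choice (r' 17 0) v with hm | hm
          · rw [e17, hm]; exact hb.1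
          · rw [e17, hm]; exact Or.inr ⟨_, hif, hv⟩
        · rcases Nat.lt_succ_iff_lt_or_eq.1 hj with hlt | rfl
          · obtain ⟨v', hle, hv'⟩ := hb.2 j hlt hjw
            exact ⟨v', hle.trans (by rw [e17]; exact le_max_left _ _), hv'⟩
          · exact ⟨v, by rw [e17]; exact le_max_right _ _, hv⟩
      · rw [e17]
        refine ⟨hb.1, fun j hj hjw => ?_⟩
        rcases Nat.lt_succ_iff_lt_or_eq.1 hj with hlt | rfl
        · exact hb.2 j hlt hjw
        · exact absurd hjw hif
  · rintro s' ⟨r', e, -, hr9, -, -, hb⟩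
    exact ⟨r', e, hr9, hb⟩

end RealRAM

open Finset InnerProductSpace
open scoped RealInnerProductSpace

/-! ### Properties of the stability -/

section Stability

variable {n d p : ℕ} [NeZero d] {ε δ : ℝ} {X : Matrix (Fin n) (Fin d) ℝ} {y : Fin n → ℝ}
  {Z : Matrix (Fin n) (Fin p) ℝ}

theorem mulVec_eq_dropFirst (X : Matrix (Fin n) (Fin d) ℝ) {β : Fin d → ℝ} (h : β 0 = 0) :
    X *ᵥ β = dropFirst X *ᵥ fun j => β j := by
  ext i
  simp only [Matrix.mulVec, dotProduct, dropFirst, Matrix.submatrix_apply, id]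
  have := Fintype.sum_subtype_add_sum_subtype (fun j : Fin d => j ≠ 0) fun j => X i j * β j
  rw [← this, add_eq_left]
  refine sum_eq_zero fun j _ => ?_
  rw [not_not.1 j.2, h, mul_zero]

theorem ivStability_le {w : Fin n → ℝ} (hw : ∀ i, w i ∈ Set.Icc (0 : ℝ) 1)
    {β : {j : Fin d // j ≠ 0} → ℝ} (h : Zᵀ *ᵥ (w * (dropFirst X *ᵥ β - y)) = 0) :
    ivStability X y Z ≤ n - ∑ i, w i := by
  refine csInf_le ⟨0, ?_⟩ ⟨w, fun j => if h : j ≠ 0 then β ⟨j, h⟩ else 0, hw, by simp, ?_, ?_⟩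
  · rintro _ ⟨w, β, hw, -, -, rfl⟩
    rw [sub_nonneg]
    calc ∑ i, |w i| ≤ ∑ i : Fin n, 1 :=
          sum_le_sum fun i _ => by rw [abs_of_nonneg (hw i).1]; exact (hw i).2
      _ = n := by simp
  · rw [ivSet, Set.mem_ofPred_eq, mulVec_eq_dropFirst X (by simp)]
    have e : (fun j : {j : Fin d // j ≠ 0} =>
        if h : (j : Fin d) ≠ 0 then β ⟨j, h⟩ else 0) = β := by
      ext j; simp [j.2]
    rw [e, h]
  · congr 1
    exact sum_congr rfl fun i _ => (abs_of_nonneg (hw i).1).symm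

theorem le_ivStability {x : ℝ} (h : ∀ (w : Fin n → ℝ) (β : {j : Fin d // j ≠ 0} → ℝ),
    (∀ i, w i ∈ Set.Icc (0 : ℝ) 1) → Zᵀ *ᵥ (w * (dropFirst X *ᵥ β - y)) = 0 →
      x ≤ n - ∑ i, w i) : x ≤ ivStability X y Z := by
  refine le_csInf ⟨_, 0, 0, by simp, rfl, by simp [ivSet], rfl⟩ ?_
  rintro _ ⟨w, β, hw, h0, hβ, rfl⟩
  rw [ivSet, Set.mem_ofPred_eq, mulVec_eq_dropFirst X h0] at hβ
  have := h w _ hw hβ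
  rwa [sum_congr rfl fun i _ => (abs_of_nonneg (hw i).1).symm] at this

theorem ivStability_nonneg : 0 ≤ ivStability X y Z :=
  le_ivStability fun w _ hw _ => by
    rw [sub_nonneg]
    calc ∑ i, w i ≤ ∑ i : Fin n, 1 := sum_le_sum fun i _ => (hw i).2
      _ = n := by simp

theorem ivStability_le_card : ivStability X y Z ≤ n := by
  simpa using ivStability_le (X := X) (y := y) (Z := Z) (w := 0) (β := 0) (by simp) (by simp)

theorem ivStability_eq_zero {β : {j : Fin d // j ≠ 0} → ℝ} (h : dropFirst X *ᵥ β = y) :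
    ivStability X y Z = 0 := by
  refine le_antisymm ?_ ivStability_nonneg
  simpa using ivStability_le (X := X) (y := y) (Z := Z) (w := 1) (β := β) (by simp) (by simp [h])

theorem FewSmallEntries.smul {v : Fin n → ℝ} (hε : 0 ≤ ε) (h : FewSmallEntries ε δ v) (c : ℝ) :
    FewSmallEntries ε δ (c • v) := by
  rcases eq_or_ne c 0 with rfl | hc
  · simp only [FewSmallEntries, zero_smul, WithLp.toLp_zero, norm_zero, mul_zero, Pi.zero_apply,
      abs_zero, lt_irrefl, Set.ofPred_false, Set.ncard_empty, Nat.cast_zero]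
    positivity
  · have e : {i : Fin n | |(c • v) i| < δ / √(n : ℝ) * ‖WithLp.toLp 2 (c • v)‖} =
        {i : Fin n | |v i| < δ / √(n : ℝ) * ‖WithLp.toLp 2 v‖} := by
      ext i
      simp only [Set.mem_ofPred_eq, Pi.smul_apply, smul_eq_mul, abs_mul, WithLp.toLp_smul,
        norm_smul, Real.norm_eq_abs, mul_left_comm _ |c|]
      exact mul_lt_mul_iff_right₀ (abs_pos.2 hc)
    rw [FewSmallEntries, e]
    exact h

/-- At least `(1 - ε) n` entries have square at least `δ² ‖v‖² / n`. If `v ≠ 0`, summation gives `(1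
- ε) δ² ≤ 1`, contradicting `(1 - ε) δ² > ε δ² ≥ 1`. -/
theorem FewSmallEntries.eq_zero {v : Fin n → ℝ} (hδ : 0 < δ) (hε : ε < 1 / 2)
    (hεδ : 1 ≤ ε * (δ * δ)) (h : FewSmallEntries ε δ v) : v = 0 := by
  rcases Nat.eq_zero_or_pos n with rfl | hn
  · exact Subsingleton.elim _ _
  have hn' : (0 : ℝ) < n := Nat.cast_pos.2 hn
  by_contra hv
  set N := ‖WithLp.toLp 2 v‖ with hN
  have hNpos : 0 < N := norm_pos_iff.2 fun h0 => hv (by simpa using h0)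
  set S : Set (Fin n) := {i : Fin n | |v i| < δ / √(n : ℝ) * N} with hS
  have hsq : N ^ 2 = ∑ i, v i ^ 2 := by
    rw [hN, EuclideanSpace.norm_sq_eq]; simp
  have hc : (S.ncard : ℝ) ≤ ε * n := h
  have hcompl : (S.ncard : ℝ) + (Sᶜ.ncard : ℝ) = n := by
    exact_mod_cast (Set.ncard_add_ncard_compl S).trans (by simp)
  classical
  have h1 : (Sᶜ.ncard : ℝ) * (δ ^ 2 / n * N ^ 2) ≤ N ^ 2 := by
    rw [hsq, Set.ncard_eq_toFinset_card', ← nsmul_eq_mul, ← hsq]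
    refine (card_nsmul_le_sum _ (fun i => v i ^ 2) _ fun i hi => ?_).trans ?_
    · rw [Set.mem_toFinset, Set.mem_compl_iff, hS, Set.mem_ofPred_eq, not_lt] at hi
      calc δ ^ 2 / n * N ^ 2 = (δ / √(n : ℝ) * N) ^ 2 := by
            rw [mul_pow, div_pow, Real.sq_sqrt hn'.le]
        _ ≤ |v i| ^ 2 := by gcongr
        _ = v i ^ 2 := sq_abs _
    · rw [hsq]
      exact sum_le_sum_of_subset_of_nonneg (subset_univ _) fun i _ _ => sq_nonneg _
  have h2 : (1 - ε) * δ ^ 2 * N ^ 2 ≤ N ^ 2 := by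
    calc (1 - ε) * δ ^ 2 * N ^ 2 = ((1 - ε) * n) * (δ ^ 2 / n * N ^ 2) := by field_simp
      _ ≤ Sᶜ.ncard * (δ ^ 2 / n * N ^ 2) := by
          gcongr
          linarith
      _ ≤ _ := h1
  have h3 : (1 - ε) * δ ^ 2 ≤ 1 := by
    by_contra h4
    have : 1 * N ^ 2 < (1 - ε) * δ ^ 2 * N ^ 2 := by gcongr; linarith
    linarith
  have h4 : 0 < (1 - 2 * ε) * δ ^ 2 := mul_pos (by linarith) (by positivity)
  nlinarith

end Stability

/-! ### Spans of columns -/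

theorem mem_span_iff_exists_mulVec {n m : ℕ} {ι : Type*} [Fintype ι] (A : Matrix (Fin n) ι ℝ)
    {f : ℕ → EuclideanSpace ℝ (Fin n)}
    (h : Set.range (fun j => WithLp.toLp 2 fun i => A i j) = f '' Set.Iio m)
    (v : EuclideanSpace ℝ (Fin n)) :
    v ∈ Submodule.span ℝ (f '' Set.Iio m) ↔ ∃ β : ι → ℝ, v = WithLp.toLp 2 (A *ᵥ β) := by
  rw [← h, Submodule.mem_span_range_iff_exists_fun]
  refine exists_congr fun β => ?_
  have e : ∑ j, β j • (WithLp.toLp 2 fun i => A i j : EuclideanSpace ℝ (Fin n)) =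
      WithLp.toLp 2 (A *ᵥ β) := by
    ext i
    simp [Matrix.mulVec, dotProduct, mul_comm]
  rw [e, eq_comm]

/-- The columns of the covariates, except for the first, followed by the responses. -/
noncomputable def residualColumns {n d : ℕ} (X : Matrix (Fin n) (Fin d) ℝ) (y : Fin n → ℝ)
    (j : ℕ) : EuclideanSpace ℝ (Fin n) :=
  WithLp.toLp 2 fun i => if h : j + 1 < d then X i ⟨j + 1, h⟩ else y i

/-- The columns of the instruments. -/
noncomputable def instrumentColumns {n p : ℕ} (Z : Matrix (Fin n) (Fin p) ℝ)
    (k : ℕ) : EuclideanSpace ℝ (Fin n) :=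
  WithLp.toLp 2 fun i => if h : k < p then Z i ⟨k, h⟩ else 0

theorem mem_span_instrumentColumns {n p : ℕ} (Z : Matrix (Fin n) (Fin p) ℝ)
    (v : EuclideanSpace ℝ (Fin n)) :
    v ∈ Submodule.span ℝ (instrumentColumns Z '' Set.Iio p) ↔
      ∃ α : Fin p → ℝ, v = WithLp.toLp 2 (Z *ᵥ α) := by
  refine mem_span_iff_exists_mulVec Z ?_ v
  ext x
  constructor
  · rintro ⟨j, rfl⟩
    exact ⟨j, j.2, by simp [instrumentColumns]⟩
  · rintro ⟨j, hj, rfl⟩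
    exact ⟨⟨j, hj⟩, by simp [instrumentColumns, Set.mem_Iio.1 hj]⟩

theorem residualColumns_last {n k : ℕ} (X : Matrix (Fin n) (Fin (k + 1)) ℝ) (y : Fin n → ℝ) :
    residualColumns X y k = WithLp.toLp 2 y := by
  ext i; simp [residualColumns]

theorem mem_span_residualColumns {n k : ℕ} (X : Matrix (Fin n) (Fin (k + 1)) ℝ)
    (y : Fin n → ℝ) (v : EuclideanSpace ℝ (Fin n)) :
    v ∈ Submodule.span ℝ (residualColumns X y '' Set.Iio k) ↔
      ∃ β, v = WithLp.toLp 2 (dropFirst X *ᵥ β) := by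
  refine mem_span_iff_exists_mulVec (dropFirst X) ?_ v
  ext x
  constructor
  · rintro ⟨⟨j, hj⟩, rfl⟩
    obtain ⟨i, rfl⟩ := Fin.exists_succ_eq.2 hj
    exact ⟨i, i.2, by ext; simp [residualColumns, dropFirst]; rfl⟩
  · rintro ⟨j, hj, rfl⟩
    have hj' : j + 1 < k + 1 := by simpa using hj
    exact ⟨⟨⟨j + 1, hj'⟩, by simp [Fin.ext_iff]⟩,
      by ext; simp [residualColumns, dropFirst, Set.mem_Iio.1 hj]⟩

theorem inner_gramSchmidtNormed_eq_zero {E : Type*} [NormedAddCommGroup E] [InnerProductSpace ℝ E]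
    {f : ℕ → E} {k : ℕ} {v : E} (hv : v ∈ Submodule.span ℝ (f '' Set.Iio k)) :
    ⟪gramSchmidtNormed ℝ f k, v⟫ = 0 := by
  rw [← sum_inner_gramSchmidtNormed f hv, inner_sum]
  refine sum_eq_zero fun i hi => ?_
  rw [real_inner_smul_right, inner_gramSchmidtNormed_of_ne f (mem_range.1 hi).ne', mul_zero]

theorem inner_gramSchmidtNormed_self {E : Type*} [NormedAddCommGroup E] [InnerProductSpace ℝ E]
    (f : ℕ → E) (k : ℕ) : ⟪gramSchmidtNormed ℝ f k, f k⟫ = ‖gramSchmidt ℝ f k‖ := by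
  have e : f k = gramSchmidt ℝ f k + ∑ i ∈ range k,
      ⟪f k, gramSchmidtNormed ℝ f i⟫ • gramSchmidtNormed ℝ f i := by
    rw [gramSchmidt_eq_sub_sum_normed, sub_add_cancel]
  have h0 : ⟪gramSchmidtNormed ℝ f k, ∑ i ∈ range k,
      ⟪f k, gramSchmidtNormed ℝ f i⟫ • gramSchmidtNormed ℝ f i⟫ = 0 :=
    inner_gramSchmidtNormed_eq_zero (sum_gramSchmidtNormed_mem f k _)
  rw [e, inner_add_right, h0, add_zero]
  rcases eq_or_ne (gramSchmidt ℝ f k) 0 with h | h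
  · simp [h]
  · simp only [gramSchmidtNormed, RCLike.ofReal_real_eq_id, id]
    rw [real_inner_smul_left, real_inner_self_eq_norm_sq, sq,
      inv_mul_cancel_left₀ (norm_ne_zero_iff.2 h)]

theorem mem_span_of_gramSchmidt_eq_zero {E : Type*} [NormedAddCommGroup E]
    [InnerProductSpace ℝ E] {f : ℕ → E} {k : ℕ} (h : gramSchmidt ℝ f k = 0) :
    f k ∈ Submodule.span ℝ (f '' Set.Iio k) := by
  rw [gramSchmidt_eq_sub_sum_normed, sub_eq_zero] at h
  rw [h]
  exact sum_gramSchmidtNormed_mem f k _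

/-! ### Correctness of the search over the net -/

section Correctness

open RealRAM

variable {n k p : ℕ} {ε δ : ℝ} {X : Matrix (Fin n) (Fin (k + 1)) ℝ} {y : Fin n → ℝ}
  {Z : Matrix (Fin n) (Fin p) ℝ}

/-- A nonzero last Gram–Schmidt coordinate means that `y` enters with nonzero coefficient; dividing
by its negative turns `v` into a residual. -/
theorem exists_eq_smul_residual {v : EuclideanSpace ℝ (Fin n)}
    (hv : v ∈ Submodule.span ℝ (residualColumns X y '' Set.Iio (k + 1)))
    (hpos : ⟪gramSchmidtNormed ℝ (residualColumns X y) k, v⟫ ≠ 0) :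
    ∃ (c : ℝ) (β : _), c ≠ 0 ∧ v.ofLp = c • (dropFirst X *ᵥ β - y) := by
  have e : residualColumns X y '' Set.Iio (k + 1) =
      insert (WithLp.toLp 2 y) (residualColumns X y '' Set.Iio k) := by
    rw [← residualColumns_last X y, ← Set.image_insert_eq]
    congr 1
    ext j; simp
  rw [e, Submodule.mem_span_insert] at hv
  obtain ⟨a, z, hz, rfl⟩ := hv
  have ha : a ≠ 0 := by
    rintro rfl
    rw [zero_smul, zero_add] at hpos
    exact hpos (inner_gramSchmidtNormed_eq_zero hz)
  obtain ⟨β, rfl⟩ := (mem_span_residualColumns X y z).1 hz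
  refine ⟨-a, -(a⁻¹) • β, neg_ne_zero.2 ha, ?_⟩
  ext i
  simp only [Matrix.mulVec_smul, WithLp.ofLp_add, WithLp.ofLp_smul, Pi.add_apply, Pi.smul_apply,
    Pi.sub_apply, smul_eq_mul]
  field_simp
  ring

/-- The net point is a multiple of a genuine residual, so it inherits anti-concentration. Every dual
vector can be shrunk into the ball, hence all hinge losses are at least `v - 1 - 2εn`, and strong
duality produces feasible weights of that total. -/
theorem ivStability_le_of_isValue (hε : 0 < ε) (hδ : 0 < δ) (hn : 0 < n)
    (hA : IVStrongAntiConcentration ε δ X y Z)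
    (hgs : gramSchmidt ℝ (residualColumns X y) k ≠ 0) {L : ℝ} {a : ℕ → ℕ}
    (ha : 0 < netWeight L (k + 1) a) {v : ℝ}
    (hv : IsValue L (n / (δ * δ)) (k + 1) p (residualColumns X y) (instrumentColumns Z) a v) :
    ivStability X y Z ≤ n - v + 2 * ε * n + 1 := by
  set f := residualColumns X y with hf
  set P := netPoint L (k + 1) f a with hP
  have hPmem : P ∈ Submodule.span ℝ (f '' Set.Iio (k + 1)) := sum_gramSchmidtNormed_mem f _ _
  have hb : 0 < ‖gramSchmidtNormed ℝ f k‖ := by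
    refine norm_pos_iff.2 (smul_ne_zero (inv_ne_zero ?_) hgs)
    simpa using hgs
  have hPin : 0 < ⟪gramSchmidtNormed ℝ f k, P⟫ := by
    rw [hP, netPoint, inner_gramSchmidtNormed_sum f (Nat.lt_succ_self k), if_neg (lt_irrefl _)]
    positivity
  have hP0 : P ≠ 0 := fun h => by rw [h, inner_zero_right] at hPin; exact hPin.false
  have hPn : 0 < ‖P‖ := norm_pos_iff.2 hP0
  obtain ⟨c, β, hc, hu⟩ := exists_eq_smul_residual (v := ‖P‖⁻¹ • P)
    (Submodule.smul_mem _ _ hPmem)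
    (by rw [real_inner_smul_right]; positivity)
  set u := (‖P‖⁻¹ • P).ofLp with hu'
  have hunorm : ‖WithLp.toLp 2 u‖ = 1 := by
    change ‖‖P‖⁻¹ • P‖ = 1
    rw [norm_smul, norm_inv, norm_norm, inv_mul_cancel₀ hPn.ne']
  have hfew : FewSmallEntries ε δ u := by rw [hu]; exact (hA.2 β).smul hε.le c
  obtain ⟨w, hw, hwu, hsum⟩ := exists_weights_of_le_hingeLoss Z u (v - 1 - 2 * ε * n) fun α => by
    obtain ⟨c', hc1, hc2⟩ := exists_smul_hingeLoss_le hδ hn hfew (hA.1 α) hunorm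
    have := hv.2 (WithLp.toLp 2 (c' • (Z *ᵥ α)))
      ((mem_span_instrumentColumns Z _).2 ⟨c' • α, by rw [Matrix.mulVec_smul]⟩) hc1
    linarith
  have hfeas : Zᵀ *ᵥ (w * (dropFirst X *ᵥ β - y)) = 0 := by
    have e : w * (dropFirst X *ᵥ β - y) = c⁻¹ • (w * u) := by
      rw [hu, mul_smul_comm, inv_smul_smul₀ hc]
    rw [e, Matrix.mulVec_smul, hwu, smul_zero]
  linarith [ivStability_le hw hfeas]

/-- Given feasible `w` and `β`, a net point near the direction of the residual has a value that is
the loss of some dual vector in the ball. By weak duality the same dual vector bounds `∑ w`, once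
the change of direction is paid with `γ R = εn`. -/
theorem le_ivStability_of_isBest (hε : 0 < ε) (hδ : 0 < δ)
    (hgs : gramSchmidt ℝ (residualColumns X y) k ≠ 0) {L : ℝ}
    (hL : L = 2 * (k + 1 : ℕ) / (ε * (δ * δ))) {b : ℝ}
    (hb : IsBest L (n / (δ * δ)) k p (residualColumns X y) (instrumentColumns Z)
      (odometerLength k ⌊2 * L⌋₊) b) (hL1 : 1 ≤ 2 * L) :
    n - b ≤ ivStability X y Z + ε * n := by
  rw [← sub_le_iff_le_add]
  refine le_ivStability fun w β hw hfeas => ?_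
  set f := residualColumns X y with hf
  set v : EuclideanSpace ℝ (Fin n) := WithLp.toLp 2 (y - dropFirst X *ᵥ β) with hv
  have hXβ : WithLp.toLp 2 (dropFirst X *ᵥ β) ∈ Submodule.span ℝ (f '' Set.Iio k) :=
    (mem_span_residualColumns X y _).2 ⟨β, rfl⟩
  have hve : v = f k - WithLp.toLp 2 (dropFirst X *ᵥ β) := by
    rw [hf, residualColumns_last]; rfl
  have hvmem : v ∈ Submodule.span ℝ (f '' Set.Iio (k + 1)) := by
    rw [hve]
    refine Submodule.sub_mem _ (Submodule.subset_span ⟨k, by simp, rfl⟩)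
      (Submodule.span_mono (Set.image_mono (Set.Iio_subset_Iio (Nat.le_succ k))) hXβ)
  have hpos : 0 < ⟪gramSchmidtNormed ℝ f k, v⟫ := by
    rw [hve, inner_sub_right, inner_gramSchmidtNormed_eq_zero hXβ, sub_zero,
      inner_gramSchmidtNormed_self]
    exact norm_pos_iff.2 hgs
  obtain ⟨t, ht0, htsum, htw, hnear⟩ :=
    exists_netPoint_near f k (γ := ε * (δ * δ)) (by positivity) hvmem hpos
  rw [← hL] at htsum htw hnear
  have htB : ∑ j ∈ range (k + 1), t j ≤ ⌊2 * L⌋₊ := by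
    rw [Nat.le_floor_iff (by linarith)]; push_cast; exact htsum
  obtain ⟨i, hi, hit⟩ := (odometer_spec k ⌊2 * L⌋₊ (Nat.floor_pos.2 hL1)).2.2 t ht0 htB
  obtain ⟨x, hxb, ⟨z, hz, hzR, hxz⟩, -⟩ := hb.2 i hi (by rw [hit]; exact htw)
  rw [hit] at hxz
  set P := netPoint L (k + 1) f t with hP
  obtain ⟨α, rfl⟩ := (mem_span_instrumentColumns Z z).1 hz
  have h1 : ∑ i, w i ≤ hingeLoss (‖v‖⁻¹ • v).ofLp (Z *ᵥ α) := by
    refine sum_le_hingeLoss hw ?_ α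
    -- The sign is reversed because `v` is `y` minus the fit, which makes its last coordinate
    -- positive; feasibility is indifferent to the sign.
    have e : w * (‖v‖⁻¹ • v).ofLp = (-‖v‖⁻¹) • (w * (dropFirst X *ᵥ β - y)) := by
      ext i; simp [hv]; ring
    rw [e, Matrix.mulVec_smul, hfeas, smul_zero]
  have h2 := hingeLoss_le_add (‖P‖⁻¹ • P).ofLp (‖v‖⁻¹ • v).ofLp (Z *ᵥ α)
  rw [← hxz] at h2
  have h3 : ‖WithLp.toLp 2 ((‖P‖⁻¹ • P).ofLp - (‖v‖⁻¹ • v).ofLp)‖ *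
      ‖WithLp.toLp 2 (Z *ᵥ α)‖ ≤ ε * (δ * δ) * (n / (δ * δ)) :=
    mul_le_mul hnear hzR (norm_nonneg _) (by positivity)
  have h4 : ε * (δ * δ) * (n / (δ * δ)) = ε * n := by field_simp
  linarith

end Correctness

namespace RealRAM

open Finset Function InnerProductSpace
open scoped RealInnerProductSpace

/-! ### Execution of the program -/

/-- Cost of the program after the trivial cases. -/
def mainCost (B N m : ℕ) : ℕ :=
  setupCmd.cost B + (N * (pointCost B m + 1) + 1 + outputCmd.cost B + 1 + 1)

theorem mainProgram_halts {w : ℕ → ℕ} {r : ℕ → ℕ → ℝ} {s : State} {B k : ℕ} (hs : Rel s w r)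
    (hB : ∀ v, w v ≤ B) (hd : w 1 = k + 1) (h5 : 0 < r 5 0) (h5' : r 5 0 < 1) (h4 : 0 < r 4 0)
    (h6 : r 6 0 = 1) {L R : ℝ} (hL : L = 2 * w 1 / r 5 0) (hR : R = w 0 / (r 4 0 * r 4 0)) :
    Halts mainProgram s (mainCost B (odometerLength k ⌊2 * L⌋₊) ⌈w 0 * R⌉₊) fun s' =>
      ∃ r', Rel s' w r' ∧ (gramSchmidt ℝ (residualVec w r) k = 0 → r' 7 0 = r 7 0) ∧
        (gramSchmidt ℝ (residualVec w r) k ≠ 0 → ∃ b,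
          IsBest L R k (w 2) (residualVec w r) (instrumentVec w r)
            (odometerLength k ⌊2 * L⌋₊) b ∧
          r' 7 0 = w 0 - b + 2 * (r 3 0 * w 0) + 1) := by
  obtain ⟨f1, f10, f9, f13, f14, f15, f16, f17, f18, f19, f20, f21⟩ :=
    setupCmd_eval w r (by omega)
  rw [hd, Nat.add_sub_cancel] at f13
  set r₁ := setupCmd.eval w r with hr₁
  refine Halts.seq ((setupCmd.halts 0 hs hB).mono le_rfl ?_)
  rintro s₁ ⟨e₁, -⟩
  have test : (Test.rlt (.cell 22 0) (.cell 14 0)).Holds s₁ ↔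
      gramSchmidt ℝ (residualVec w r) k ≠ 0 := by
    change s₁.real (21 + 1) 0 < s₁.real (13 + 1) 0 ↔ _
    rw [e₁.2, e₁.2, ← hr₁, f21, f13, norm_pos_iff]
  refine Halts.ite (fun h => ?_) fun h => ?_
  · have hgs := test.1 h
    have hn : 0 < w 0 := by
      refine Nat.pos_of_ne_zero fun h0 => hgs ?_
      have : IsEmpty (Fin (w 0)) := by rw [h0]; infer_instance
      exact Subsingleton.elim _ _
    have hd' : (1 : ℝ) ≤ w 1 := by rw [hd]; exact_mod_cast Nat.le_add_left 1 k
    have hL2 : 2 ≤ L := by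
      rw [hL, le_div_iff₀ h5]; nlinarith
    have hn' : (0 : ℝ) < w 0 := Nat.cast_pos.2 hn
    have ready : IsReady w k L R (residualVec w r) (instrumentVec w r) r₁ :=
      { dim := hd
        samples := hn
        width_pos := by linarith
        radius_pos := by rw [hR]; positivity
        one := by rw [f1 6 (by decide), h6]
        width := by rw [f14, hL]
        radius := by rw [f15, hR]
        iterations := by rw [f16, hR]
        residuals := f9
        instruments := f10 }
    refine Halts.seq ((ready.mainLoop_halts (by linarith) f17 f21 ?_ e₁ hB).mono le_rfl ?_)
    · rw [← hd]
      exact ⟨by simpa using f19, by simpa [zigzag] using f20, by simpa using f18⟩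
    rintro s₂ ⟨r₂, e₂, g1, g2⟩
    refine (outputCmd.halts 0 e₂ hB).mono le_rfl ?_
    rintro s₃ ⟨e₃, -⟩
    refine ⟨_, e₃, fun h0 => absurd h0 hgs, fun _ => ⟨_, g2, ?_⟩⟩
    simp [outputCmd, Cmd.eval_scal_self, RExpr.eval, RExpr.cell, Ix.eval, g1 3 (by decide),
      f1 3 (by decide)]
  · have hgs : gramSchmidt ℝ (residualVec w r) k = 0 := by
      by_contra h0; exact h (test.2 h0)
    exact Halts.instr ⟨r₁, e₁, fun _ => by rw [f1 7 (by decide)], fun h0 => absurd hgs h0⟩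

theorem rowMajor_mul_add {n m : ℕ} (A : Matrix (Fin n) (Fin m) ℝ) (i : Fin n) (j : Fin m) :
    rowMajor A (i * m + j) = A i j := by
  have h : (i : ℕ) * m + j < n * m := by
    calc (i : ℕ) * m + j < i * m + m := by omega
      _ = (i + 1) * m := by ring
      _ ≤ n * m := Nat.mul_le_mul_right _ i.2
  rw [rowMajor, dif_pos h]
  have hm : 0 < m := j.pos
  congr 1
  · ext
    change ((i : ℕ) * m + j) / m = i
    rw [mul_comm, Nat.mul_add_div hm, Nat.div_eq_of_lt j.2, add_zero]
  · ext
    change ((i : ℕ) * m + j) % m = j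
    rw [mul_comm, Nat.mul_add_mod, Nat.mod_eq_of_lt j.2]

/-- The outcome of the computation. -/
def Outcome {n k p : ℕ} (ε δ : ℝ) (X : Matrix (Fin n) (Fin (k + 1)) ℝ) (y : Fin n → ℝ)
    (Z : Matrix (Fin n) (Fin p) ℝ) (o : ℝ) : Prop :=
  (1 / 2 ≤ ε → o = n) ∧ (ε < 1 / 2 → 1 ≤ ε * (δ * δ) → o = 0) ∧
  (ε < 1 / 2 → ε * (δ * δ) < 1 →
    (gramSchmidt ℝ (residualColumns X y) k = 0 → o = 0) ∧
    (gramSchmidt ℝ (residualColumns X y) k ≠ 0 → ∃ b,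
      IsBest (2 * (k + 1 : ℕ) / (ε * (δ * δ))) (n / (δ * δ)) k p (residualColumns X y)
        (instrumentColumns Z) (odometerLength k ⌊2 * (2 * (k + 1 : ℕ) / (ε * (δ * δ)))⌋₊) b ∧
      o = n - b + 2 * (ε * n) + 1))

open Classical in
theorem ivProgram_halts {n k p : ℕ} {ε δ : ℝ} (hε : 0 < ε) (hδ : 0 < δ)
    (X : Matrix (Fin n) (Fin (k + 1)) ℝ) (y : Fin n → ℝ) (Z : Matrix (Fin n) (Fin p) ℝ) :
    Halts ivProgram (input ε δ X y Z) (exitCmd.cost 0 + 5 +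
      if ε * (δ * δ) < 1 ∧ ε < 1 / 2 then mainCost (n + (k + 1) + p)
        (odometerLength k ⌊2 * (2 * (k + 1 : ℕ) / (ε * (δ * δ)))⌋₊) ⌈n * (n / (δ * δ))⌉₊ else 0)
      fun s => Outcome ε δ X y Z s.output := by
  set s₀ := input ε δ X y Z with hs₀
  set w : ℕ → ℕ := s₀.word 0 with hw
  have w0 : w 0 = n := rfl
  have w1 : w 1 = k + 1 := rfl
  have w2 : w 2 = p := rfl
  have hB : ∀ v, w v ≤ n + (k + 1) + p := fun v => by
    match v with
    | 0 => rw [w0]; omega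
    | 1 => rw [w1]; omega
    | 2 => rw [w2]; omega
    | v + 3 => exact Nat.zero_le _
  set T := if ε * (δ * δ) < 1 ∧ ε < 1 / 2 then mainCost (n + (k + 1) + p)
        (odometerLength k ⌊2 * (2 * (k + 1 : ℕ) / (ε * (δ * δ)))⌋₊) ⌈n * (n / (δ * δ))⌉₊ else 0
    with hT
  refine Halts.mono (t := 1 + (1 + (exitCmd.cost 0 + ((T + 1 + 1) + 1)))) ?_ (by omega)
    fun _ h => h
  refine Halts.block_cons (Halts.instr (Halts.block_cons (Halts.instr ?_)))
  -- The parameters arrive in real array `0`, which compiled code uses for temporaries, so they are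
  -- moved away before anything else runs.
  set s₁ := Instr.apply (Instr.apply s₀ (.rmove (.cell 4 0) (.cell 0 0)))
    (.rmove (.cell 5 0) (.cell 0 1)) with hs₁
  set r : ℕ → ℕ → ℝ := fun a => s₁.real (a + 1) with hr
  have rel : Rel s₁ w r := ⟨rfl, fun _ => rfl⟩
  have r0 : r 0 = rowMajor X := rfl
  have r1 : r 1 = fun k => if h : k < n then y ⟨k, h⟩ else 0 := rfl
  have r2 : r 2 = rowMajor Z := rfl
  have r3 : r 3 0 = ε := rfl
  have r4 : r 4 0 = δ := rfl
  refine Halts.block_cons ((exitCmd.halts 0 rel hB).mono (le_of_eq rfl) ?_)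
  rintro s₂ ⟨e₂, -⟩
  obtain ⟨f1, f5, f6, f7, f8⟩ := exitCmd_eval w r
  rw [r3, r4] at f5 f8
  rw [r3, w0] at f7
  set r₂ := exitCmd.eval w r with hr₂
  have hf : (residualVec w r₂ : ℕ → EuclideanSpace ℝ (Fin n)) = residualColumns X y := by
    ext j i
    simp only [residualVec, vecOf, residualColumns, f1 0 (by decide), f1 1 (by decide), r0, r1, w1]
    split_ifs with h1 h2
    · exact rowMajor_mul_add X i ⟨j + 1, h1⟩
    · rfl
    · exact absurd i.2 h2
  have hg : (instrumentVec w r₂ : ℕ → EuclideanSpace ℝ (Fin n)) = instrumentColumns Z := by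
    ext j i
    simp only [instrumentVec, vecOf, instrumentColumns, f1 2 (by decide), r2, w2]
    split_ifs with h1
    · exact rowMajor_mul_add Z i ⟨j, h1⟩
    · rfl
  have test : (Test.rlt (.cell 9 0) (.cell 7 0)).Holds s₂ ↔ ε * (δ * δ) < 1 ∧ ε < 1 / 2 := by
    change s₂.real (8 + 1) 0 < s₂.real (6 + 1) 0 ↔ _
    rw [e₂.2, e₂.2, f6, f8]
    split_ifs with h1 h2 <;> simp <;> first | exact ⟨h2, by linarith⟩ | grind
  refine Halts.block_cons ((Halts.ite (t := T) (t' := 1) (Q := fun s => ∃ r', Rel s w r' ∧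
    Outcome ε δ X y Z (r' 7 0)) (fun h => ?_) fun h => ?_).mono le_rfl ?_)
  · have hc := test.1 h
    have hmain := mainProgram_halts e₂ hB w1 (by rw [f5]; positivity) (by rw [f5]; exact hc.1)
      (by rw [f1 4 (by decide), r4]; exact hδ) f6 rfl rfl
    rw [f5, f1 4 (by decide), f1 3 (by decide), r3, r4, f7, if_pos hc.2] at hmain
    refine hmain.mono ?_ ?_
    · rw [hT, if_pos hc]
      exact le_rfl
    · rintro s₃ ⟨r₃, e₃, h1, h2⟩
      refine ⟨r₃, e₃, fun h => absurd hc.2 (not_lt.2 h), fun _ h => absurd hc.1 (not_lt.2 h),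
        fun _ _ => ⟨fun h => h1 ?_, fun h => ?_⟩⟩
      · have := congrArg (fun f => gramSchmidt ℝ f k) hf
        exact this.trans h
      · have := congrArg (fun f => gramSchmidt ℝ f k) hf
        obtain ⟨b, hb, ho⟩ := h2 fun h0 => h (this.symm.trans h0)
        refine ⟨b, ?_, ho⟩
        rw [← hf, ← hg]
        exact hb
  · refine Halts.instr ⟨r₂, e₂, fun h' => ?_, fun h' _ => ?_, fun h1 h2 => ?_⟩
    · rw [f7, if_neg (not_lt.2 h')]
    · rw [f7, if_pos h']
    · exact absurd (test.2 ⟨h2, h1⟩) h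
  · rintro s₃ ⟨r₃, e₃, ho⟩
    refine Halts.block_single (Halts.instr ?_)
    change Outcome ε δ X y Z (s₃.real (7 + 1) 0)
    rw [e₃.2]
    exact ho

end RealRAM

open Finset InnerProductSpace RealRAM

/-! ### The number of steps -/

namespace RealRAM

/-- The factor `k!` in the denominator of the binomial coefficient compensates the growth of `(k +
1)^k`, through `x^k / k! ≤ exp x`; only an exponential in `k` remains next to `γ^(-k)`. -/
theorem odometerLength_le {k : ℕ} {γ : ℝ} (hγ : 0 < γ) (hγ1 : γ ≤ 1) :
    (odometerLength k ⌊2 * (2 * (k + 1 : ℕ) / γ)⌋₊ : ℝ) ≤ 15 ^ (k + 1) / γ ^ k := by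
  set D : ℝ := ((k + 1 : ℕ) : ℝ) with hD
  have hD0 : 0 < D := by positivity
  set b := ⌊2 * (2 * D / γ)⌋₊ with hb
  have h1 : (b : ℝ) ≤ 4 * D / γ := (Nat.floor_le (by positivity)).trans_eq (by ring)
  have h2 : ((b + k : ℕ) : ℝ) ≤ 5 * D / γ := by
    have : (k : ℝ) ≤ D / γ := by
      rw [le_div_iff₀ hγ]
      calc (k : ℝ) * γ ≤ k * 1 := by gcongr
        _ ≤ D := by rw [hD]; push_cast; linarith
    push_cast
    calc (b : ℝ) + k ≤ 4 * D / γ + D / γ := add_le_add h1 this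
      _ = _ := by ring
  have h3 : D ^ k / k.factorial ≤ 3 ^ (k + 1) := by
    calc D ^ k / k.factorial ≤ Real.exp D := Real.pow_div_factorial_le_exp D hD0.le k
      _ = Real.exp 1 ^ (k + 1) := by rw [← Real.exp_nat_mul, mul_one]
      _ ≤ 3 ^ (k + 1) := by gcongr; exact Real.exp_one_lt_three.le
  calc (odometerLength k b : ℝ) ≤ ((b + k : ℕ) : ℝ) ^ k / k.factorial :=
        Nat.choose_le_pow_div k (b + k)
    _ ≤ (5 * D / γ) ^ k / k.factorial := by gcongr
    _ = 5 ^ k * (D ^ k / k.factorial) / γ ^ k := by rw [div_pow, mul_pow]; ring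
    _ ≤ 5 ^ (k + 1) * 3 ^ (k + 1) / γ ^ k := by
        gcongr
        · norm_num
        · omega
    _ = 15 ^ (k + 1) / γ ^ k := by rw [← mul_pow]; norm_num

/-- For `d ≥ (c + 1)²` already `c ≤ √d`; the finitely many smaller `d` are covered by the constant.
-/
theorem exists_pow_le_sqrt_pow (c : ℕ) :
    ∃ C : ℕ, ∀ d : ℕ, 0 < d → (c : ℝ) ^ d ≤ C * √(d : ℝ) ^ d := by
  refine ⟨(c + 1) ^ ((c + 1) * (c + 1)), fun d hd => ?_⟩
  have h1 : (1 : ℝ) ≤ √(d : ℝ) := Real.one_le_sqrt.2 (by exact_mod_cast hd)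
  have hC : (1 : ℝ) ≤ ((c + 1) ^ ((c + 1) * (c + 1)) : ℕ) := by
    exact_mod_cast Nat.one_le_pow _ _ (by omega)
  rcases le_total d ((c + 1) * (c + 1)) with h | h
  · calc (c : ℝ) ^ d ≤ (c + 1 : ℝ) ^ d := by gcongr; linarith
      _ ≤ (c + 1 : ℝ) ^ ((c + 1) * (c + 1)) := by
          gcongr
          linarith [Nat.cast_nonneg (α := ℝ) c]
      _ = ((c + 1) ^ ((c + 1) * (c + 1)) : ℕ) * 1 := by push_cast; ring
      _ ≤ _ := by gcongr; exact one_le_pow₀ h1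
  · have h2 : (c : ℝ) ≤ √(d : ℝ) := by
      apply Real.le_sqrt_of_sq_le
      have : c ^ 2 ≤ d := by nlinarith
      exact_mod_cast this
    calc (c : ℝ) ^ d ≤ 1 * √(d : ℝ) ^ d := by rw [one_mul]; gcongr
      _ ≤ _ := by gcongr

theorem exists_pow_mul_pow_le (c K : ℕ) :
    ∃ C : ℕ, ∀ d : ℕ, 0 < d → ((d : ℝ) + 1) ^ K * c ^ d ≤ C * √(d : ℝ) ^ d := by
  obtain ⟨C, hC⟩ := exists_pow_le_sqrt_pow (3 * c)
  refine ⟨K.factorial * 3 * C, fun d hd => ?_⟩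
  have h1 : ((d : ℝ) + 1) ^ K ≤ K.factorial * 3 ^ (d + 1) := by
    have := Real.pow_div_factorial_le_exp ((d : ℝ) + 1) (by positivity) K
    rw [div_le_iff₀ (by positivity)] at this
    calc _ ≤ _ := this
      _ = Real.exp 1 ^ (d + 1) * K.factorial := by
          rw [← Real.exp_nat_mul, mul_one]; push_cast; rfl
      _ ≤ 3 ^ (d + 1) * K.factorial := by gcongr; exact Real.exp_one_lt_three.le
      _ = _ := mul_comm _ _
  calc ((d : ℝ) + 1) ^ K * c ^ d ≤ K.factorial * 3 ^ (d + 1) * c ^ d := by gcongr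
    _ = K.factorial * 3 * ((3 * c : ℕ) : ℝ) ^ d := by push_cast; rw [mul_pow, pow_succ]; ring
    _ ≤ K.factorial * 3 * (C * √(d : ℝ) ^ d) := by gcongr; exact hC d hd
    _ = _ := by push_cast; ring

theorem mainCost_le : ∃ K : ℕ, ∀ B N m : ℕ,
    mainCost B N m ≤ K * (B + 1) ^ K * ((N + 1) * (m + 1)) := by
  obtain ⟨K, hK⟩ := (((setupCmd.polyBounded_cost.add pointCmd.polyBounded_cost).add
    (stepCmd.polyBounded_cost.add valueCmd.polyBounded_cost)).add
    (nextCmd.polyBounded_cost.add outputCmd.polyBounded_cost)).add (.const 5)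
  refine ⟨K, fun B N m => le_trans ?_ (Nat.mul_le_mul_right _ (hK B))⟩
  simp only [mainCost, pointCost]
  generalize setupCmd.cost B = a
  generalize pointCmd.cost B = b
  generalize stepCmd.cost B = c
  generalize valueCmd.cost B = d
  generalize nextCmd.cost B = e
  generalize outputCmd.cost B = f
  nlinarith [Nat.zero_le (N * m), Nat.zero_le (a * (N * m)), Nat.zero_le (a * N),
    Nat.zero_le (a * m), Nat.zero_le (b * (N * m)), Nat.zero_le (b * m), Nat.zero_le (b * N),
    Nat.zero_le (c * (N * m)), Nat.zero_le (c * N), Nat.zero_le (c * m),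
    Nat.zero_le (d * (N * m)), Nat.zero_le (d * m), Nat.zero_le (d * N),
    Nat.zero_le (e * (N * m)), Nat.zero_le (e * m), Nat.zero_le (e * N),
    Nat.zero_le (f * (N * m)), Nat.zero_le (f * m), Nat.zero_le (f * N)]

/-- The net contributes `γ^(-k)`. The rounds per point contribute `n² / δ² = ε n² / γ ≤ n² / γ`,
completing the exponent to `k + 1`. The factor `15^d` and the polynomial dependence on `d` disappear
in `√d ^ d`. -/
theorem exists_mainCost_le : ∃ C e : ℕ, ∀ (n k p : ℕ) (ε δ : ℝ), 0 < ε → 0 < δ →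
    ε * (δ * δ) < 1 → ε < 1 / 2 →
    (mainCost (n + (k + 1) + p) (odometerLength k ⌊2 * (2 * (k + 1 : ℕ) / (ε * (δ * δ)))⌋₊)
      ⌈n * (n / (δ * δ))⌉₊ : ℝ) ≤
      C * ((n : ℝ) + p + 1) ^ e * (√((k + 1 : ℕ) : ℝ) / (ε * δ ^ 2)) ^ (k + 1) := by
  obtain ⟨K, hK⟩ := mainCost_le
  obtain ⟨C, hC⟩ := exists_pow_mul_pow_le 15 K
  refine ⟨K * 2 * 2 * C, K + 2, fun n k p ε δ hε hδ hγ hε2 => ?_⟩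
  set γ := ε * (δ * δ) with hγdef
  have hγ0 : 0 < γ := by positivity
  set N := odometerLength k ⌊2 * (2 * (k + 1 : ℕ) / γ)⌋₊ with hN
  set m := ⌈n * (n / (δ * δ))⌉₊ with hm
  set A : ℝ := (n : ℝ) + p + 1 with hA
  set D : ℝ := ((k + 1 : ℕ) : ℝ) with hD
  have hn0 : (0 : ℝ) ≤ n := Nat.cast_nonneg n
  have hp0 : (0 : ℝ) ≤ p := Nat.cast_nonneg p
  have hD1 : (1 : ℝ) ≤ D := by rw [hD]; exact_mod_cast Nat.le_add_left 1 k
  have hN' : (N : ℝ) + 1 ≤ 2 * (15 ^ (k + 1) / γ ^ k) := by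
    have h1 : (1 : ℝ) ≤ 15 ^ (k + 1) / γ ^ k := by
      rw [le_div_iff₀ (by positivity), one_mul]
      exact (pow_le_one₀ hγ0.le hγ.le).trans (one_le_pow₀ (by norm_num))
    linarith [odometerLength_le (k := k) hγ0 hγ.le]
  have hm' : (m : ℝ) + 1 ≤ 2 * A ^ 2 / γ := by
    have h1 : (m : ℝ) < n * (n / (δ * δ)) + 1 := Nat.ceil_lt_add_one (by positivity)
    have h2 : (n : ℝ) * (n / (δ * δ)) ≤ n ^ 2 / γ := by
      rw [hγdef]
      calc (n : ℝ) * (n / (δ * δ)) = n ^ 2 * ε / (ε * (δ * δ)) := by field_simp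
        _ ≤ n ^ 2 * 1 / (ε * (δ * δ)) := by gcongr; linarith
        _ = _ := by rw [mul_one]
    have h3 : (2 : ℝ) ≤ 2 / γ := by rw [le_div_iff₀ hγ0]; linarith
    calc (m : ℝ) + 1 ≤ n ^ 2 / γ + 2 / γ := by linarith
      _ = (n ^ 2 + 2) / γ := by ring
      _ ≤ 2 * A ^ 2 / γ := by gcongr; rw [hA]; nlinarith
  have hB : (((n + (k + 1) + p : ℕ) : ℝ) + 1) ≤ A * (D + 1) := by
    rw [hA]; push_cast; rw [← Nat.cast_succ, ← hD]; nlinarith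
  have hK' : (mainCost (n + (k + 1) + p) N m : ℝ) ≤
      K * (((n + (k + 1) + p : ℕ) : ℝ) + 1) ^ K * (((N : ℝ) + 1) * (m + 1)) := by
    exact_mod_cast hK (n + (k + 1) + p) N m
  have hC' := hC (k + 1) (Nat.succ_pos k)
  rw [← hD] at hC'
  calc (mainCost (n + (k + 1) + p) N m : ℝ)
      ≤ K * (A * (D + 1)) ^ K * ((2 * (15 ^ (k + 1) / γ ^ k)) * (2 * A ^ 2 / γ)) := by
        refine hK'.trans ?_
        gcongr
    _ = K * 2 * 2 * A ^ (K + 2) * ((D + 1) ^ K * (15 : ℕ) ^ (k + 1)) / γ ^ (k + 1) := by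
        rw [mul_pow, pow_add, pow_succ γ]; push_cast; field_simp; ring
    _ ≤ K * 2 * 2 * A ^ (K + 2) * (C * √D ^ (k + 1)) / γ ^ (k + 1) := by gcongr
    _ = _ := by
        rw [div_pow, hγdef, sq δ]; push_cast; ring

end RealRAM

/-! ### Assembly of the theorem -/

theorem mainTheorem9 :
    ∃ (P : RealRAM.Program) (C k : ℕ),
      ∀ (n d p : ℕ) [NeZero d] (ε δ : ℝ), 0 < ε → 0 < δ →
        ∀ (X : Matrix (Fin n) (Fin d) ℝ) (y : Fin n → ℝ) (Z : Matrix (Fin n) (Fin p) ℝ),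
          ∃ (t : ℕ) (s : RealRAM.State),
            RealRAM.Exec P (RealRAM.input ε δ X y Z) t s ∧
            (t : ℝ) ≤ C * ((n : ℝ) + p + 1) ^ k * max 1 ((√(d : ℝ) / (ε * δ ^ 2)) ^ d) ∧
            (IVStrongAntiConcentration ε δ X y Z →
              ivStability X y Z ≤ s.output ∧
              s.output ≤ ivStability X y Z + 3 * ε * n + 1) := by
  obtain ⟨C, e, hC⟩ := RealRAM.exists_mainCost_le
  refine ⟨ivProgram, exitCmd.cost 0 + 5 + C, e, fun n d p _ ε δ hε hδ X y Z => ?_⟩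
  obtain ⟨k, rfl⟩ : ∃ k, d = k + 1 := Nat.exists_eq_succ_of_ne_zero (NeZero.ne d)
  obtain ⟨t, s, hex, ht, ho1, ho2, ho3⟩ := ivProgram_halts hε hδ X y Z
  have hn0 : (0 : ℝ) ≤ n := Nat.cast_nonneg n
  have hεn : 0 ≤ ε * n := by positivity
  refine ⟨t, s, hex, ?_, fun hA => ?_⟩
  · have hA1 : (1 : ℝ) ≤ ((n : ℝ) + p + 1) ^ e :=
      one_le_pow₀ (by linarith [Nat.cast_nonneg (α := ℝ) p])
    set M := max 1 ((√((k + 1 : ℕ) : ℝ) / (ε * δ ^ 2)) ^ (k + 1)) with hM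
    have hM1 : 1 ≤ M := le_max_left _ _
    have h1 : (exitCmd.cost 0 + 5 : ℝ) ≤ (exitCmd.cost 0 + 5) * ((n : ℝ) + p + 1) ^ e * M := by
      rw [mul_assoc]
      exact le_mul_of_one_le_right (by positivity) (one_le_mul_of_one_le_of_one_le hA1 hM1)
    have h2 : (t : ℝ) ≤ (exitCmd.cost 0 + 5) + C * ((n : ℝ) + p + 1) ^ e * M := by
      refine (Nat.cast_le.2 ht).trans ?_
      split_ifs with hc
      · rw [Nat.cast_add, Nat.cast_add, Nat.cast_ofNat]
        gcongr
        refine (hC n k p ε δ hε hδ hc.1 hc.2).trans ?_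
        gcongr
        exact le_max_right _ _
      · push_cast
        rw [add_zero]
        exact le_add_of_nonneg_right (by positivity)
    push_cast
    linarith
  · rcases le_or_gt (1 / 2) ε with h | h
    -- Here `3 ε n ≥ n`, so the trivial bound `n` is already within the tolerance.
    · rw [ho1 h]
      refine ⟨ivStability_le_card, ?_⟩
      have := ivStability_nonneg (X := X) (y := y) (Z := Z)
      nlinarith
    suffices H : s.output = 0 ∧ ivStability X y Z = 0 ∨
        ivStability X y Z ≤ s.output ∧ s.output ≤ ivStability X y Z + 3 * ε * n + 1 by
      rcases H with ⟨h1, h2⟩ | H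
      · rw [h1, h2]
        exact ⟨le_rfl, by linarith⟩
      · exact H
    rcases le_or_gt 1 (ε * (δ * δ)) with hγ | hγ
    · refine Or.inl ⟨ho2 h hγ, ivStability_eq_zero (β := 0) ?_⟩
      have := (hA.2 0).eq_zero hδ h hγ
      rwa [sub_eq_zero] at this
    obtain ⟨hg0, hg1⟩ := ho3 h hγ
    by_cases hgs : InnerProductSpace.gramSchmidt ℝ (residualColumns X y) k = 0
    · refine Or.inl ⟨hg0 hgs, ?_⟩
      have hmem := mem_span_of_gramSchmidt_eq_zero hgs
      rw [mem_span_residualColumns, residualColumns_last] at hmem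
      obtain ⟨β, hβ⟩ := hmem
      exact ivStability_eq_zero (β := β) (WithLp.toLp_injective 2 hβ).symm
    · right
      obtain ⟨b, hb, ho⟩ := hg1 hgs
      have hn : 0 < n := by
        refine Nat.pos_of_ne_zero ?_
        rintro rfl
        exact hgs (Subsingleton.elim _ _)
      constructor
      · rw [ho]
        rcases hb.1 with rfl | ⟨a, ha, hv⟩
        -- If no net point improved on `0`, the output is at least `n`, which always bounds the
        -- stability.
        · linarith [ivStability_le_card (X := X) (y := y) (Z := Z)]
        · linarith [ivStability_le_of_isValue hε hδ hn hA hgs ha hv]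
      · have hL1 : 1 ≤ 2 * (2 * ((k + 1 : ℕ) : ℝ) / (ε * (δ * δ))) := by
          have h1 : (1 : ℝ) ≤ (k + 1 : ℕ) := by exact_mod_cast Nat.le_add_left 1 k
          have h2 : 2 ≤ 2 * ((k + 1 : ℕ) : ℝ) / (ε * (δ * δ)) := by
            rw [le_div_iff₀ (by positivity)]; nlinarith
          linarith
        linarith [le_ivStability_of_isBest hε hδ hgs rfl hb hL1]
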